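/- Let $\mathsf{Solv}$ be $\mathbb{R}^3$ with the group law $(x,y,z)\cdot(x',y',z')=(x+e^{-z}x',\,y+e^{z}y',\,z+z')$ and the left-invariant metric $e^{2z}dx^2+e^{-2z}dy^2+dz^2$. A $\mathsf{Solv}$ rational homology sphere is here a closed orientable Riemannian $3$-manifold $Y=\pi\backslash\mathsf{Solv}$ with $b_1(Y)=0$, where $\pi$ is a group of orientation-preserving isometries of $\mathsf{Solv}$ acting freely, properly discontinuously and cocompactly, such that $Y$ has a double cover of the form $\tilde Y=\Gamma\backslash\mathsf{Solv}$ with $\Gamma\subset\mathsf{Solv}$ a lattice acting by left translations (equivalently, $\pi$ has an index-two subgroup consisting of left translations). The fibers of $Y$ are the images of the planes $z=\mathrm{const}$, with their induced flat metrics. For $s>0$ let $\delta_s(x,y,z)=(sx,sy,z)$, and let $Y_s=(\delta_s\pi\delta_s^{-1})\backslash\mathsf{Solv}$ be obtained from $Y$ by rescaling the fibers by $s$. Let $\lambda_1^*(Y)$ be the smallest eigenvalue of the Hodge Laplacian $\Delta=d\delta+\delta d$ acting on smooth real coexact $1$-forms on $Y$. (1) There is a constant $\varepsilon>0$ such that every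 $\mathsf{Solv}$ rational homology sphere $Y$ all of whose fibers have intrinsic diameter less than $\varepsilon$ satisfies $\lambda_1^*(Y)=1$, and the space of coexact $1$-forms $\xi$ on $Y$ with $\Delta\xi=\xi$ is one-dimensional. (2) For every $\mathsf{Solv}$ rational homology sphere $Y$ there is $s_0>0$ such that for all $0<s<s_0$ the manifold $Y_s$ is again a $\mathsf{Solv}$ rational homology sphere, $\lambda_1^*(Y_s)=1$, and its space of coexact $1$-forms $\xi$ with $\Delta\xi=\xi$ is one-dimensional. -/

import Mathlib

open scoped ContDiff

noncomputable section

namespace SolvGeometry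

/-- The underlying smooth manifold `ℝ³` of the model geometry `Solv`,
with coordinates `x = p 0`, `y = p 1`, `z = p 2`. -/
abbrev Solv : Type := Fin 3 → ℝ

/-- The Riemannian metric `e^{2z} dx² + e^{-2z} dy² + dz²` at the point `p`. -/
def metric (p u v : Solv) : ℝ :=
  Real.exp (2 * p 2) * (u 0 * v 0) + Real.exp (-2 * p 2) * (u 1 * v 1) + u 2 * v 2

/-- The solvable Lie group structure
`(x, y, z) · (x', y', z') = (x + e^{-z} x', y + e^{z} y', z + z')`. -/
def mul (q p : Solv) : Solv :=
  ![q 0 + Real.exp (-(q 2)) * p 0, q 1 + Real.exp (q 2) * p 1, q 2 + p 2]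

/-- `φ` is a left translation of the Lie group `Solv`. -/
def IsLeftTranslation (φ : Solv → Solv) : Prop := ∃ q : Solv, ∀ p, φ p = mul q p

/-- `φ` is smooth and preserves the Riemannian metric. -/
def IsIsometry (φ : Solv → Solv) : Prop :=
  ContDiff ℝ ∞ φ ∧
    ∀ p u v : Solv, metric (φ p) (fderiv ℝ φ p u) (fderiv ℝ φ p v) = metric p u v

/-- `φ` preserves the orientation of `ℝ³`. -/
def PreservesOrientation (φ : Solv → Solv) : Prop := ∀ p, 0 < (fderiv ℝ φ p).det

/-! ### Differential forms -/

/-- Differential forms of degree `k` on `Solv`. -/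
abbrev Form (k : ℕ) : Type := Solv → Solv [⋀^Fin k]→L[ℝ] ℝ

/-- `α` is (the pullback to `Solv` of) a smooth `k`-form on the quotient of `Solv` by `π`, that is,
a smooth form which is invariant under pullback by all elements of `π`. -/
def IsFormOnQuotient (π : Subgroup (Equiv.Perm Solv)) {k : ℕ} (α : Form k) : Prop :=
  ContDiff ℝ ∞ α ∧
    ∀ γ ∈ π, ∀ p, (α (γ p)).compContinuousLinearMap (fderiv ℝ γ p) = α p

/-- The left-invariant oriented orthonormal frame `e^{-z} ∂x, e^{z} ∂y, ∂z`. -/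
def frame (p : Solv) : Fin 3 → Solv :=
  ![![Real.exp (-(p 2)), 0, 0], ![0, Real.exp (p 2), 0], ![0, 0, 1]]

/-- The Riemannian volume form. The metric has determinant `1` in the coordinates `x, y, z`, so this
is `dx ∧ dy ∧ dz`. -/
def vol : Solv [⋀^Fin 3]→L[ℝ] ℝ :=
  { (Pi.basisFun ℝ (Fin 3)).det with
    cont := by
      change Continuous fun v => (Pi.basisFun ℝ (Fin 3)).det v
      simp only [Pi.basisFun_det]
      exact Continuous.matrix_det continuous_id }

/-- The Hodge star from `1`-forms to `2`-forms, `⋆α = ∑ᵢ α(Eᵢ) vol(Eᵢ, ·, ·)` for the oriented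
orthonormal frame `E`. -/
def star₁ (α : Form 1) : Form 2 := fun p =>
  ∑ i, α p ![frame p i] • vol.curryLeft (frame p i)

/-- The Hodge star from `2`-forms to `1`-forms,
`⋆α = ½ ∑ᵢⱼ α(Eᵢ, Eⱼ) vol(Eᵢ, Eⱼ, ·)`. -/
def star₂ (α : Form 2) : Form 1 := fun p =>
  (1 / 2 : ℝ) • ∑ i, ∑ j,
    α p ![frame p i, frame p j] • (vol.curryLeft (frame p i)).curryLeft (frame p j)

/-- The Hodge star from `3`-forms to `0`-forms, `⋆α = α(E₀, E₁, E₂)`. -/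
def star₃ (α : Form 3) : Form 0 := fun p =>
  ContinuousAlternatingMap.constOfIsEmpty ℝ Solv (Fin 0) (α p (frame p))

/-- The codifferential `δ = -⋆d⋆` on `1`-forms. -/
def codiff₁ (α : Form 1) : Form 0 := -star₃ (extDeriv (star₁ α))

/-- The codifferential `δ = ⋆d⋆` on `2`-forms. -/
def codiff₂ (α : Form 2) : Form 1 := star₂ (extDeriv (star₂ α))

/-- The Hodge Laplacian `dδ + δd` on `1`-forms. -/
def hodgeLaplacian (α : Form 1) : Form 1 := extDeriv (codiff₁ α) + codiff₂ (extDeriv α)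

/-- `ξ` is a coexact `1`-form on the quotient of `Solv` by `π`. -/
def IsCoexact (π : Subgroup (Equiv.Perm Solv)) (ξ : Form 1) : Prop :=
  ∃ β : Form 2, IsFormOnQuotient π β ∧ ξ = codiff₂ β

/-- The coexact `1`-forms `ξ` on the quotient of `Solv` by `π` with `Δξ = λξ`. -/
def coexactEigenspace (π : Subgroup (Equiv.Perm Solv)) (l : ℝ) : Set (Form 1) :=
  {ξ | IsFormOnQuotient π ξ ∧ IsCoexact π ξ ∧ hodgeLaplacian ξ = l • ξ}

/-- The eigenvalues of the Hodge Laplacian on coexact `1`-forms on the quotient of `Solv`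
by `π`. -/
def coexactEigenvalues (π : Subgroup (Equiv.Perm Solv)) : Set ℝ :=
  {l | ∃ ξ ∈ coexactEigenspace π l, ξ ≠ 0}

/-! ### Solv manifolds -/

/-- `π` is a group of isometries of `Solv` acting freely, properly discontinuously and
cocompactly: the quotient of `Solv` by `π` is a closed `3`-manifold with a `Solv` metric. -/
structure IsSolvManifold (π : Subgroup (Equiv.Perm Solv)) : Prop where
  isometry : ∀ γ ∈ π, IsIsometry γ
  free : ∀ γ ∈ π, ∀ p, γ p = p → γ = 1
  properlyDiscontinuous : ∀ K : Set Solv, IsCompact K →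
    {γ : Equiv.Perm Solv | γ ∈ π ∧ (γ '' K ∩ K).Nonempty}.Finite
  cocompact : ∃ K : Set Solv, IsCompact K ∧ ∀ p, ∃ γ ∈ π, γ p ∈ K

/-- The first de Rham cohomology of the quotient of `Solv` by `π` vanishes, i.e. `b₁ = 0`. -/
def FirstBettiZero (π : Subgroup (Equiv.Perm Solv)) : Prop :=
  ∀ α : Form 1, IsFormOnQuotient π α → extDeriv α = 0 →
    ∃ f : Form 0, IsFormOnQuotient π f ∧ extDeriv f = α

/-- The quotient `Y` of `Solv` by `π` is a `Solv` rational homology sphere (a closed orientable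
`3`-manifold with `b₁ = 0`, carrying a `Solv` metric), and it has a double cover of the form
`Γ \ Solv` with `Γ` a group of left translations of the Lie group `Solv`. -/
structure IsSolvRationalHomologySphere (π : Subgroup (Equiv.Perm Solv)) : Prop
    extends IsSolvManifold π where
  orientable : ∀ γ ∈ π, PreservesOrientation γ
  firstBetti : FirstBettiZero π
  doubleCover : ∃ Γ : Subgroup (Equiv.Perm Solv), Γ ≤ π ∧ Γ.relIndex π = 2 ∧
    ∀ γ ∈ Γ, IsLeftTranslation γ

/-- The distance, in the induced (flat) metric of the plane `z = p 2`, between two points of that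
plane. -/
def planeDist (p q : Solv) : ℝ :=
  Real.sqrt (Real.exp (2 * p 2) * (p 0 - q 0) ^ 2 + Real.exp (-2 * p 2) * (p 1 - q 1) ^ 2)

/-- Every fiber (the image in the quotient of `Solv` by `π` of a plane `z = const`) has intrinsic
diameter less than `ε`. -/
def FibersSmallerThan (π : Subgroup (Equiv.Perm Solv)) (ε : ℝ) : Prop :=
  ∀ p q : Solv, p 2 = q 2 → ∃ γ ∈ π, (γ q) 2 = p 2 ∧ planeDist p (γ q) < ε

/-- The dilation `(x, y, z) ↦ (s x, s y, z)`. -/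
def fiberDilation (s : ℝ) (hs : s ≠ 0) : Equiv.Perm Solv where
  toFun p := ![s * p 0, s * p 1, p 2]
  invFun p := ![s⁻¹ * p 0, s⁻¹ * p 1, p 2]
  left_inv p := by
    ext i; fin_cases i <;> simp [hs]
  right_inv p := by
    ext i; fin_cases i <;> simp [hs]

/-- The conjugate of `π` by the dilation by `s`. The quotient of `Solv` by it is diffeomorphic to
the quotient by `π`; its metric is obtained from the one of the latter by rescaling lengths along
the fibers by `s`. -/
def rescaleFibers (s : ℝ) (hs : s ≠ 0) (π : Subgroup (Equiv.Perm Solv)) :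
    Subgroup (Equiv.Perm Solv) :=
  π.map (MulAut.conj (fiberDilation s hs)).toMonoidHom

/-- The first eigenvalue of the Hodge Laplacian on coexact `1`-forms on the quotient of `Solv`
by `π` is `1`, and the eigenspace for the eigenvalue `1` is one-dimensional. -/
def FirstCoexactEigenvalueIsSimpleOne (π : Subgroup (Equiv.Perm Solv)) : Prop :=
  IsLeast (coexactEigenvalues π) 1 ∧
    ∃ η : Form 1, η ≠ 0 ∧ coexactEigenspace π 1 = (Submodule.span ℝ {η} : Set (Form 1))

end SolvGeometry

end

/-!
The components of a `1`-form in the left-invariant frame `E₀ = e^{-z} ∂x`, `E₁ = e^z ∂y`, `E₂ = ∂z`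
turn the equation `δdξ = lξ` for coexact `ξ` into the system
`Δf₀ = (1 - l) f₀ - 2 E₀f₂`, `Δf₁ = (1 - l) f₁ + 2 E₁f₂`, `Δf₂ = -l f₂ + 2 E₀f₀ - 2 E₁f₁`, where
`Δ = ∑ᵢ EᵢEᵢ`, together with `E₀f₀ + E₁f₁ + E₂f₂ = 0` (`isEigenSystem_of_mem`).

Let `l ≤ 1`, and let `g` be the increment of `f` by a horizontal vector `h`. It solves the same
system, is bounded, and has mean zero on every fiber. If the fibers are small, the Poincaré
inequality on the flat tori which are the fibers (`avg_sq_le`) bounds the mean `N(z)` of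
`∑ᵢ gᵢ²` by a small multiple of the mean of the fiberwise energy. The second derivative of `N`
contains twice that energy, which dominates the first order terms of the system, so `N'' ≥ 16 N`
at all heights where the fiber is a torus, hence everywhere by continuity; being bounded,
`N` vanishes. Hence `f` depends on `z` only (`IsEigenSystem.horizontal_const`). The
remaining ordinary differential equations have only constant bounded solutions
(`IsEigenSystem.eq_const`): `(0, 0, c)` for `l < 1`, and `(a, b, 0)` for `l = 1`.

It remains to use the elements of `π` outside of the lattice `Γ` of left translations. An isometry
normalizing `Γ` maps fibers to fibers, as seen from the fiberwise mean of its height function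
(`Normalizes.exists_height_eq`). If all of `π` preserved the direction of `z` then `dz` would
represent a nontrivial class on the quotient, so the vanishing of the first Betti number forces the
elements of `π` outside of `Γ` to reverse it; such an orientation-preserving isometry is
`(x, y, z) ↦ (ηy, ηx, -z)` for a sign `η` followed by a left translation
(`IsSolvRationalHomologySphere.exists_isFlipExtension`). Invariance under it excludes `(0, 0, c)`
and leaves the multiples of `η e^z dx + e^{-z} dy`, which is its own curl up to the sign `η`. So the
first coexact eigenvalue is `1`, and it is simple.

For the second assertion, conjugation by the dilation preserves the structure of `π` and multiplies
the diameters of the fibers by `s`; these are bounded because the quotient is compact and every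
fiber at bounded height has a basis of periods of bounded length.
-/

open scoped ContDiff

noncomputable section

namespace SolvGeometry

/-! ### Differential forms in the left-invariant frame -/

/-- The factors by which the frame `E₀, E₁, E₂` differs from the coordinate frame. -/
def frameScale (i : Fin 3) (p : Solv) : ℝ := ![Real.exp (-(p 2)), Real.exp (p 2), 1] i

/-- The derivative of the function `f` along the frame field `Eᵢ`. -/
def frameDeriv (i : Fin 3) (f : Solv → ℝ) (p : Solv) : ℝ := fderiv ℝ f p (frame p i)

/-- The component `ξ(Eᵢ)` of the `1`-form `ξ`. -/
def comp (ξ : Form 1) (i : Fin 3) (p : Solv) : ℝ := ξ p ![frame p i]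

/-- The `1`-form whose components in the coframe dual to `E` are `f 0, f 1, f 2`. -/
def ofComp (f : Fin 3 → Solv → ℝ) : Form 1 := fun p =>
  ContinuousAlternatingMap.ofSubsingleton ℝ Solv ℝ (0 : Fin 1)
    (∑ i, (f i p * (frameScale i p)⁻¹) •
      ContinuousLinearMap.proj (R := ℝ) (φ := fun _ : Fin 3 => ℝ) i)

lemma frameScale_pos (i : Fin 3) (p : Solv) : 0 < frameScale i p := by
  fin_cases i <;> simp [frameScale, Real.exp_pos]

lemma frame_eq (i : Fin 3) (p : Solv) : frame p i = frameScale i p • Pi.single i (1 : ℝ) := by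
  ext j; fin_cases i <;> fin_cases j <;> simp [frame, frameScale]

lemma contDiff_frameScale (i : Fin 3) : ContDiff ℝ ∞ (frameScale i) := by
  have h : ContDiff ℝ ∞ fun p : Solv => p 2 := contDiff_apply ℝ ℝ 2
  fin_cases i
  · exact Real.contDiff_exp.comp h.neg
  · exact Real.contDiff_exp.comp h
  · exact contDiff_const

lemma contDiff_frame (i : Fin 3) : ContDiff ℝ ∞ (fun p => frame p i) := by
  simp only [frame_eq]
  exact (contDiff_frameScale i).smul contDiff_const

lemma comp_ofComp (f : Fin 3 → Solv → ℝ) (i : Fin 3) : comp (ofComp f) i = f i := by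
  ext p
  have := (frameScale_pos i p).ne'
  simp [comp, ofComp, frame_eq, Pi.single_apply]
  field_simp

lemma contDiff_ofComp {f : Fin 3 → Solv → ℝ} (hf : ∀ i, ContDiff ℝ ∞ (f i)) :
    ContDiff ℝ ∞ (ofComp f) := by
  have h : ContDiff ℝ ∞ (fun p : Solv => ∑ i, (f i p * (frameScale i p)⁻¹) •
      ContinuousLinearMap.proj (R := ℝ) (φ := fun _ : Fin 3 => ℝ) i) := by
    refine ContDiff.sum fun i _ => ?_
    refine ContDiff.smul ((hf i).mul ?_) contDiff_const
    exact (contDiff_frameScale i).inv fun p => (frameScale_pos i p).ne'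
  exact (ContinuousAlternatingMap.ofSubsingletonLIE (𝕜 := ℝ) (E := Solv) (F := ℝ)
    (0 : Fin 1)).toContinuousLinearEquiv.contDiff.comp h

lemma apply_smul_vec (α : Solv [⋀^Fin 1]→L[ℝ] ℝ) (c : ℝ) (u : Solv) :
    α ![c • u] = c * α ![u] := by
  have h : ∀ v : Solv, α ![v] =
      (ContinuousAlternatingMap.ofSubsingleton ℝ Solv ℝ (0 : Fin 1)).symm α v := by
    intro v
    have e : (![v] : Fin 1 → Solv) = fun _ => v := by ext j; simp
    rw [e]; rfl
  rw [h, h, map_smul, smul_eq_mul]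

lemma form_one_ext_at {ξ η : Form 1} {p : Solv} (h : ∀ i, comp ξ i p = comp η i p) :
    ξ p = η p := by
  have key : (ξ p).toAlternatingMap = (η p).toAlternatingMap := by
    refine Module.Basis.ext_alternating (Pi.basisFun ℝ (Fin 3)) fun v _ => ?_
    have h1 := h (v 0)
    rw [comp, comp, frame_eq, apply_smul_vec, apply_smul_vec] at h1
    have h2 := mul_left_cancel₀ (frameScale_pos _ p).ne' h1
    have e : (fun i => Pi.basisFun ℝ (Fin 3) (v i)) = ![Pi.single (v 0) (1 : ℝ)] := by
      funext j; fin_cases j; simp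
    rw [e]; exact h2
  exact ContinuousAlternatingMap.toAlternatingMap_injective key

lemma form_one_ext {ξ η : Form 1} (h : ∀ i, comp ξ i = comp η i) : ξ = η :=
  funext fun p => form_one_ext_at fun i => congrFun (h i) p

lemma alternating_two_swap (α : Solv [⋀^Fin 2]→L[ℝ] ℝ) (u v : Solv) :
    α ![u, v] = -α ![v, u] := by
  have := α.toAlternatingMap.map_swap (i := 0) (j := 1) ![v, u] (by simp)
  have e : (![v, u] : Fin 2 → Solv) ∘ Equiv.swap 0 1 = ![u, v] := by
    funext i; fin_cases i <;> simp
  rwa [e] at this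

lemma alternating_two_self (α : Solv [⋀^Fin 2]→L[ℝ] ℝ) (u : Solv) : α ![u, u] = 0 :=
  α.map_eq_zero_of_eq (i := 0) (j := 1) _ (by simp) (by simp)

lemma vol_apply (u v w : Solv) :
    vol ![u, v, w] = u 0 * v 1 * w 2 - u 0 * v 2 * w 1 - u 1 * v 0 * w 2 + u 1 * v 2 * w 0
      + u 2 * v 0 * w 1 - u 2 * v 1 * w 0 := by
  change (Pi.basisFun ℝ (Fin 3)).det _ = _
  rw [Pi.basisFun_det]
  change Matrix.det (Matrix.of ![u, v, w]) = _
  rw [Matrix.det_fin_three]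
  simp

lemma comp_star₂ (α : Form 2) (p : Solv) :
    comp (star₂ α) 0 p = α p ![frame p 1, frame p 2] ∧
    comp (star₂ α) 1 p = α p ![frame p 2, frame p 0] ∧
    comp (star₂ α) 2 p = α p ![frame p 0, frame p 1] := by
  have hs : Real.exp (-(p 2)) * Real.exp (p 2) = 1 := by rw [← Real.exp_add]; simp
  have key : ∀ k, comp (star₂ α) k p = (1/2 : ℝ) * ∑ i, ∑ j,
      α p ![frame p i, frame p j] * vol ![frame p i, frame p j, frame p k] := by
    intro k
    simp [comp, star₂, ContinuousAlternatingMap.curryLeft_apply_apply]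
  have h10 := alternating_two_swap (α p) (frame p 1) (frame p 0)
  have h20 := alternating_two_swap (α p) (frame p 2) (frame p 0)
  have h21 := alternating_two_swap (α p) (frame p 2) (frame p 1)
  refine ⟨?_, ?_, ?_⟩
  · rw [key]
    simp only [Fin.sum_univ_three, vol_apply, alternating_two_self, h10, h20, h21]
    generalize α p ![frame p 1, frame p 2] = a
    generalize α p ![frame p 0, frame p 2] = b
    generalize α p ![frame p 0, frame p 1] = c
    simp [frame]
    linear_combination a * hs
  · rw [key, h20]
    simp only [Fin.sum_univ_three, vol_apply, alternating_two_self, h10, h20, h21]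
    generalize α p ![frame p 1, frame p 2] = a
    generalize α p ![frame p 0, frame p 2] = b
    generalize α p ![frame p 0, frame p 1] = c
    simp [frame]
    linear_combination -b * hs
  · rw [key]
    simp only [Fin.sum_univ_three, vol_apply, alternating_two_self, h10, h20, h21]
    generalize α p ![frame p 1, frame p 2] = a
    generalize α p ![frame p 0, frame p 2] = b
    generalize α p ![frame p 0, frame p 1] = c
    simp [frame]
    linear_combination c * hs

/-- The logarithmic derivatives of the factors `frameScale i` in the direction `z`. -/
def frameWeight (i : Fin 3) : ℝ := ![-1, 1, 0] i

lemma hasFDerivAt_frameScale (i : Fin 3) (p : Solv) :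
    HasFDerivAt (frameScale i) ((frameWeight i * frameScale i p) •
      ContinuousLinearMap.proj (R := ℝ) (φ := fun _ : Fin 3 => ℝ) 2) p := by
  have h : HasFDerivAt (fun p : Solv => p 2)
    (ContinuousLinearMap.proj (R := ℝ) (φ := fun _ : Fin 3 => ℝ) 2) p := hasFDerivAt_apply 2 p
  fin_cases i
  · refine (h.neg.exp).congr_fderiv ?_
    ext v; simp [frameWeight, frameScale]
  · refine (h.exp).congr_fderiv ?_
    ext v; simp [frameWeight, frameScale]
  · refine (hasFDerivAt_const (1 : ℝ) p).congr_fderiv ?_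
    ext v; simp [frameWeight, frameScale]

lemma contDiff_apply_const {k : ℕ} {α : Form k} (hα : ContDiff ℝ ∞ α) (v : Fin k → Solv) :
    ContDiff ℝ ∞ fun p => α p v :=
  (ContinuousAlternatingMap.apply ℝ Solv ℝ v).contDiff.comp hα

lemma contDiff_comp {ξ : Form 1} (hξ : ContDiff ℝ ∞ ξ) (i : Fin 3) : ContDiff ℝ ∞ (comp ξ i) := by
  have : comp ξ i = fun p => frameScale i p * ξ p ![Pi.single i 1] := by
    ext p
    rw [comp, frame_eq, apply_smul_vec]
  rw [this]
  exact (contDiff_frameScale i).mul (contDiff_apply_const hξ _)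

lemma contDiff_extDeriv {k : ℕ} {α : Form k} (hα : ContDiff ℝ ∞ α) :
    ContDiff ℝ ∞ (extDeriv α) := by
  have h : ContDiff ℝ ∞ (fderiv ℝ α) := hα.fderiv_right (by simp)
  exact (ContinuousAlternatingMap.alternatizeUncurryFinCLM ℝ Solv ℝ (n := k)).contDiff.comp h

lemma extDeriv_const {k : ℕ} (c : Solv [⋀^Fin k]→L[ℝ] ℝ) : extDeriv (fun _ => c : Form k) = 0 := by
  funext p
  rw [extDeriv, fderiv_fun_const, Pi.zero_apply]
  exact (ContinuousAlternatingMap.alternatizeUncurryFinCLM ℝ Solv ℝ (n := k)).map_zero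

lemma contDiff_star₂ {α : Form 2} (hα : ContDiff ℝ ∞ α) : ContDiff ℝ ∞ (star₂ α) := by
  have h : ∀ i j, ContDiff ℝ ∞ fun p => α p ![frame p i, frame p j] := by
    intro i j
    have e : (fun p => α p ![frame p i, frame p j]) = fun p =>
        frameScale i p * frameScale j p * α p ![Pi.single i 1, Pi.single j 1] := by
      ext p
      have := (α p).map_smul_univ ![frameScale i p, frameScale j p]
        ![Pi.single i 1, Pi.single j 1]
      rw [Fin.prod_univ_two] at this
      rw [frame_eq, frame_eq]
      refine Eq.trans ?_ this
      congr 1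
      funext k; fin_cases k <;> simp
    rw [e]
    exact ((contDiff_frameScale i).mul (contDiff_frameScale j)).mul (contDiff_apply_const hα _)
  have e : star₂ α = ofComp fun i => comp (star₂ α) i :=
    form_one_ext fun i => (comp_ofComp _ i).symm
  rw [e]
  refine contDiff_ofComp fun i => ?_
  fin_cases i
  · exact (funext fun p => (comp_star₂ α p).1 : comp (star₂ α) 0 = _) ▸ h 1 2
  · exact (funext fun p => (comp_star₂ α p).2.1 : comp (star₂ α) 1 = _) ▸ h 2 0
  · exact (funext fun p => (comp_star₂ α p).2.2 : comp (star₂ α) 2 = _) ▸ h 0 1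

/-- The value of `dξ` on two frame fields; the zeroth order terms come from the brackets
`[E₂, E₀] = -E₀` and `[E₂, E₁] = E₁`. -/
lemma extDeriv_frame {ξ : Form 1} (hξ : ContDiff ℝ ∞ ξ) (i j : Fin 3) (p : Solv) :
    extDeriv ξ p ![frame p i, frame p j] =
      (frameDeriv i (comp ξ j) p - frameWeight j * comp ξ j p * frame p i 2) -
      (frameDeriv j (comp ξ i) p - frameWeight i * comp ξ i p * frame p j 2) := by
  have key : ∀ (j : Fin 3) (u : Solv), fderiv ℝ (fun q => ξ q ![frame p j]) p u =
      fderiv ℝ (comp ξ j) p u - frameWeight j * comp ξ j p * u 2 := by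
    intro j u
    have hc : DifferentiableAt ℝ (fun q => ξ q ![Pi.single j 1]) p :=
      (contDiff_apply_const hξ _).differentiable (by simp) p
    have e1 : (fun q => ξ q ![frame p j]) = fun q => frameScale j p * ξ q ![Pi.single j 1] := by
      ext q; rw [frame_eq, apply_smul_vec]
    have e2 : comp ξ j = fun q => frameScale j q * ξ q ![Pi.single j 1] := by
      ext q; rw [comp, frame_eq, apply_smul_vec]
    rw [e1, e2, (hc.hasFDerivAt.const_mul _).fderiv,
      ((hasFDerivAt_frameScale j p).fun_mul hc.hasFDerivAt).fderiv]
    simp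
    ring
  rw [extDeriv_apply (hξ.differentiable (by simp) p), Fin.sum_univ_two]
  have e0 : (0 : Fin 2).removeNth ![frame p i, frame p j] = ![frame p j] := by
    funext k; fin_cases k; simp [Fin.removeNth]
  have e1 : (1 : Fin 2).removeNth ![frame p i, frame p j] = ![frame p i] := by
    funext k; fin_cases k; simp [Fin.removeNth]
  rw [e0, e1]
  simp only [Matrix.cons_val_zero, Matrix.cons_val_one]
  rw [key, key]
  simp only [frameDeriv]
  simp
  ring

/-- The components of the curl `⋆dξ`. -/
lemma comp_curl {ξ : Form 1} (hξ : ContDiff ℝ ∞ ξ) (p : Solv) :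
    comp (star₂ (extDeriv ξ)) 0 p =
      frameDeriv 1 (comp ξ 2) p - frameDeriv 2 (comp ξ 1) p + comp ξ 1 p ∧
    comp (star₂ (extDeriv ξ)) 1 p =
      frameDeriv 2 (comp ξ 0) p - frameDeriv 0 (comp ξ 2) p + comp ξ 0 p ∧
    comp (star₂ (extDeriv ξ)) 2 p =
      frameDeriv 0 (comp ξ 1) p - frameDeriv 1 (comp ξ 0) p := by
  obtain ⟨h0, h1, h2⟩ := comp_star₂ (extDeriv ξ) p
  rw [h0, h1, h2, extDeriv_frame hξ, extDeriv_frame hξ, extDeriv_frame hξ]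
  refine ⟨?_, ?_, ?_⟩ <;> simp [frame, frameWeight] <;> ring

lemma star₁_star₂ (α : Form 2) : star₁ (star₂ α) = α := by
  funext p
  have hs : Real.exp (-(p 2)) * Real.exp (p 2) = 1 := by rw [← Real.exp_add]; simp
  have h10 := alternating_two_swap (α p) (frame p 1) (frame p 0)
  have h20 := alternating_two_swap (α p) (frame p 2) (frame p 0)
  have h21 := alternating_two_swap (α p) (frame p 2) (frame p 1)
  obtain ⟨h0, h1, h2⟩ := comp_star₂ α p
  simp only [comp] at h0 h1 h2
  have key : ∀ i j, star₁ (star₂ α) p ![frame p i, frame p j] = α p ![frame p i, frame p j] := by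
    intro i j
    have e : star₁ (star₂ α) p ![frame p i, frame p j] =
        ∑ k, star₂ α p ![frame p k] * vol ![frame p k, frame p i, frame p j] := by
      simp [star₁, ContinuousAlternatingMap.curryLeft_apply_apply]
    rw [e]
    simp only [Fin.sum_univ_three, vol_apply, h0, h1, h2]
    fin_cases i <;> fin_cases j <;>
      simp only [Fin.zero_eta, Fin.mk_one, Fin.reduceFinMk, alternating_two_self, h10, h20, h21] <;>
      generalize α p ![frame p 1, frame p 2] = a <;>
      generalize α p ![frame p 0, frame p 2] = b <;>
      generalize α p ![frame p 0, frame p 1] = c <;>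
      simp [frame] <;> first
        | ring1
        | linear_combination a * hs
        | linear_combination -a * hs
        | linear_combination b * hs
        | linear_combination -b * hs
        | linear_combination c * hs
  have : (star₁ (star₂ α) p).toAlternatingMap = (α p).toAlternatingMap := by
    refine Module.Basis.ext_alternating (Pi.basisFun ℝ (Fin 3)) fun v _ => ?_
    have e : (fun i => Pi.basisFun ℝ (Fin 3) (v i)) = fun i =>
        (![(frameScale (v 0) p)⁻¹, (frameScale (v 1) p)⁻¹] : Fin 2 → ℝ) i •
          (![frame p (v 0), frame p (v 1)] : Fin 2 → Solv) i := by
      funext j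
      fin_cases j <;> simp [frame_eq, smul_smul, (frameScale_pos _ p).ne']
    rw [e]
    change (star₁ (star₂ α) p) _ = α p _
    rw [ContinuousAlternatingMap.map_smul_univ, ContinuousAlternatingMap.map_smul_univ, key]
  exact ContinuousAlternatingMap.toAlternatingMap_injective this

/-- Coexact forms are coclosed. -/
lemma codiff₁_codiff₂ {β : Form 2} (hβ : ContDiff ℝ ∞ β) : codiff₁ (codiff₂ β) = 0 := by
  rw [codiff₁, codiff₂, star₁_star₂,
    extDeriv_extDeriv (contDiff_star₂ hβ) (by simpa using ENat.LEInfty.out)]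
  funext p
  ext v
  simp [star₃]


/-! ### Calculus of the frame derivatives -/

lemma frameDeriv_eq (i : Fin 3) (f : Solv → ℝ) (p : Solv) :
    frameDeriv i f p = frameScale i p * fderiv ℝ f p (Pi.single i 1) := by
  rw [frameDeriv, frame_eq, map_smul, smul_eq_mul]

lemma contDiff_frameDeriv {f : Solv → ℝ} (hf : ContDiff ℝ ∞ f) (i : Fin 3) :
    ContDiff ℝ ∞ (frameDeriv i f) :=
  (hf.fderiv_right (m := ∞) (by simp)).clm_apply (contDiff_frame i)

lemma frameDeriv_add {f g : Solv → ℝ} (hf : ContDiff ℝ ∞ f) (hg : ContDiff ℝ ∞ g) (i : Fin 3)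
    (p : Solv) : frameDeriv i (fun q => f q + g q) p = frameDeriv i f p + frameDeriv i g p := by
  simp only [frameDeriv]
  rw [fderiv_fun_add (hf.differentiable (by simp) p) (hg.differentiable (by simp) p)]
  rfl

lemma frameDeriv_sub {f g : Solv → ℝ} (hf : ContDiff ℝ ∞ f) (hg : ContDiff ℝ ∞ g) (i : Fin 3)
    (p : Solv) : frameDeriv i (fun q => f q - g q) p = frameDeriv i f p - frameDeriv i g p := by
  simp only [frameDeriv]
  rw [fderiv_fun_sub (hf.differentiable (by simp) p) (hg.differentiable (by simp) p)]
  rfl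

lemma frameDeriv_const_mul {f : Solv → ℝ} (hf : ContDiff ℝ ∞ f) (c : ℝ) (i : Fin 3)
    (p : Solv) : frameDeriv i (fun q => c * f q) p = c * frameDeriv i f p := by
  simp only [frameDeriv]
  rw [fderiv_const_mul (hf.differentiable (by simp) p)]
  rfl

lemma frameDeriv_mul {f g : Solv → ℝ} (hf : ContDiff ℝ ∞ f) (hg : ContDiff ℝ ∞ g) (i : Fin 3)
    (p : Solv) : frameDeriv i (fun q => f q * g q) p =
      f p * frameDeriv i g p + g p * frameDeriv i f p := by
  simp only [frameDeriv]
  rw [fderiv_fun_mul (hf.differentiable (by simp) p) (hg.differentiable (by simp) p)]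
  rfl

/-- The brackets of the frame fields: `[E₂, E₀] = -E₀`, `[E₂, E₁] = E₁`, `[E₀, E₁] = 0`. -/
lemma frameDeriv_bracket {f : Solv → ℝ} (hf : ContDiff ℝ ∞ f) (i j : Fin 3) (p : Solv) :
    frameDeriv i (frameDeriv j f) p - frameDeriv j (frameDeriv i f) p =
      frameWeight j * frame p i 2 * frameDeriv j f p -
      frameWeight i * frame p j 2 * frameDeriv i f p := by
  have hd : ContDiff ℝ ∞ (fderiv ℝ f) := hf.fderiv_right (by simp)
  have key : ∀ i j : Fin 3, frameDeriv i (frameDeriv j f) p =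
      frameScale i p * frameScale j p *
        fderiv ℝ (fderiv ℝ f) p (Pi.single i 1) (Pi.single j 1) +
      frameWeight j * frame p i 2 * frameDeriv j f p := by
    intro i j
    have e : frameDeriv j f = fun q => frameScale j q * fderiv ℝ f q (Pi.single j 1) := by
      ext q; exact frameDeriv_eq j f q
    have h1 : HasFDerivAt (fun q => fderiv ℝ f q (Pi.single j 1))
        ((fderiv ℝ (fderiv ℝ f) p).flip (Pi.single j 1)) p :=
      ((hd.differentiable (by simp) p).hasFDerivAt).clm_apply
        (hasFDerivAt_const (Pi.single j 1) p) |>.congr_fderiv (by ext v; simp)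
    rw [e, frameDeriv, ((hasFDerivAt_frameScale j p).fun_mul h1).fderiv]
    rw [frame_eq]
    simp
    ring
  have hs := (hf.contDiffAt (x := p)).isSymmSndFDerivAt (by simpa using ENat.LEInfty.out)
  rw [key, key, hs.eq (Pi.single i 1) (Pi.single j 1)]
  ring

lemma frameDeriv_two_zero {f : Solv → ℝ} (hf : ContDiff ℝ ∞ f) (p : Solv) :
    frameDeriv 2 (frameDeriv 0 f) p = frameDeriv 0 (frameDeriv 2 f) p - frameDeriv 0 f p := by
  have := frameDeriv_bracket hf 2 0 p
  simp [frame, frameWeight] at this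
  linarith

lemma frameDeriv_two_one {f : Solv → ℝ} (hf : ContDiff ℝ ∞ f) (p : Solv) :
    frameDeriv 2 (frameDeriv 1 f) p = frameDeriv 1 (frameDeriv 2 f) p + frameDeriv 1 f p := by
  have := frameDeriv_bracket hf 2 1 p
  simp [frame, frameWeight] at this
  linarith

lemma frameDeriv_one_zero {f : Solv → ℝ} (hf : ContDiff ℝ ∞ f) (p : Solv) :
    frameDeriv 1 (frameDeriv 0 f) p = frameDeriv 0 (frameDeriv 1 f) p := by
  have := frameDeriv_bracket hf 1 0 p
  simp [frame, frameWeight] at this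
  linarith

/-- The components `c` of the curl of a `1`-form with components `f`. -/
structure IsCurl (f c : Fin 3 → Solv → ℝ) : Prop where
  zero : c 0 = fun p => frameDeriv 1 (f 2) p - frameDeriv 2 (f 1) p + f 1 p
  one : c 1 = fun p => frameDeriv 2 (f 0) p - frameDeriv 0 (f 2) p + f 0 p
  two : c 2 = fun p => frameDeriv 0 (f 1) p - frameDeriv 1 (f 0) p

lemma isCurl_comp {ξ : Form 1} (hξ : ContDiff ℝ ∞ ξ) :
    IsCurl (comp ξ) (comp (star₂ (extDeriv ξ))) :=
  ⟨funext fun p => (comp_curl hξ p).1, funext fun p => (comp_curl hξ p).2.1,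
    funext fun p => (comp_curl hξ p).2.2⟩

/-- The frame derivatives of the components of a curl. -/
lemma IsCurl.frameDeriv {f c : Fin 3 → Solv → ℝ} (h : IsCurl f c)
    (hf : ∀ i, ContDiff ℝ ∞ (f i)) (i : Fin 3) (p : Solv) :
    frameDeriv i (c 0) p = frameDeriv i (frameDeriv 1 (f 2)) p
      - frameDeriv i (frameDeriv 2 (f 1)) p + frameDeriv i (f 1) p ∧
    frameDeriv i (c 1) p = frameDeriv i (frameDeriv 2 (f 0)) p
      - frameDeriv i (frameDeriv 0 (f 2)) p + frameDeriv i (f 0) p ∧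
    frameDeriv i (c 2) p = frameDeriv i (frameDeriv 0 (f 1)) p
      - frameDeriv i (frameDeriv 1 (f 0)) p := by
  have hd : ∀ i j, ContDiff ℝ ∞ (SolvGeometry.frameDeriv j (f i)) :=
    fun i j => contDiff_frameDeriv (hf i) j
  refine ⟨?_, ?_, ?_⟩
  · rw [h.zero, frameDeriv_add ((hd 2 1).sub (hd 1 2)) (hf 1), frameDeriv_sub (hd 2 1) (hd 1 2)]
  · rw [h.one, frameDeriv_add ((hd 0 2).sub (hd 2 0)) (hf 0), frameDeriv_sub (hd 0 2) (hd 2 0)]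
  · rw [h.two, frameDeriv_sub (hd 1 0) (hd 0 1)]

/-- A curl is divergence free; the frame fields themselves are divergence free. -/
lemma IsCurl.div_eq_zero {f c : Fin 3 → Solv → ℝ} (h : IsCurl f c)
    (hf : ∀ i, ContDiff ℝ ∞ (f i)) (p : Solv) :
    SolvGeometry.frameDeriv 0 (c 0) p + SolvGeometry.frameDeriv 1 (c 1) p
      + SolvGeometry.frameDeriv 2 (c 2) p = 0 := by
  rw [(h.frameDeriv hf 0 p).1, (h.frameDeriv hf 1 p).2.1, (h.frameDeriv hf 2 p).2.2,
    frameDeriv_two_zero (hf 1), frameDeriv_two_one (hf 0), frameDeriv_one_zero (hf 2)]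
  ring

/-- The functions `f 0, f 1, f 2` satisfy the equations which express, for the components of a
`1`-form `ξ`, that `δξ = 0` and `Δξ = lξ`. -/
structure IsEigenSystem (l : ℝ) (f : Fin 3 → Solv → ℝ) : Prop where
  smooth : ∀ i, ContDiff ℝ ∞ (f i)
  div : ∀ p, frameDeriv 0 (f 0) p + frameDeriv 1 (f 1) p + frameDeriv 2 (f 2) p = 0
  zero : ∀ p, frameDeriv 2 (frameDeriv 2 (f 0)) p = - frameDeriv 0 (frameDeriv 0 (f 0)) p
    - frameDeriv 1 (frameDeriv 1 (f 0)) p + (1 - l) * f 0 p - 2 * frameDeriv 0 (f 2) p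
  one : ∀ p, frameDeriv 2 (frameDeriv 2 (f 1)) p = - frameDeriv 0 (frameDeriv 0 (f 1)) p
    - frameDeriv 1 (frameDeriv 1 (f 1)) p + (1 - l) * f 1 p + 2 * frameDeriv 1 (f 2) p
  two : ∀ p, frameDeriv 2 (frameDeriv 2 (f 2)) p = - frameDeriv 0 (frameDeriv 0 (f 2)) p
    - frameDeriv 1 (frameDeriv 1 (f 2)) p - l * f 2 p + 2 * frameDeriv 0 (f 0) p
    - 2 * frameDeriv 1 (f 1) p

/-- For divergence free `f`, the equation `curl (curl f) = l f` in terms of the Laplacian. -/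
lemma isEigenSystem_of_isCurl {l : ℝ} {f c : Fin 3 → Solv → ℝ}
    (hf : ∀ i, ContDiff ℝ ∞ (f i)) (hfc : IsCurl f c) (hc : IsCurl c fun i p => l * f i p)
    (hdiv : ∀ p, frameDeriv 0 (f 0) p + frameDeriv 1 (f 1) p + frameDeriv 2 (f 2) p = 0) :
    IsEigenSystem l f := by
  have hd : ∀ i j, ContDiff ℝ ∞ (frameDeriv j (f i)) := fun i j => contDiff_frameDeriv (hf i) j
  have hdd : ∀ i p, frameDeriv i (frameDeriv 0 (f 0)) p + frameDeriv i (frameDeriv 1 (f 1)) p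
      + frameDeriv i (frameDeriv 2 (f 2)) p = 0 := by
    intro i p
    rw [← frameDeriv_add (hd 0 0) (hd 1 1), ← frameDeriv_add ((hd 0 0).add (hd 1 1)) (hd 2 2),
      funext hdiv]
    simp [frameDeriv]
  refine ⟨hf, hdiv, fun p => ?_, fun p => ?_, fun p => ?_⟩
  · have h := congrFun hc.zero p
    simp only [(hfc.frameDeriv hf 1 p).2.2, (hfc.frameDeriv hf 2 p).2.1, congrFun hfc.one p,
      frameDeriv_two_zero (hf 2)] at h
    linarith [hdd 0 p, frameDeriv_one_zero (hf 1) p]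
  · have h := congrFun hc.one p
    simp only [(hfc.frameDeriv hf 2 p).1, (hfc.frameDeriv hf 0 p).2.2, congrFun hfc.zero p,
      frameDeriv_two_one (hf 2)] at h
    linarith [hdd 1 p, frameDeriv_one_zero (hf 0) p]
  · have h := congrFun hc.two p
    simp only [(hfc.frameDeriv hf 0 p).2.1, (hfc.frameDeriv hf 1 p).1] at h
    linarith [hdd 2 p, frameDeriv_two_zero (hf 0) p, frameDeriv_two_one (hf 1) p]

/-- The components of a coexact eigenform. -/
lemma isEigenSystem_of_mem {π : Subgroup (Equiv.Perm Solv)} {l : ℝ} {ξ : Form 1}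
    (h : ξ ∈ coexactEigenspace π l) : IsEigenSystem l (comp ξ) := by
  obtain ⟨⟨hξ, -⟩, ⟨β, ⟨hβ, -⟩, rfl⟩, h⟩ := h
  rw [hodgeLaplacian, codiff₁_codiff₂ hβ] at h
  have h0 : extDeriv (0 : Form 0) = 0 := extDeriv_const 0
  rw [h0, zero_add] at h
  have h1 : comp (star₂ (extDeriv (star₂ (extDeriv (codiff₂ β))))) =
      fun i p => l * comp (codiff₂ β) i p := by
    rw [codiff₂] at h
    funext i p
    rw [h]; rfl
  have hs : ContDiff ℝ ∞ (star₂ (extDeriv (codiff₂ β))) := contDiff_star₂ (contDiff_extDeriv hξ)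
  refine isEigenSystem_of_isCurl (contDiff_comp hξ) (isCurl_comp hξ) (h1 ▸ isCurl_comp hs) ?_
  exact (isCurl_comp (contDiff_star₂ hβ)).div_eq_zero (contDiff_comp (contDiff_star₂ hβ))

/-! ### Averages over a torus in a fiber -/

open MeasureTheory Set

lemma setIntegral_swap {X Y : Type*} [TopologicalSpace X] [TopologicalSpace Y]
    [MeasurableSpace X] [MeasurableSpace Y] [BorelSpace X] [BorelSpace Y]
    [SecondCountableTopology X] [SecondCountableTopology Y] [T2Space X] [T2Space Y]
    {μ : Measure X} {ν : Measure Y} [IsLocallyFiniteMeasure μ] [IsLocallyFiniteMeasure ν]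
    [SFinite μ] [SFinite ν] {K : Set X} {L : Set Y} (hK : IsCompact K) (hL : IsCompact L)
    {f : X → Y → ℝ} (hf : Continuous (Function.uncurry f)) :
    ∫ x in K, ∫ y in L, f x y ∂ν ∂μ = ∫ y in L, ∫ x in K, f x y ∂μ ∂ν := by
  apply integral_integral_swap
  rw [Measure.prod_restrict]
  exact hf.continuousOn.integrableOn_compact (hK.prod hL)

lemma setIntegral_periodic {k : ℝ → ℝ} (hk : Function.Periodic k 1) (a : ℝ) :
    ∫ t in Icc (0 : ℝ) 1, k (t + a) = ∫ t in Icc (0 : ℝ) 1, k t := by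
  rw [integral_Icc_eq_integral_Ioc, integral_Icc_eq_integral_Ioc,
    ← intervalIntegral.integral_of_le zero_le_one, ← intervalIntegral.integral_of_le zero_le_one,
    intervalIntegral.integral_comp_add_right]
  have := hk.intervalIntegral_add_eq (0 + a) 0
  rw [zero_add, zero_add] at this
  rw [zero_add, add_comm 1 a, this]

/-- The unit square. -/
def unitSquare : Set (ℝ × ℝ) := Icc 0 1 ×ˢ Icc 0 1

lemma isCompact_unitSquare : IsCompact unitSquare := isCompact_Icc.prod isCompact_Icc

lemma volume_unitSquare : volume.real unitSquare = 1 := by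
  rw [Measure.real, unitSquare, Measure.volume_eq_prod, Measure.prod_prod]
  simp

lemma measurableSet_unitSquare : MeasurableSet unitSquare :=
  isCompact_unitSquare.isClosed.measurableSet

/-- The vectors `v` and `w` form a basis of the horizontal plane `z = 0`. -/
structure IsFiberBasis (v w : Solv) : Prop where
  left : v 2 = 0
  right : w 2 = 0
  det : v 0 * w 1 - v 1 * w 0 ≠ 0

/-- The point of the parallelogram spanned by `v` and `w` with coordinates `u`. -/
def cellPoint (v w : Solv) (u : ℝ × ℝ) : Solv := u.1 • v + u.2 • w

/-- The average of `f` over the parallelogram with corner `p` spanned by `v` and `w`. -/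
def avg (v w : Solv) (f : Solv → ℝ) (p : Solv) : ℝ :=
  ∫ u in unitSquare, f (p + cellPoint v w u)

@[fun_prop]
lemma continuous_cellPoint (v w : Solv) : Continuous (cellPoint v w) := by
  unfold cellPoint; fun_prop

lemma cellPoint_two {v w : Solv} (h : IsFiberBasis v w) (u : ℝ × ℝ) : cellPoint v w u 2 = 0 := by
  simp [cellPoint, h.left, h.right]

lemma IsFiberBasis.exists_eq {v w : Solv} (hb : IsFiberBasis v w) {h : Solv} (hh : h 2 = 0) :
    ∃ u, h = cellPoint v w u := by
  have hd := hb.det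
  refine ⟨((h 0 * w 1 - h 1 * w 0) / (v 0 * w 1 - v 1 * w 0),
    (v 0 * h 1 - v 1 * h 0) / (v 0 * w 1 - v 1 * w 0)), ?_⟩
  ext i
  fin_cases i
  · simp only [cellPoint, Fin.zero_eta, Pi.add_apply, Pi.smul_apply, smul_eq_mul]
    rw [div_mul_eq_mul_div, div_mul_eq_mul_div, ← add_div, eq_div_iff hd]; ring
  · simp only [cellPoint, Fin.mk_one, Pi.add_apply, Pi.smul_apply, smul_eq_mul]
    rw [div_mul_eq_mul_div, div_mul_eq_mul_div, ← add_div, eq_div_iff hd]; ring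
  · simp [cellPoint, hb.left, hb.right, hh]

variable {v w : Solv}

lemma integrableOn_cell {f : Solv → ℝ} (hf : Continuous f) (p : Solv) :
    IntegrableOn (fun u => f (p + cellPoint v w u)) unitSquare :=
  (by fun_prop : Continuous fun u => f (p + cellPoint v w u)).continuousOn.integrableOn_compact
    isCompact_unitSquare

lemma avg_add {f g : Solv → ℝ} (hf : Continuous f) (hg : Continuous g) (p : Solv) :
    avg v w (fun q => f q + g q) p = avg v w f p + avg v w g p :=
  integral_add (integrableOn_cell hf p) (integrableOn_cell hg p)

lemma avg_sub {f g : Solv → ℝ} (hf : Continuous f) (hg : Continuous g) (p : Solv) :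
    avg v w (fun q => f q - g q) p = avg v w f p - avg v w g p :=
  integral_sub (integrableOn_cell hf p) (integrableOn_cell hg p)

lemma avg_const_mul (c : ℝ) (f : Solv → ℝ) (p : Solv) :
    avg v w (fun q => c * f q) p = c * avg v w f p :=
  integral_const_mul c _

lemma avg_const (c : ℝ) (p : Solv) : avg v w (fun _ => c) p = c := by
  simp [avg, volume_unitSquare]

/-- Only the values in the plane through `p` enter the average. -/
lemma avg_congr (hb : IsFiberBasis v w) {f g : Solv → ℝ} {p : Solv}
    (h : ∀ q, q 2 = p 2 → f q = g q) : avg v w f p = avg v w g p := by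
  unfold avg
  congr 1
  funext u
  exact h _ (by simp [cellPoint_two hb])

lemma avg_mono (hb : IsFiberBasis v w) {f g : Solv → ℝ} (hf : Continuous f) (hg : Continuous g)
    {p : Solv} (h : ∀ q, q 2 = p 2 → f q ≤ g q) : avg v w f p ≤ avg v w g p :=
  integral_mono (integrableOn_cell hf p) (integrableOn_cell hg p) fun u =>
    h _ (by simp [cellPoint_two hb])

lemma avg_nonneg {f : Solv → ℝ} (h : ∀ q, 0 ≤ f q) (p : Solv) : 0 ≤ avg v w f p :=
  integral_nonneg fun _ => h _

lemma continuous_avg {f : Solv → ℝ} (hf : Continuous f) : Continuous (avg v w f) :=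
  continuous_parametric_integral_of_continuous (by fun_prop) isCompact_unitSquare

/-- `f` is invariant under the translations by `v` and `w`. -/
def IsCellPeriodic (v w : Solv) (f : Solv → ℝ) : Prop :=
  (∀ p, f (p + v) = f p) ∧ ∀ p, f (p + w) = f p

/-- The average of a periodic function over a period cell does not depend on the position of the
cell in the fiber. -/
lemma avg_shift (hb : IsFiberBasis v w) {f : Solv → ℝ} (hf : Continuous f)
    (hp : IsCellPeriodic v w f) (p : Solv) {h : Solv} (hh : h 2 = 0) :
    avg v w f (p + h) = avg v w f p := by
  obtain ⟨⟨a, b⟩, rfl⟩ := hb.exists_eq hh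
  have key : ∀ a b : ℝ, avg v w f (p + cellPoint v w (a, b)) =
      ∫ s in Icc (0 : ℝ) 1, ∫ r in Icc (0 : ℝ) 1, f (p + cellPoint v w (s + a, r + b)) := by
    intro a b
    rw [avg, unitSquare, Measure.volume_eq_prod, setIntegral_prod]
    · simp only [cellPoint]
      congr 1; funext s; congr 1; funext r
      congr 1; ext i; simp; ring
    · exact integrableOn_cell hf _
  have hr : ∀ s r, f (p + cellPoint v w (s, r + 1)) = f (p + cellPoint v w (s, r)) := by
    intro s r
    rw [← hp.2 (p + cellPoint v w (s, r))]
    congr 1; ext i; simp [cellPoint]; ring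
  have hs : ∀ s r, f (p + cellPoint v w (s + 1, r)) = f (p + cellPoint v w (s, r)) := by
    intro s r
    rw [← hp.1 (p + cellPoint v w (s, r))]
    congr 1; ext i; simp [cellPoint]; ring
  have e0 := key 0 0
  have : p + cellPoint v w (0, 0) = p := by simp [cellPoint]
  rw [this] at e0
  rw [key, e0]
  have inner : ∀ s b, ∫ r in Icc (0 : ℝ) 1, f (p + cellPoint v w (s, r + b)) =
      ∫ r in Icc (0 : ℝ) 1, f (p + cellPoint v w (s, r)) := fun s b =>
    setIntegral_periodic (k := fun r => f (p + cellPoint v w (s, r))) (hr s) b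
  simp only [inner]
  have outer := fun a => setIntegral_periodic
    (k := fun s => ∫ r in Icc (0 : ℝ) 1, f (p + cellPoint v w (s, r)))
    (fun s => by simp only [hs]) a
  rw [outer a, outer 0]

lemma avg_comm {v' w' : Solv} {F : Solv → Solv → ℝ} (hF : Continuous (Function.uncurry F))
    (p q : Solv) : avg v w (fun x => avg v' w' (F x) q) p =
      avg v' w' (fun y => avg v w (fun x => F x y) p) q := by
  unfold avg
  refine setIntegral_swap isCompact_unitSquare isCompact_unitSquare
    (f := fun u u' => F (p + cellPoint v w u) (q + cellPoint v' w' u')) ?_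
  have : Continuous fun z : (ℝ × ℝ) × (ℝ × ℝ) =>
      (p + cellPoint v w z.1, q + cellPoint v' w' z.2) := by fun_prop
  exact hF.comp this

/-- The average does not depend on the choice of the lattice of periods. -/
lemma avg_eq_avg {v' w' : Solv} (hb : IsFiberBasis v w) (hb' : IsFiberBasis v' w')
    {f : Solv → ℝ} (hf : Continuous f) (hp : IsCellPeriodic v w f) (hp' : IsCellPeriodic v' w' f)
    (p : Solv) : avg v w f p = avg v' w' f p := by
  have h := avg_comm (v := v) (w := w) (v' := v') (w' := w') (F := fun x y => f (x + y))
    (by simp only [Function.uncurry_def]; fun_prop) p 0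
  have hsh : ∀ (g : Solv → ℝ) (q : Solv) (v w : Solv), avg v w (fun x => g (x + q)) p =
      avg v w g (p + q) := by
    intro g q v w
    unfold avg
    simp only [add_right_comm]
  have e1 : avg v w (fun x => avg v' w' (fun y => f (x + y)) 0) p = avg v' w' f p := by
    have : ∀ x, x 2 = p 2 → avg v' w' (fun y => f (x + y)) 0 = avg v' w' f p := by
      intro x hx
      have e : avg v' w' (fun y => f (x + y)) 0 = avg v' w' f x := by simp [avg]
      rw [e]
      have := avg_shift hb' hf hp' p (h := x - p) (by simp [hx])
      rwa [add_sub_cancel] at this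
    rw [avg_congr hb (g := fun _ => avg v' w' f p) this, avg_const]
  have e2 : avg v' w' (fun y => avg v w (fun x => f (x + y)) p) 0 = avg v w f p := by
    have : ∀ y, y 2 = (0 : Solv) 2 → avg v w (fun x => f (x + y)) p = avg v w f p := by
      intro y hy
      rw [hsh, avg_shift hb hf hp p hy]
    rw [avg_congr hb' (g := fun _ => avg v w f p) this, avg_const]
  rw [← e2, ← h, e1]

/-- Differentiation under the integral sign. -/
lemma hasFDerivAt_avg {f : Solv → ℝ} (hf : ContDiff ℝ ∞ f) (p : Solv) :
    HasFDerivAt (avg v w f) (∫ u in unitSquare, fderiv ℝ f (p + cellPoint v w u)) p := by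
  have hd : Continuous (fderiv ℝ f) := hf.continuous_fderiv (by simp)
  have hK : IsCompact ((fun z : Solv × (ℝ × ℝ) => z.1 + cellPoint v w z.2) ''
      (Metric.closedBall p 1 ×ˢ unitSquare)) :=
    ((isCompact_closedBall p 1).prod isCompact_unitSquare).image (by fun_prop)
  obtain ⟨C, hC⟩ := hK.exists_bound_of_continuousOn hd.continuousOn
  refine hasFDerivAt_integral_of_dominated_of_fderiv_le (s := Metric.closedBall p 1)
    (F := fun q u => f (q + cellPoint v w u))
    (F' := fun q u => fderiv ℝ f (q + cellPoint v w u)) (bound := fun _ => C)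
    (Metric.closedBall_mem_nhds p one_pos) ?_ (integrableOn_cell hf.continuous p) ?_ ?_ ?_ ?_
  · refine Filter.Eventually.of_forall fun q => Continuous.aestronglyMeasurable ?_
    have := hf.continuous
    fun_prop
  · exact Continuous.aestronglyMeasurable (by fun_prop)
  · refine (ae_restrict_mem measurableSet_unitSquare).mono fun u hu q hq => ?_
    exact hC _ ⟨(q, u), ⟨hq, hu⟩, rfl⟩
  · exact integrableOn_const isCompact_unitSquare.measure_lt_top.ne
  · refine Filter.Eventually.of_forall fun u q _ => ?_
    have h1 := (hf.differentiable (by simp) (q + cellPoint v w u)).hasFDerivAt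
    simpa [Function.comp_def] using h1.comp q ((hasFDerivAt_id q).add_const (cellPoint v w u))

lemma fderiv_avg {f : Solv → ℝ} (hf : ContDiff ℝ ∞ f) (p e : Solv) :
    fderiv ℝ (avg v w f) p e = avg v w (fun q => fderiv ℝ f q e) p := by
  rw [(hasFDerivAt_avg hf p).fderiv, ContinuousLinearMap.integral_apply]
  · rfl
  · have hd : Continuous (fderiv ℝ f) := hf.continuous_fderiv (by simp)
    exact (by fun_prop : Continuous fun u => fderiv ℝ f (p + cellPoint v w u)).continuousOn
      |>.integrableOn_compact isCompact_unitSquare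

lemma avg_frameDeriv (hb : IsFiberBasis v w) {f : Solv → ℝ} (hf : ContDiff ℝ ∞ f) (i : Fin 3)
    (p : Solv) : avg v w (frameDeriv i f) p = frameDeriv i (avg v w f) p := by
  rw [frameDeriv, fderiv_avg hf]
  refine avg_congr hb fun q hq => ?_
  have : frame q i = frame p i := by simp [frame, hq]
  rw [frameDeriv, this]

lemma frameDeriv_eq_zero_of_horizontal_const {f : Solv → ℝ} (hf : Differentiable ℝ f) {p : Solv}
    (h : ∀ u : Solv, u 2 = 0 → f (p + u) = f p) {i : Fin 3} (hi : i ≠ 2) :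
    frameDeriv i f p = 0 := by
  have h1 : HasDerivAt (fun t : ℝ => f (p + t • Pi.single i 1))
      (fderiv ℝ f p (Pi.single i 1)) 0 := by
    have h2 : HasFDerivAt f (fderiv ℝ f p) (p + (0 : ℝ) • Pi.single i 1) := by
      rw [zero_smul, add_zero]; exact (hf p).hasFDerivAt
    have h3 : HasDerivAt (fun t : ℝ => p + t • (Pi.single i 1 : Solv)) (Pi.single i 1) 0 := by
      simpa using ((hasDerivAt_id (0 : ℝ)).smul_const (Pi.single i 1 : Solv)).const_add p
    exact h2.comp_hasDerivAt 0 h3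
  have h4 : (fun t : ℝ => f (p + t • Pi.single i 1)) = fun _ => f p := by
    funext t
    exact h _ (by simp [hi.symm])
  rw [h4] at h1
  rw [frameDeriv_eq, h1.unique (hasDerivAt_const 0 _), mul_zero]

/-- The integral of a horizontal derivative over a period cell vanishes. -/
lemma avg_frameDeriv_eq_zero (hb : IsFiberBasis v w) {f : Solv → ℝ} (hf : ContDiff ℝ ∞ f)
    (hp : IsCellPeriodic v w f) {i : Fin 3} (hi : i ≠ 2) (p : Solv) :
    avg v w (frameDeriv i f) p = 0 := by
  rw [avg_frameDeriv hb hf]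
  exact frameDeriv_eq_zero_of_horizontal_const
    (fun p => (hasFDerivAt_avg hf p).differentiableAt)
    (fun u hu => avg_shift hb hf.continuous hp p hu) hi

/-- A periodic function whose square has mean zero vanishes. -/
lemma eq_zero_of_avg_sq (hb : IsFiberBasis v w) {f : Solv → ℝ} (hf : Continuous f)
    (hp : IsCellPeriodic v w f) {p : Solv} (h : avg v w (fun q => f q ^ 2) p = 0)
    {q : Solv} (hq : q 2 = p 2) : f q = 0 := by
  have hp2 : IsCellPeriodic v w fun q => f q ^ 2 :=
    ⟨fun x => by simp only [hp.1], fun x => by simp only [hp.2]⟩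
  have h' : avg v w (fun q => f q ^ 2) q = 0 := by
    have := avg_shift hb (hf.pow 2) hp2 p (h := q - p) (by simp [hq])
    rw [add_sub_cancel] at this
    exact this.trans h
  by_contra hne
  have hcont : Continuous fun u => f (q + cellPoint v w u) ^ 2 := by fun_prop
  have hae := (setIntegral_eq_zero_iff_of_nonneg_ae
    (Filter.Eventually.of_forall fun u => sq_nonneg (f (q + cellPoint v w u)))
    (integrableOn_cell (hf.pow 2) q)).1 h'
  have hzero : ∀ u ∈ Ioo (0 : ℝ) 1 ×ˢ Ioo (0 : ℝ) 1, f (q + cellPoint v w u) ^ 2 = 0 := by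
    have hsub : Ioo (0 : ℝ) 1 ×ˢ Ioo (0 : ℝ) 1 ⊆ unitSquare :=
      prod_mono Ioo_subset_Icc_self Ioo_subset_Icc_self
    have := Measure.eqOn_open_of_ae_eq (μ := volume) (f := fun u => f (q + cellPoint v w u) ^ 2)
      (g := fun _ => 0) (ae_restrict_of_ae_restrict_of_subset hsub hae) (isOpen_Ioo.prod isOpen_Ioo)
      hcont.continuousOn continuousOn_const
    exact this
  have hcl : ∀ u ∈ closure (Ioo (0 : ℝ) 1 ×ˢ Ioo (0 : ℝ) 1),
      f (q + cellPoint v w u) ^ 2 = 0 := by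
    intro u hu
    exact closure_minimal (t := {u | f (q + cellPoint v w u) ^ 2 = 0}) hzero
      (isClosed_eq hcont continuous_const) hu
  have := hcl (0, 0) (by rw [closure_prod_eq, closure_Ioo zero_ne_one]; simp)
  simp [cellPoint, hne] at this

/-! ### The Poincaré inequality on the fibers -/

lemma sq_setIntegral_le {D : ℝ → ℝ} (hD : Continuous D) :
    (∫ t in Icc (0 : ℝ) 1, D t) ^ 2 ≤ ∫ t in Icc (0 : ℝ) 1, D t ^ 2 := by
  set m := ∫ t in Icc (0 : ℝ) 1, D t with hm
  have hi : ∀ {k : ℝ → ℝ}, Continuous k → IntegrableOn k (Icc (0 : ℝ) 1) := fun hk =>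
    hk.continuousOn.integrableOn_compact isCompact_Icc
  have h1 : 0 ≤ ∫ t in Icc (0 : ℝ) 1, (D t ^ 2 - 2 * m * D t + m ^ 2) :=
    integral_nonneg fun t => by
      have := sq_nonneg (D t - m)
      simp only [Pi.zero_apply]
      linarith
  rw [integral_add (hi (by fun_prop)) (hi (by fun_prop)),
    integral_sub (hi (by fun_prop)) (hi (by fun_prop)), integral_const_mul, ← hm] at h1
  simp at h1
  linarith

lemma IsCellPeriodic.frameDeriv (hb : IsFiberBasis v w) {f : Solv → ℝ}
    (hp : IsCellPeriodic v w f) (i : Fin 3) : IsCellPeriodic v w (frameDeriv i f) := by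
  have key : ∀ u : Solv, u 2 = 0 → (∀ p, f (p + u) = f p) → ∀ p,
      SolvGeometry.frameDeriv i f (p + u) = SolvGeometry.frameDeriv i f p := by
    intro u hu hf p
    have e : frame (p + u) i = frame p i := by simp [frame, hu]
    rw [SolvGeometry.frameDeriv, SolvGeometry.frameDeriv, e, ← fderiv_comp_add_right, funext hf]
  exact ⟨key v hb.left hp.1, key w hb.right hp.2⟩

/-- The square of the norm of the fiberwise gradient of `g`. -/
def fiberEnergy (g : Solv → ℝ) (p : Solv) : ℝ := frameDeriv 0 g p ^ 2 + frameDeriv 1 g p ^ 2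

lemma continuous_fiberEnergy {g : Solv → ℝ} (hg : ContDiff ℝ ∞ g) :
    Continuous (fiberEnergy g) :=
  ((contDiff_frameDeriv hg 0).continuous.pow 2).add ((contDiff_frameDeriv hg 1).continuous.pow 2)

/-- The square of the length of a horizontal vector in the induced metric of the fiber at
height `z`. -/
def fiberNormSq (z : ℝ) (h : Solv) : ℝ := Real.exp (2 * z) * h 0 ^ 2 + Real.exp (-2 * z) * h 1 ^ 2

lemma fderiv_horizontal_sq_le (g : Solv → ℝ) (q : Solv) {h : Solv} (hh : h 2 = 0) :
    fderiv ℝ g q h ^ 2 ≤ fiberNormSq (q 2) h * fiberEnergy g q := by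
  have e : h = (Real.exp (q 2) * h 0) • frame q 0 + (Real.exp (-(q 2)) * h 1) • frame q 1 := by
    have hs : Real.exp (q 2) * Real.exp (-(q 2)) = 1 := by rw [← Real.exp_add]; simp
    ext i; fin_cases i
    · simp [frame]; linear_combination -h 0 * hs
    · simp [frame]; linear_combination -h 1 * hs
    · simp [frame, hh]
  have e2 : fderiv ℝ g q h = (Real.exp (q 2) * h 0) * frameDeriv 0 g q +
      (Real.exp (-(q 2)) * h 1) * frameDeriv 1 g q := by
    conv_lhs => rw [e]
    simp [frameDeriv]
  have e3 : fiberNormSq (q 2) h = (Real.exp (q 2) * h 0) ^ 2 + (Real.exp (-(q 2)) * h 1) ^ 2 := by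
    rw [fiberNormSq, mul_pow, mul_pow, ← Real.exp_nat_mul, ← Real.exp_nat_mul]
    congr 3
    push_cast; ring
  rw [e2, e3, fiberEnergy]
  nlinarith [sq_nonneg ((Real.exp (q 2) * h 0) * frameDeriv 1 g q -
    (Real.exp (-(q 2)) * h 1) * frameDeriv 0 g q)]

/-- The mean square increment of `g` under a horizontal translation is controlled by the fiberwise
energy. -/
lemma avg_sq_increment_le (hb : IsFiberBasis v w) {g : Solv → ℝ} (hg : ContDiff ℝ ∞ g)
    (hp : IsCellPeriodic v w g) (p : Solv) {h : Solv} (hh : h 2 = 0) :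
    avg v w (fun q => (g (q + h) - g q) ^ 2) p ≤
      fiberNormSq (p 2) h * avg v w (fiberEnergy g) p := by
  have hgc := hg.continuous
  have hE := continuous_fiberEnergy hg
  have hd : Continuous (fderiv ℝ g) := hg.continuous_fderiv (by simp)
  have hEp : IsCellPeriodic v w (fiberEnergy g) :=
    ⟨fun x => by simp only [fiberEnergy, (hp.frameDeriv hb _).1],
      fun x => by simp only [fiberEnergy, (hp.frameDeriv hb _).2]⟩
  have hpt : ∀ q, q 2 = p 2 → (g (q + h) - g q) ^ 2 ≤
      fiberNormSq (p 2) h * ∫ t in Icc (0 : ℝ) 1, fiberEnergy g (q + t • h) := by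
    intro q hq
    have hD : Continuous fun t : ℝ => fderiv ℝ g (q + t • h) h := by fun_prop
    have h1 : g (q + h) - g q = ∫ t in Icc (0 : ℝ) 1, fderiv ℝ g (q + t • h) h := by
      rw [integral_Icc_eq_integral_Ioc, ← intervalIntegral.integral_of_le zero_le_one,
        intervalIntegral.integral_eq_sub_of_hasDerivAt (f := fun t : ℝ => g (q + t • h))]
      · simp
      · intro t _
        have h3 : HasDerivAt (fun t : ℝ => q + t • h) h t := by
          simpa using ((hasDerivAt_id t).smul_const h).const_add q
        exact ((hg.differentiable (by simp) _).hasFDerivAt).comp_hasDerivAt t h3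
      · exact hD.intervalIntegrable _ _
    rw [h1, ← integral_const_mul]
    refine (sq_setIntegral_le hD).trans (integral_mono ?_ ?_ fun t => ?_)
    · exact (hD.pow 2).continuousOn.integrableOn_compact isCompact_Icc
    · exact (by fun_prop : Continuous fun t : ℝ => fiberNormSq (p 2) h * fiberEnergy g (q + t • h)
        ).continuousOn.integrableOn_compact isCompact_Icc
    · have := fderiv_horizontal_sq_le g (q + t • h) hh
      simpa [hh, hq] using this
  have hcont : Continuous fun q => ∫ t in Icc (0 : ℝ) 1, fiberEnergy g (q + t • h) :=
    continuous_parametric_integral_of_continuous (by fun_prop) isCompact_Icc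
  refine (avg_mono hb (by fun_prop) (hcont.const_mul _) hpt).trans_eq ?_
  rw [avg_const_mul]
  congr 1
  have hsw : avg v w (fun q => ∫ t in Icc (0 : ℝ) 1, fiberEnergy g (q + t • h)) p =
      ∫ t in Icc (0 : ℝ) 1, avg v w (fiberEnergy g) (p + t • h) := by
    unfold avg
    rw [setIntegral_swap isCompact_unitSquare isCompact_Icc (by fun_prop)]
    simp only [add_right_comm]
  rw [hsw]
  have : ∀ t : ℝ, avg v w (fiberEnergy g) (p + t • h) = avg v w (fiberEnergy g) p := fun t =>
    avg_shift hb hE hEp p (by simp [hh])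
  simp [this]

/-- The horizontal vectors in `Λ` are `ε`-dense in the fiber at height `z`. -/
def IsFiberNet (Λ : Set Solv) (ε z : ℝ) : Prop :=
  ∀ h : Solv, h 2 = 0 → ∃ u ∈ Λ, fiberNormSq z (h - u) ≤ ε ^ 2

/-- The Poincaré inequality on a flat torus whose lattice of periods is `ε`-dense. An increment of
`g` does not change when the translation vector is reduced modulo periods, and the mean of the
square of the increment over all translations is twice the mean of `g ^ 2`. -/
lemma avg_sq_le (hb : IsFiberBasis v w) {g : Solv → ℝ} (hg : ContDiff ℝ ∞ g)
    (hp : IsCellPeriodic v w g) {p : Solv} {Λ : Set Solv} (hΛ : ∀ u ∈ Λ, u 2 = 0)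
    (hΛg : ∀ u ∈ Λ, ∀ q, g (q + u) = g q) {ε : ℝ} (hnet : IsFiberNet Λ ε (p 2))
    (h0 : avg v w g p = 0) :
    2 * avg v w (fun q => g q ^ 2) p ≤ ε ^ 2 * avg v w (fiberEnergy g) p := by
  have hgc := hg.continuous
  have hE0 : 0 ≤ avg v w (fiberEnergy g) p :=
    avg_nonneg (fun q => add_nonneg (sq_nonneg _) (sq_nonneg _)) p
  have hp2 : IsCellPeriodic v w fun q => g q ^ 2 :=
    ⟨fun x => by simp only [hp.1], fun x => by simp only [hp.2]⟩
  have hinc : ∀ h : Solv, h 2 = 0 → 2 * avg v w (fun q => g q ^ 2) p -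
      2 * avg v w (fun q => g q * g (q + h)) p ≤ ε ^ 2 * avg v w (fiberEnergy g) p := by
    intro h hh
    obtain ⟨u, hu, hle⟩ := hnet h hh
    have h1 := avg_sq_increment_le hb hg hp p (h := h - u) (by simp [hh, hΛ u hu])
    have e1 : avg v w (fun q => (g (q + (h - u)) - g q) ^ 2) p =
        2 * avg v w (fun q => g q ^ 2) p - 2 * avg v w (fun q => g q * g (q + h)) p := by
      have e2 : (fun q => (g (q + (h - u)) - g q) ^ 2) =
          fun q => (g (q + h) ^ 2 + g q ^ 2) - 2 * (g q * g (q + h)) := by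
        funext q
        have : g (q + (h - u)) = g (q + h) := by
          rw [← hΛg u hu]; congr 1; abel
        rw [this]; ring
      have e3 : avg v w (fun q => g (q + h) ^ 2) p = avg v w (fun q => g q ^ 2) p := by
        rw [← avg_shift hb (f := fun q => g q ^ 2) (hgc.pow 2) hp2 p hh]
        unfold avg
        simp only [add_right_comm]
      rw [e2, avg_sub (by fun_prop) (by fun_prop), avg_add (by fun_prop) (by fun_prop),
        avg_const_mul, e3]
      ring
    rw [← e1]
    exact h1.trans (mul_le_mul_of_nonneg_right hle hE0)
  have hcorr : avg v w (fun y => avg v w (fun q => g q * g (q + y)) p) 0 = 0 := by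
    rw [← avg_comm (F := fun q y => g q * g (q + y))
      (by simp only [Function.uncurry_def]; fun_prop)]
    have : ∀ q, q 2 = p 2 → avg v w (fun y => g q * g (q + y)) 0 = 0 := by
      intro q hq
      rw [avg_const_mul]
      have e : avg v w (fun y => g (q + y)) 0 = avg v w g q := by simp [avg]
      have := avg_shift hb hgc hp p (h := q - p) (by simp [hq])
      rw [add_sub_cancel] at this
      rw [e, this, h0, mul_zero]
    rw [avg_congr hb (g := fun _ => 0) this, avg_const]
  have hC : Continuous fun y => avg v w (fun q => g q * g (q + y)) p := by
    unfold avg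
    exact continuous_parametric_integral_of_continuous (by fun_prop) isCompact_unitSquare
  have hfin := avg_mono (v := v) (w := w) hb (p := 0)
    (f := fun y => 2 * avg v w (fun q => g q ^ 2) p - 2 * avg v w (fun q => g q * g (q + y)) p)
    (g := fun _ => ε ^ 2 * avg v w (fiberEnergy g) p) (by fun_prop) (by fun_prop)
    (fun y hy => hinc y (by simpa using hy))
  rw [avg_sub (by fun_prop) (by fun_prop), avg_const, avg_const, avg_const_mul, hcorr] at hfin
  linarith

/-! ### Coexact eigenforms with small eigenvalue are constant on the fibers -/

/-- A bounded convex function on the whole line is constant. -/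
lemma deriv_eq_zero_of_bounded_of_convex {N N' N'' : ℝ → ℝ} {B : ℝ} (hB : ∀ z, |N z| ≤ B)
    (h1 : ∀ z, HasDerivAt N (N' z) z) (h2 : ∀ z, HasDerivAt N' (N'' z) z) (h3 : ∀ z, 0 ≤ N'' z)
    (z : ℝ) : N' z = 0 := by
  have hmono : Monotone N' := monotone_of_hasDerivAt_nonneg h2 h3
  -- The graph of `N` lies above its tangent lines.
  have htan : ∀ y, N z + N' z * (y - z) ≤ N y := by
    intro y
    rcases lt_trichotomy z y with hzy | rfl | hyz
    · obtain ⟨c, hc, he⟩ := exists_hasDerivAt_eq_slope N N' hzy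
        (fun x _ => (h1 x).continuousAt.continuousWithinAt) (fun x _ => h1 x)
      have := hmono hc.1.le
      rw [he, le_div_iff₀ (by linarith)] at this
      linarith
    · simp
    · obtain ⟨c, hc, he⟩ := exists_hasDerivAt_eq_slope N N' hyz
        (fun x _ => (h1 x).continuousAt.continuousWithinAt) (fun x _ => h1 x)
      have := hmono hc.2.le
      rw [he, div_le_iff₀ (by linarith)] at this
      linarith
  by_contra hne
  have h := htan (z + (2 * B + 1) / N' z)
  have e : N' z * (z + (2 * B + 1) / N' z - z) = 2 * B + 1 := by field_simp; ring
  rw [e] at h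
  have ha := abs_le.1 (hB z)
  have hb := abs_le.1 (hB (z + (2 * B + 1) / N' z))
  linarith

/-- A bounded nonnegative function `N` with `N'' ≥ c N` for some `c > 0` vanishes. -/
lemma eq_zero_of_bounded_of_le {N N' N'' : ℝ → ℝ} {B c : ℝ} (hc : 0 < c) (h0 : ∀ z, 0 ≤ N z)
    (hB : ∀ z, N z ≤ B) (h1 : ∀ z, HasDerivAt N (N' z) z) (h2 : ∀ z, HasDerivAt N' (N'' z) z)
    (h3 : ∀ z, c * N z ≤ N'' z) (z : ℝ) : N z = 0 := by
  have h4 : N' = fun _ => 0 := funext <| deriv_eq_zero_of_bounded_of_convex (B := B)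
    (fun z => by rw [abs_of_nonneg (h0 z)]; exact hB z) h1 h2
    (fun z => (mul_nonneg hc.le (h0 z)).trans (h3 z))
  have h5 := h2 z
  rw [h4] at h5
  have h6 := h3 z
  rw [h5.unique (hasDerivAt_const z 0)] at h6
  exact le_antisymm (nonpos_of_mul_nonpos_right h6 hc) (h0 z)

lemma avg_sum {F : Fin 3 → Solv → ℝ} (hF : ∀ i, Continuous (F i)) (p : Solv) :
    avg v w (fun q => ∑ i, F i q) p = ∑ i, avg v w (F i) p :=
  integral_finsetSum _ fun i _ => integrableOn_cell (hF i) p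

lemma frame_two (p : Solv) : frame p 2 = Pi.single 2 1 := by
  rw [frame_eq]; simp [frameScale]

lemma frameDeriv_comp_add (f : Solv → ℝ) {h : Solv} (hh : h 2 = 0) (i : Fin 3) (p : Solv) :
    frameDeriv i (fun q => f (q + h)) p = frameDeriv i f (p + h) := by
  have e : frame (p + h) i = frame p i := by simp [frame, hh]
  rw [frameDeriv, frameDeriv, e, fderiv_comp_add_right]

/-- The equations for the components of a coexact eigenform are linear and invariant under
horizontal translations. -/
lemma IsEigenSystem.increment {l : ℝ} {f : Fin 3 → Solv → ℝ} (hf : IsEigenSystem l f) {h : Solv}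
    (hh : h 2 = 0) : IsEigenSystem l fun i p => f i (p + h) - f i p := by
  have hs := hf.smooth
  have hsh : ∀ i, ContDiff ℝ ∞ fun p => f i (p + h) := fun i =>
    (hs i).comp (contDiff_id.add contDiff_const)
  have hd : ∀ i j p, frameDeriv j (fun p => f i (p + h) - f i p) p =
      frameDeriv j (f i) (p + h) - frameDeriv j (f i) p := by
    intro i j p
    rw [frameDeriv_sub (hsh i) (hs i), frameDeriv_comp_add _ hh]
  have hdd : ∀ i j k p, frameDeriv k (frameDeriv j (fun p => f i (p + h) - f i p)) p =
      frameDeriv k (frameDeriv j (f i)) (p + h) - frameDeriv k (frameDeriv j (f i)) p := by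
    intro i j k p
    have hj := contDiff_frameDeriv (hs i) j
    have hjh : ContDiff ℝ ∞ fun p => frameDeriv j (f i) (p + h) :=
      hj.comp (contDiff_id.add contDiff_const)
    rw [funext (hd i j), frameDeriv_sub hjh hj, frameDeriv_comp_add _ hh]
  refine ⟨fun i => (hsh i).sub (hs i), fun p => ?_, fun p => ?_, fun p => ?_, fun p => ?_⟩
  · simp only [hd]; linarith [hf.div p, hf.div (p + h)]
  · simp only [hd, hdd]; linarith [hf.zero p, hf.zero (p + h)]
  · simp only [hd, hdd]; linarith [hf.one p, hf.one (p + h)]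
  · simp only [hd, hdd]; linarith [hf.two p, hf.two (p + h)]

/-- The pointwise energy estimate: up to horizontal derivatives, half of the second derivative of
`∑ gᵢ²` in the direction `z` is at least half of the fiberwise energy minus `17 ∑ gᵢ²`. -/
lemma IsEigenSystem.energy_le {l : ℝ} {g : Fin 3 → Solv → ℝ} (hg : IsEigenSystem l g) (hl : l ≤ 1)
    (p : Solv) :
    (1 / 2) * ∑ i, fiberEnergy (g i) p - 17 * ∑ i, g i p ^ 2 ≤
      (1 / 2) * frameDeriv 2 (frameDeriv 2 fun q => ∑ i, g i q ^ 2) p +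
      (frameDeriv 0 (fun q => ∑ i, g i q * frameDeriv 0 (g i) q + 2 * (g 0 q * g 2 q)) p +
        frameDeriv 1 (fun q => ∑ i, g i q * frameDeriv 1 (g i) q - 2 * (g 1 q * g 2 q)) p) := by
  have hs := hg.smooth
  have hd : ∀ i j, ContDiff ℝ ∞ (frameDeriv j (g i)) := fun i j => contDiff_frameDeriv (hs i) j
  have e1 : frameDeriv 2 (fun q => ∑ i, g i q ^ 2) =
      fun q => 2 * (g 0 q * frameDeriv 2 (g 0) q + g 1 q * frameDeriv 2 (g 1) q +
        g 2 q * frameDeriv 2 (g 2) q) := by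
    funext q
    simp only [Fin.sum_univ_three, pow_two]
    rw [frameDeriv_add (((hs 0).mul (hs 0)).add ((hs 1).mul (hs 1))) ((hs 2).mul (hs 2)),
      frameDeriv_add ((hs 0).mul (hs 0)) ((hs 1).mul (hs 1)), frameDeriv_mul (hs 0) (hs 0),
      frameDeriv_mul (hs 1) (hs 1), frameDeriv_mul (hs 2) (hs 2)]
    ring
  have hm : ∀ i j, ContDiff ℝ ∞ fun q => g i q * frameDeriv j (g i) q :=
    fun i j => (hs i).mul (hd i j)
  have hmm : ∀ i j, ContDiff ℝ ∞ fun q => g i q * g j q := fun i j => (hs i).mul (hs j)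
  have hcm : ∀ i j, ContDiff ℝ ∞ fun q => 2 * (g i q * g j q) := fun i j =>
    contDiff_const.mul (hmm i j)
  have hdm : ∀ i j k, frameDeriv k (fun q => g i q * frameDeriv j (g i) q) p =
      g i p * frameDeriv k (frameDeriv j (g i)) p +
        frameDeriv j (g i) p * frameDeriv k (g i) p := fun i j k =>
    frameDeriv_mul (hs i) (hd i j) k p
  rw [e1, frameDeriv_const_mul (((hm 0 2).add (hm 1 2)).add (hm 2 2)),
    frameDeriv_add ((hm 0 2).add (hm 1 2)) (hm 2 2), frameDeriv_add (hm 0 2) (hm 1 2)]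
  simp only [Fin.sum_univ_three]
  rw [frameDeriv_add (((hm 0 0).add (hm 1 0)).add (hm 2 0)) (hcm 0 2),
    frameDeriv_sub (((hm 0 1).add (hm 1 1)).add (hm 2 1)) (hcm 1 2),
    frameDeriv_add ((hm 0 0).add (hm 1 0)) (hm 2 0), frameDeriv_add (hm 0 0) (hm 1 0),
    frameDeriv_add ((hm 0 1).add (hm 1 1)) (hm 2 1), frameDeriv_add (hm 0 1) (hm 1 1),
    frameDeriv_const_mul (hmm 0 2), frameDeriv_const_mul (hmm 1 2),
    frameDeriv_mul (hs 0) (hs 2), frameDeriv_mul (hs 1) (hs 2)]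
  simp only [hdm, hg.zero p, hg.one p, hg.two p, fiberEnergy]
  have hl' : 0 ≤ 1 - l := by linarith
  -- The cross terms `4 g₂ E₀g₀` and `4 g₂ E₁g₁` are absorbed by half of the fiberwise energy, at
  -- the cost of `16 g₂²`.
  nlinarith [sq_nonneg (frameDeriv 2 (g 0) p), sq_nonneg (frameDeriv 2 (g 1) p),
    sq_nonneg (frameDeriv 2 (g 2) p), mul_nonneg hl' (sq_nonneg (g 0 p)),
    mul_nonneg hl' (sq_nonneg (g 1 p)), mul_nonneg hl' (sq_nonneg (g 2 p)),
    sq_nonneg (frameDeriv 0 (g 0) p + 4 * g 2 p), sq_nonneg (frameDeriv 1 (g 1) p - 4 * g 2 p),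
    sq_nonneg (frameDeriv 0 (g 1) p), sq_nonneg (frameDeriv 0 (g 2) p),
    sq_nonneg (frameDeriv 1 (g 0) p), sq_nonneg (frameDeriv 1 (g 2) p),
    sq_nonneg (g 0 p), sq_nonneg (g 1 p)]

lemma hasDerivAt_vertical {f : Solv → ℝ} (hf : Differentiable ℝ f) (z : ℝ) :
    HasDerivAt (fun t : ℝ => f (Pi.single 2 t)) (frameDeriv 2 f (Pi.single 2 z)) z := by
  have h1 : HasDerivAt (fun t : ℝ => (Pi.single 2 t : Solv)) (Pi.single 2 1) z := by
    have e : (fun t : ℝ => (Pi.single 2 t : Solv)) = fun t => t • (Pi.single 2 1 : Solv) := by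
      funext t; simp [← Pi.single_smul]
    rw [e]
    simpa using (hasDerivAt_id z).smul_const (Pi.single 2 1 : Solv)
  rw [frameDeriv, frame_two]
  exact (hf _).hasFDerivAt.comp_hasDerivAt z h1

lemma hasDerivAt_avg (hb : IsFiberBasis v w) {f : Solv → ℝ} (hf : ContDiff ℝ ∞ f) (z : ℝ) :
    HasDerivAt (fun t : ℝ => avg v w f (Pi.single 2 t)) (avg v w (frameDeriv 2 f) (Pi.single 2 z))
      z := by
  rw [avg_frameDeriv hb hf]
  exact hasDerivAt_vertical (fun p => (hasFDerivAt_avg hf p).differentiableAt) z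

/-- If the periods are `1/5`-dense in a dense set of fibers, then the bounded periodic solutions of
the eigenform equations with `l ≤ 1` and mean zero on the fibers vanish: the mean `N(z)` of `∑ gᵢ²`
satisfies `N'' ≥ 16 N`. -/
lemma IsEigenSystem.eq_zero_of_avg (hb : IsFiberBasis v w) {l : ℝ} (hl : l ≤ 1)
    {g : Fin 3 → Solv → ℝ} (hg : IsEigenSystem l g) {B : ℝ} (hB : ∀ i p, |g i p| ≤ B)
    (hp : ∀ i, IsCellPeriodic v w (g i)) {Λ : Set Solv} (hΛ : ∀ u ∈ Λ, u 2 = 0)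
    (hΛg : ∀ i, ∀ u ∈ Λ, ∀ q, g i (q + u) = g i q) (hnet : Dense {z | IsFiberNet Λ (1 / 5) z})
    (h0 : ∀ i p, avg v w (g i) p = 0) (i : Fin 3) (p : Solv) : g i p = 0 := by
  have hs := hg.smooth
  have hd : ∀ i j, ContDiff ℝ ∞ (frameDeriv j (g i)) := fun i j => contDiff_frameDeriv (hs i) j
  set S : Solv → ℝ := fun q => ∑ i, g i q ^ 2 with hS
  have hSs : ContDiff ℝ ∞ S := ContDiff.sum fun i _ => (hs i).pow 2
  have hS2 : ContDiff ℝ ∞ (frameDeriv 2 S) := contDiff_frameDeriv hSs 2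
  have hS3 : ContDiff ℝ ∞ (frameDeriv 2 (frameDeriv 2 S)) := contDiff_frameDeriv hS2 2
  -- the functions whose horizontal derivatives appear in the energy estimate
  set P : Solv → ℝ := fun q => ∑ i, g i q * frameDeriv 0 (g i) q + 2 * (g 0 q * g 2 q) with hP
  set Q : Solv → ℝ := fun q => ∑ i, g i q * frameDeriv 1 (g i) q - 2 * (g 1 q * g 2 q) with hQ
  have hPs : ContDiff ℝ ∞ P := (ContDiff.sum fun i _ => (hs i).mul (hd i 0)).add
    (contDiff_const.mul ((hs 0).mul (hs 2)))
  have hQs : ContDiff ℝ ∞ Q := (ContDiff.sum fun i _ => (hs i).mul (hd i 1)).sub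
    (contDiff_const.mul ((hs 1).mul (hs 2)))
  have hPp : IsCellPeriodic v w P :=
    ⟨fun x => by simp only [hP, (hp _).1, ((hp _).frameDeriv hb _).1],
      fun x => by simp only [hP, (hp _).2, ((hp _).frameDeriv hb _).2]⟩
  have hQp : IsCellPeriodic v w Q :=
    ⟨fun x => by simp only [hQ, (hp _).1, ((hp _).frameDeriv hb _).1],
      fun x => by simp only [hQ, (hp _).2, ((hp _).frameDeriv hb _).2]⟩
  have hEc : ∀ i, Continuous (fiberEnergy (g i)) := fun i => continuous_fiberEnergy (hs i)
  have hgc : ∀ i, Continuous fun q => g i q ^ 2 := fun i => (hs i).continuous.pow 2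
  have hSavg : ∀ q, avg v w S q = ∑ i, avg v w (fun q => g i q ^ 2) q := by
    exact avg_sum hgc
  have hgood : ∀ q : Solv, IsFiberNet Λ (1 / 5) (q 2) →
      16 * avg v w S q ≤ avg v w (frameDeriv 2 (frameDeriv 2 S)) q := by
    intro q hq
    have hpc := fun i => avg_sq_le hb (hs i) (hp i) hΛ (hΛg i) hq (h0 i q)
    have hPc := (contDiff_frameDeriv hPs 0).continuous
    have hQc := (contDiff_frameDeriv hQs 1).continuous
    have hSc := hSs.continuous
    have hS3c := hS3.continuous
    have hen := avg_mono hb (p := q)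
      (f := fun p => (1 / 2) * ∑ i, fiberEnergy (g i) p - 17 * S p)
      (g := fun p => (1 / 2) * frameDeriv 2 (frameDeriv 2 S) p +
        (frameDeriv 0 P p + frameDeriv 1 Q p))
      (by fun_prop) (by fun_prop) (fun p _ => hg.energy_le hl p)
    rw [avg_sub (by fun_prop) (by fun_prop), avg_add (by fun_prop) (by fun_prop),
      avg_add (by fun_prop) (by fun_prop), avg_frameDeriv_eq_zero hb hPs hPp (by decide),
      avg_frameDeriv_eq_zero hb hQs hQp (by decide), avg_const_mul, avg_const_mul,
      avg_const_mul, avg_sum hEc, Fin.sum_univ_three] at hen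
    have h3 := hSavg q
    rw [Fin.sum_univ_three] at h3
    -- The energy is at least `2 / (1/5)² = 50` times the mean square, and `50 / 2 - 17 = 16 / 2`.
    linarith [hpc 0, hpc 1, hpc 2]
  have hall : ∀ z : ℝ, 16 * avg v w S (Pi.single 2 z) ≤
      avg v w (frameDeriv 2 (frameDeriv 2 S)) (Pi.single 2 z) := by
    have hsing : Continuous fun z : ℝ => (Pi.single 2 z : Solv) := by
      refine continuous_pi fun i => ?_
      fin_cases i
      · exact continuous_const
      · exact continuous_const
      · exact continuous_id
    have hcl : IsClosed {z : ℝ | 16 * avg v w S (Pi.single 2 z) ≤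
        avg v w (frameDeriv 2 (frameDeriv 2 S)) (Pi.single 2 z)} :=
      isClosed_le (((continuous_avg hSs.continuous).comp hsing).const_mul _)
        ((continuous_avg hS3.continuous).comp hsing)
    have : ∀ z ∈ {z | IsFiberNet Λ (1 / 5) z}, z ∈ {z : ℝ | 16 * avg v w S (Pi.single 2 z) ≤
        avg v w (frameDeriv 2 (frameDeriv 2 S)) (Pi.single 2 z)} := fun z hz =>
      hgood _ (by simpa using hz)
    intro z
    exact hcl.closure_subset_iff.2 this (hnet z)
  have hSB : ∀ q, S q ≤ 3 * B ^ 2 := by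
    intro q
    have : ∀ i, g i q ^ 2 ≤ B ^ 2 := fun i => sq_le_sq' (abs_le.1 (hB i q)).1 (abs_le.1 (hB i q)).2
    simp only [hS, Fin.sum_univ_three]
    linarith [this 0, this 1, this 2]
  have hS0 : ∀ q, 0 ≤ S q := fun q => Finset.sum_nonneg fun i _ => sq_nonneg _
  have hN := eq_zero_of_bounded_of_le (N := fun z => avg v w S (Pi.single 2 z)) (B := 3 * B ^ 2)
    (by norm_num : (0 : ℝ) < 16) (fun z => avg_nonneg hS0 _)
    (fun z => (avg_mono hb hSs.continuous continuous_const fun q _ => hSB q).trans_eq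
      (avg_const _ _)) (hasDerivAt_avg hb hSs) (hasDerivAt_avg hb hS2) hall (p 2)
  refine eq_zero_of_avg_sq hb (hs i).continuous (hp i) (p := Pi.single 2 (p 2)) ?_ (by simp)
  rw [hSavg] at hN
  have hnn : ∀ i ∈ Finset.univ, 0 ≤ avg v w (fun q => g i q ^ 2) (Pi.single 2 (p 2)) :=
    fun i _ => avg_nonneg (fun q => sq_nonneg _) _
  exact (Finset.sum_eq_zero_iff_of_nonneg hnn).1 hN i (Finset.mem_univ i)

/-- Under the same assumptions, a bounded periodic solution is constant on the fibers: its
horizontal increments have mean zero on the fibers. -/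
lemma IsEigenSystem.horizontal_const (hb : IsFiberBasis v w) {l : ℝ} (hl : l ≤ 1)
    {f : Fin 3 → Solv → ℝ} (hf : IsEigenSystem l f) {B : ℝ} (hB : ∀ i p, |f i p| ≤ B)
    {Λ : Set Solv} (hv : v ∈ Λ) (hw : w ∈ Λ) (hΛ : ∀ u ∈ Λ, u 2 = 0)
    (hΛf : ∀ i, ∀ u ∈ Λ, ∀ q, f i (q + u) = f i q) (hnet : Dense {z | IsFiberNet Λ (1 / 5) z})
    {h : Solv} (hh : h 2 = 0) (i : Fin 3) (p : Solv) : f i (p + h) = f i p := by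
  have hper : ∀ i, ∀ u ∈ Λ, ∀ q, f i (q + u + h) - f i (q + u) = f i (q + h) - f i q := by
    intro i u hu q
    rw [add_right_comm, hΛf i u hu, hΛf i u hu]
  have := (hf.increment hh).eq_zero_of_avg hb hl (B := 2 * B) (fun i p => ?_)
    (fun i => ⟨hper i v hv, hper i w hw⟩) hΛ hper hnet (fun i p => ?_) i p
  · exact sub_eq_zero.1 this
  · rw [two_mul]
    exact (abs_sub _ _).trans (add_le_add (hB i _) (hB i _))
  · have hc := (hf.smooth i).continuous
    rw [avg_sub (by fun_prop) hc]
    have e : avg v w (fun q => f i (q + h)) p = avg v w (f i) (p + h) := by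
      unfold avg
      simp only [add_right_comm]
    rw [e, avg_shift hb hc ⟨hΛf i v hv, hΛf i w hw⟩ p hh, sub_self]

/-- A bounded solution of the eigenform equations which is constant on the fibers is given by
bounded solutions of `f₀'' = (1 - l) f₀`, `f₁'' = (1 - l) f₁`, `f₂' = 0`, `l f₂ = 0`. -/
lemma IsEigenSystem.eq_const {l : ℝ} (hl : l ≤ 1) {f : Fin 3 → Solv → ℝ} (hf : IsEigenSystem l f)
    {B : ℝ} (hB : ∀ i p, |f i p| ≤ B)
    (hh : ∀ i p, ∀ h : Solv, h 2 = 0 → f i (p + h) = f i p) :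
    (∀ i p, f i p = f i 0) ∧ (l < 1 → f 0 0 = 0 ∧ f 1 0 = 0) ∧ (l = 1 → f 2 0 = 0) := by
  have hs := hf.smooth
  have hd : ∀ i j, ContDiff ℝ ∞ (frameDeriv j (f i)) := fun i j => contDiff_frameDeriv (hs i) j
  have h1 : ∀ i j, j ≠ 2 → frameDeriv j (f i) = fun _ => 0 := fun i j hj => funext fun p =>
    frameDeriv_eq_zero_of_horizontal_const ((hs i).differentiable (by simp)) (hh i p) hj
  have h2 : ∀ j, frameDeriv j (fun _ => (0 : ℝ)) = fun _ => 0 := by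
    intro j; funext p; simp [frameDeriv]
  have h3 : frameDeriv 2 (f 2) = fun _ => 0 := by
    funext p
    simpa [h1 0 0 (by decide), h1 1 1 (by decide)] using hf.div p
  have e0 : ∀ p, frameDeriv 2 (frameDeriv 2 (f 0)) p = (1 - l) * f 0 p := by
    intro p
    have := hf.zero p
    simpa [h1 _ 0 (by decide), h1 _ 1 (by decide), h2] using this
  have e1 : ∀ p, frameDeriv 2 (frameDeriv 2 (f 1)) p = (1 - l) * f 1 p := by
    intro p
    have := hf.one p
    simpa [h1 _ 0 (by decide), h1 _ 1 (by decide), h2] using this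
  have e2 : ∀ p, l * f 2 p = 0 := by
    intro p
    have := hf.two p
    simp only [h1 _ 0 (by decide : (0 : Fin 3) ≠ 2), h1 _ 1 (by decide : (1 : Fin 3) ≠ 2), h2, h3]
      at this
    linarith
  have hv : ∀ i p, f i p = f i (Pi.single 2 (p 2)) := by
    intro i p
    have := hh i (Pi.single 2 (p 2)) (p - Pi.single 2 (p 2)) (by simp)
    rwa [add_sub_cancel] at this
  have hder : ∀ i z, HasDerivAt (fun t : ℝ => f i (Pi.single 2 t))
      (frameDeriv 2 (f i) (Pi.single 2 z)) z := fun i => hasDerivAt_vertical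
    ((hs i).differentiable (by simp))
  have hder2 : ∀ i z, HasDerivAt (fun t : ℝ => frameDeriv 2 (f i) (Pi.single 2 t))
      (frameDeriv 2 (frameDeriv 2 (f i)) (Pi.single 2 z)) z := fun i => hasDerivAt_vertical
    ((hd i 2).differentiable (by simp))
  have hconst : ∀ i, (∀ z : ℝ, frameDeriv 2 (f i) (Pi.single 2 z) = 0) →
      ∀ p, f i p = f i 0 := by
    intro i hi p
    have h5 := is_const_of_deriv_eq_zero (fun z => (hder i z).differentiableAt)
      (fun z => (hder i z).deriv.trans (hi z)) (p 2) 0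
    simp only [Pi.single_zero] at h5
    rw [hv i p, h5]
  rcases hl.lt_or_eq with hl | rfl
  · have hzero : ∀ i, (∀ p, frameDeriv 2 (frameDeriv 2 (f i)) p = (1 - l) * f i p) →
        ∀ p, f i p = 0 := by
      intro i hi p
      have h6 := eq_zero_of_bounded_of_le (N := fun t => f i (Pi.single 2 t) ^ 2)
        (N' := fun t => 2 * (f i (Pi.single 2 t) * frameDeriv 2 (f i) (Pi.single 2 t)))
        (N'' := fun t => 2 * (frameDeriv 2 (f i) (Pi.single 2 t) ^ 2 +
          (1 - l) * f i (Pi.single 2 t) ^ 2)) (B := B ^ 2) (c := 2 * (1 - l)) (by linarith)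
        (fun t => sq_nonneg _)
        (fun t => sq_le_sq' (abs_le.1 (hB i _)).1 (abs_le.1 (hB i _)).2)
        (fun t => ((hder i t).fun_pow 2).congr_deriv (by push_cast; ring))
        (fun t => (((hder i t).fun_mul (hder2 i t)).const_mul 2).congr_deriv (by rw [hi]; ring))
        (fun t => by
          linarith [sq_nonneg (frameDeriv 2 (f i) (Pi.single 2 t))]) (p 2)
      rw [hv i p]
      exact pow_eq_zero_iff (two_ne_zero) |>.1 h6
    refine ⟨fun i => ?_, fun _ => ⟨hzero 0 e0 0, hzero 1 e1 0⟩, fun h => absurd h hl.ne⟩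
    fin_cases i
    · exact fun p => (hzero 0 e0 p).trans (hzero 0 e0 0).symm
    · exact fun p => (hzero 1 e1 p).trans (hzero 1 e1 0).symm
    · exact hconst 2 fun z => congrFun h3 _
  · have hlin : ∀ i, (∀ p, frameDeriv 2 (frameDeriv 2 (f i)) p = (1 - 1) * f i p) →
        ∀ p, f i p = f i 0 := fun i hi => hconst i <|
      deriv_eq_zero_of_bounded_of_convex (fun z => hB i _) (hder i) (hder2 i)
        (fun z => by rw [hi]; simp)
    refine ⟨fun i => ?_, fun h => absurd h (lt_irrefl _), fun _ => by simpa using e2 0⟩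
    fin_cases i
    · exact hlin 0 e0
    · exact hlin 1 e1
    · exact hconst 2 fun z => congrFun h3 _

/-! ### Lattices of left translations -/

/-- `Γ` is a group of left translations of `Solv` which acts properly discontinuously and
cocompactly. -/
structure IsSolvLattice (Γ : Subgroup (Equiv.Perm Solv)) : Prop where
  left : ∀ γ ∈ Γ, IsLeftTranslation γ
  properlyDiscontinuous : ∀ K : Set Solv, IsCompact K →
    {γ : Equiv.Perm Solv | γ ∈ Γ ∧ (γ '' K ∩ K).Nonempty}.Finite
  cocompact : ∃ K : Set Solv, IsCompact K ∧ ∀ p, ∃ γ ∈ Γ, γ p ∈ K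

/-- The lattice of horizontal vectors by which `Γ` translates the fibers. -/
def horizontalPart (Γ : Subgroup (Equiv.Perm Solv)) : Set Solv :=
  {u | u 2 = 0 ∧ Equiv.addRight u ∈ Γ}

lemma IsLeftTranslation.eq_mul {φ : Solv → Solv} (h : IsLeftTranslation φ) (p : Solv) :
    φ p = mul (φ 0) p := by
  obtain ⟨q, hq⟩ := h
  have : φ 0 = q := by
    rw [hq]; ext i; fin_cases i <;> simp [mul]
  rw [this, hq]

lemma IsLeftTranslation.apply_zero {φ : Solv → Solv} (h : IsLeftTranslation φ) (p : Solv) :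
    φ p 0 = φ 0 0 + Real.exp (-(φ 0 2)) * p 0 := by
  rw [h.eq_mul p]; simp [mul]

lemma IsLeftTranslation.apply_one {φ : Solv → Solv} (h : IsLeftTranslation φ) (p : Solv) :
    φ p 1 = φ 0 1 + Real.exp (φ 0 2) * p 1 := by
  rw [h.eq_mul p]; simp [mul]

lemma IsLeftTranslation.apply_two {φ : Solv → Solv} (h : IsLeftTranslation φ) (p : Solv) :
    φ p 2 = φ 0 2 + p 2 := by
  rw [h.eq_mul p]; simp [mul]

variable {Γ : Subgroup (Equiv.Perm Solv)}

/-- A continuous invariant function on a cocompact space is bounded. -/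
lemma exists_bound_of_invariant (hc : ∃ K : Set Solv, IsCompact K ∧ ∀ p, ∃ γ ∈ Γ, γ p ∈ K)
    {f : Solv → ℝ} (hf : Continuous f) (hinv : ∀ γ ∈ Γ, ∀ p, f (γ p) = f p) :
    ∃ B, ∀ p, |f p| ≤ B := by
  obtain ⟨K, hK, hcov⟩ := hc
  obtain ⟨B, hB⟩ := hK.exists_bound_of_continuousOn hf.continuousOn
  refine ⟨B, fun p => ?_⟩
  obtain ⟨γ, hγ, hp⟩ := hcov p
  rw [← hinv γ hγ]
  exact hB _ hp

lemma IsSolvLattice.exists_vertical (hΓ : IsSolvLattice Γ) : ∃ t ∈ Γ, t 0 2 ≠ 0 := by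
  by_contra! h
  obtain ⟨B, hB⟩ := exists_bound_of_invariant hΓ.cocompact (f := fun p => p 2) (by fun_prop)
    fun γ hγ p => by rw [(hΓ.left γ hγ).apply_two, h γ hγ, zero_add]
  have := hB (Pi.single 2 (B + 1))
  simp only [Pi.single_eq_same] at this
  linarith [le_abs_self (B + 1)]

lemma IsSolvLattice.sub_mem (hΓ : IsSolvLattice Γ) {γ δ : Equiv.Perm Solv} (hγ : γ ∈ Γ)
    (hδ : δ ∈ Γ) (h : γ 0 2 = δ 0 2) : γ 0 - δ 0 ∈ horizontalPart Γ := by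
  refine ⟨by simp [h], ?_⟩
  have e : Equiv.addRight (γ 0 - δ 0) = γ * δ⁻¹ := by
    ext1 p
    obtain ⟨r, rfl⟩ := δ.surjective p
    have hl := hΓ.left γ hγ
    have hl' := hΓ.left δ hδ
    have hr : (δ⁻¹ : Equiv.Perm Solv) (δ r) = r := by simp
    rw [Equiv.coe_addRight, Equiv.Perm.mul_apply, hr]
    ext i
    fin_cases i
    · simp [hl.apply_zero r, hl'.apply_zero r, h]; ring
    · simp [hl.apply_one r, hl'.apply_one r, h]; ring
    · simp [hl.apply_two r, hl'.apply_two r, h]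
  rw [e]
  exact Γ.mul_mem hγ (Γ.inv_mem hδ)

/-- The elements of `Γ` preserving each fiber are the horizontal translations. -/
lemma IsSolvLattice.eq_add (hΓ : IsSolvLattice Γ) {γ : Equiv.Perm Solv} (hγ : γ ∈ Γ)
    (h : γ 0 2 = 0) (p : Solv) : γ p = p + γ 0 := by
  have hl := hΓ.left γ hγ
  ext i
  fin_cases i
  · simp [hl.apply_zero p, h, add_comm]
  · simp [hl.apply_one p, h, add_comm]
  · simp [hl.apply_two p, h]

/-- The action of an element of `Γ` on the horizontal vectors. -/
def conjHorizontal (τ : ℝ) (u : Solv) : Solv := ![Real.exp (-τ) * u 0, Real.exp τ * u 1, 0]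

lemma IsSolvLattice.conjHorizontal_mem (hΓ : IsSolvLattice Γ) {t : Equiv.Perm Solv} (ht : t ∈ Γ)
    {u : Solv} (hu : u ∈ horizontalPart Γ) : conjHorizontal (t 0 2) u ∈ horizontalPart Γ := by
  have hl := hΓ.left t ht
  have h := hΓ.sub_mem (Γ.mul_mem ht hu.2) ht (by
    simp [hl.apply_two u, hu.1])
  convert h using 1
  ext i
  fin_cases i
  · simp [conjHorizontal, hl.apply_zero u]
  · simp [conjHorizontal, hl.apply_one u]
  · simp [conjHorizontal, hl.apply_two u, hu.1]

lemma IsSolvLattice.finite_horizontalPart (hΓ : IsSolvLattice Γ) (R : ℝ) :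
    {u | u ∈ horizontalPart Γ ∧ ‖u‖ ≤ R}.Finite := by
  rcases lt_or_ge R 0 with hR | hR
  · convert Set.finite_empty
    ext u
    simp only [mem_ofPred_eq, mem_empty_iff_false, iff_false, not_and, not_le]
    exact fun _ => hR.trans_le (norm_nonneg u)
  refine Set.Finite.of_finite_image (f := Equiv.addRight) ((hΓ.properlyDiscontinuous
    (Metric.closedBall 0 R) (isCompact_closedBall 0 R)).subset ?_) ?_
  · rintro _ ⟨u, ⟨hu, huR⟩, rfl⟩
    refine ⟨hu.2, u, ⟨0, by simpa using hR, by simp⟩, by simpa using huR⟩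
  · intro u _ u' _ h
    simpa using congrArg (fun e : Equiv.Perm Solv => e 0) h

/-- If `Γ` contained no horizontal translation it would be abelian, hence contained in a
one-parameter subgroup, which does not act cocompactly. -/
lemma IsSolvLattice.exists_horizontal (hΓ : IsSolvLattice Γ) :
    ∃ u ∈ horizontalPart Γ, u ≠ 0 := by
  by_contra! h
  obtain ⟨t, ht, htne⟩ := hΓ.exists_vertical
  have hl := hΓ.left t ht
  have hcomm : ∀ q ∈ Γ, t 0 0 + Real.exp (-(t 0 2)) * q 0 0 =
      q 0 0 + Real.exp (-(q 0 2)) * t 0 0 := by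
    intro q hq
    have hlq := hΓ.left q hq
    have h1 := h _ (hΓ.sub_mem (Γ.mul_mem ht hq) (Γ.mul_mem hq ht) (by
      simp [hl.apply_two (q 0), hlq.apply_two (t 0), add_comm]))
    have h2 := congrFun h1 0
    simp [hl.apply_zero (q 0), hlq.apply_zero (t 0)] at h2
    linarith
  have hne : 1 - Real.exp (-(t 0 2)) ≠ 0 := by
    intro h0
    apply htne
    have := Real.exp_eq_one_iff _ |>.1 (sub_eq_zero.1 h0).symm
    linarith
  set a := t 0 0 / (1 - Real.exp (-(t 0 2))) with ha
  -- Commuting with `t` means fixing its axis `x = a`, so `e^z (x - a)` is invariant.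
  obtain ⟨B, hB⟩ := exists_bound_of_invariant hΓ.cocompact
    (f := fun p => Real.exp (p 2) * (p 0 - a)) (by fun_prop) (fun q hq p => by
      have hlq := hΓ.left q hq
      have hq0 : q 0 0 = a * (1 - Real.exp (-(q 0 2))) := by
        rw [ha, div_mul_eq_mul_div, eq_div_iff hne]
        linarith [hcomm q hq]
      have hs : Real.exp (q 0 2) * Real.exp (-(q 0 2)) = 1 := by rw [← Real.exp_add]; simp
      rw [hlq.apply_zero p, hlq.apply_two p, hq0, Real.exp_add]
      linear_combination (Real.exp (p 2) * (p 0 - a)) * hs)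
  have := hB (Pi.single 0 (a + B + 1))
  simp at this
  have h3 : a + B + 1 - a = B + 1 := by ring
  rw [h3] at this
  linarith [le_abs_self (B + 1)]

lemma IsSolvLattice.exists_vertical_sign (hΓ : IsSolvLattice Γ) :
    (∃ t ∈ Γ, 0 < t 0 2) ∧ ∃ t ∈ Γ, t 0 2 < 0 := by
  obtain ⟨t, ht, hne⟩ := hΓ.exists_vertical
  have hinv : (t⁻¹ : Equiv.Perm Solv) 0 2 = -(t 0 2) := by
    have := (hΓ.left t ht).apply_two ((t⁻¹ : Equiv.Perm Solv) 0)
    have e : t ((t⁻¹ : Equiv.Perm Solv) 0) = 0 := by simp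
    rw [e, Pi.zero_apply] at this
    linarith
  rcases lt_or_gt_of_ne hne with h | h
  · exact ⟨⟨t⁻¹, Γ.inv_mem ht, by rw [hinv]; linarith⟩, ⟨t, ht, h⟩⟩
  · exact ⟨⟨t, ht, h⟩, ⟨t⁻¹, Γ.inv_mem ht, by rw [hinv]; linarith⟩⟩

/-- No nonzero horizontal vector of `Γ` is an eigenvector of the hyperbolic action, as otherwise
its images would accumulate at zero. -/
lemma IsSolvLattice.horizontal_ne_zero (hΓ : IsSolvLattice Γ) {u : Solv}
    (hu : u ∈ horizontalPart Γ) (hne : u ≠ 0) : u 0 ≠ 0 ∧ u 1 ≠ 0 := by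
  have hiter : ∀ t ∈ Γ, ∀ n : ℕ,
      (![Real.exp (-(n * t 0 2)) * u 0, Real.exp (n * t 0 2) * u 1, 0] : Solv) ∈
        horizontalPart Γ := by
    intro t ht n
    induction n with
    | zero =>
      convert hu using 1
      ext i; fin_cases i <;> simp [hu.1]
    | succ n ih =>
      convert hΓ.conjHorizontal_mem ht ih using 1
      ext i
      fin_cases i
      · simp only [conjHorizontal, Nat.cast_succ, Fin.zero_eta, Matrix.cons_val_zero]
        rw [← mul_assoc, ← Real.exp_add]
        congr 2; ring
      · simp only [conjHorizontal, Nat.cast_succ, Fin.mk_one, Matrix.cons_val_one,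
          Matrix.cons_val_zero]
        rw [← mul_assoc, ← Real.exp_add]
        congr 2; ring
      · simp [conjHorizontal]
  obtain ⟨⟨t, ht, htpos⟩, ⟨t', ht', htneg⟩⟩ := hΓ.exists_vertical_sign
  constructor
  · intro h0
    have h1 : u 1 ≠ 0 := fun h1 => hne (by ext i; fin_cases i <;> simp [h0, h1, hu.1])
    refine Set.infinite_of_injective_forall_mem (f := fun n : ℕ =>
      (![Real.exp (-(n * t' 0 2)) * u 0, Real.exp (n * t' 0 2) * u 1, 0] : Solv)) ?_ ?_
      (hΓ.finite_horizontalPart ‖u‖)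
    · intro n m hnm
      have := congrFun hnm 1
      simp [h1, htneg.ne] at this
      exact this
    · intro n
      refine ⟨hiter t' ht' n, (pi_norm_le_iff_of_nonneg (norm_nonneg _)).2 fun i => ?_⟩
      fin_cases i
      · simp [h0]
      · simp only [Fin.mk_one, Matrix.cons_val_one, Matrix.cons_val_zero, norm_mul,
          Real.norm_eq_abs, Real.abs_exp]
        have h2 : Real.exp (n * t' 0 2) ≤ 1 :=
          Real.exp_le_one_iff.2 (mul_nonpos_of_nonneg_of_nonpos n.cast_nonneg htneg.le)
        exact (mul_le_of_le_one_left (abs_nonneg _) h2).trans (norm_le_pi_norm u 1)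
      · simp
  · intro h1
    have h0 : u 0 ≠ 0 := fun h0 => hne (by ext i; fin_cases i <;> simp [h0, h1, hu.1])
    refine Set.infinite_of_injective_forall_mem (f := fun n : ℕ =>
      (![Real.exp (-(n * t 0 2)) * u 0, Real.exp (n * t 0 2) * u 1, 0] : Solv)) ?_ ?_
      (hΓ.finite_horizontalPart ‖u‖)
    · intro n m hnm
      have := congrFun hnm 0
      simp [h0, htpos.ne'] at this
      exact this
    · intro n
      refine ⟨hiter t ht n, (pi_norm_le_iff_of_nonneg (norm_nonneg _)).2 fun i => ?_⟩
      fin_cases i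
      · simp only [Fin.zero_eta, Matrix.cons_val_zero, norm_mul,
          Real.norm_eq_abs, Real.abs_exp]
        have h2 : Real.exp (-(n * t 0 2)) ≤ 1 :=
          Real.exp_le_one_iff.2 (neg_nonpos.2 (mul_nonneg n.cast_nonneg htpos.le))
        exact (mul_le_of_le_one_left (abs_nonneg _) h2).trans (norm_le_pi_norm u 0)
      · simp [h1]
      · simp

lemma isFiberBasis_conj {u : Solv} (h2 : u 2 = 0) (h0 : u 0 ≠ 0) (h1 : u 1 ≠ 0) {τ : ℝ}
    (hτ : τ ≠ 0) : IsFiberBasis u (conjHorizontal τ u) := by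
  refine ⟨h2, by simp [conjHorizontal], ?_⟩
  have e : u 0 * conjHorizontal τ u 1 - u 1 * conjHorizontal τ u 0 =
      u 0 * u 1 * (Real.exp τ - Real.exp (-τ)) := by
    simp [conjHorizontal]; ring
  rw [e]
  refine mul_ne_zero (mul_ne_zero h0 h1) (sub_ne_zero.2 fun h => hτ ?_)
  have := Real.exp_injective h
  linarith

lemma isFiberBasis_conj_conj (hb : IsFiberBasis v w) (τ : ℝ) :
    IsFiberBasis (conjHorizontal τ v) (conjHorizontal τ w) := by
  refine ⟨by simp [conjHorizontal], by simp [conjHorizontal], ?_⟩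
  have hs : Real.exp τ * Real.exp (-τ) = 1 := by rw [← Real.exp_add]; simp
  have e : conjHorizontal τ v 0 * conjHorizontal τ w 1 - conjHorizontal τ v 1 *
      conjHorizontal τ w 0 = v 0 * w 1 - v 1 * w 0 := by
    simp [conjHorizontal]
    linear_combination (v 0 * w 1 - v 1 * w 0) * hs
  rw [e]; exact hb.det

lemma IsSolvLattice.exists_basis (hΓ : IsSolvLattice Γ) :
    ∃ v ∈ horizontalPart Γ, ∃ w ∈ horizontalPart Γ, IsFiberBasis v w := by
  obtain ⟨t, ht, hne⟩ := hΓ.exists_vertical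
  obtain ⟨u, hu, hune⟩ := hΓ.exists_horizontal
  obtain ⟨h0, h1⟩ := hΓ.horizontal_ne_zero hu hune
  exact ⟨u, hu, _, hΓ.conjHorizontal_mem ht hu, isFiberBasis_conj hu.1 h0 h1 hne⟩

/-! ### Rigidity of isometries normalizing a lattice -/

lemma fderiv_component {φ : Solv → Solv} (hφ : ContDiff ℝ ∞ φ) (k : Fin 3) (p u : Solv) :
    fderiv ℝ (fun q => φ q k) p u = fderiv ℝ φ p u k := by
  have h := (hasFDerivAt_pi'.1 (hφ.differentiable (by simp) p).hasFDerivAt) k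
  rw [h.fderiv]; rfl

lemma eq_affine_of_fderiv {g : Solv → ℝ} (hg : Differentiable ℝ g) {L : Solv}
    (h : ∀ p i, fderiv ℝ g p (Pi.single i 1) = L i) (p : Solv) : g p = g 0 + ∑ i, L i * p i := by
  have hL : ∀ p, HasFDerivAt (fun q : Solv => ∑ i, L i * q i)
      (∑ i, L i • ContinuousLinearMap.proj (R := ℝ) (φ := fun _ : Fin 3 => ℝ) i) p := fun p =>
    HasFDerivAt.fun_sum fun i _ => (hasFDerivAt_apply i p).const_mul (L i)
  have hz : ∀ p, fderiv ℝ (fun q => g q - ∑ i, L i * q i) p = 0 := by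
    intro p
    rw [((hg p).hasFDerivAt.fun_sub (hL p)).fderiv]
    apply ContinuousLinearMap.coe_injective
    refine (Pi.basisFun ℝ (Fin 3)).ext fun i => ?_
    simp [h, Pi.single_apply]
  have := is_const_of_fderiv_eq_zero (𝕜 := ℝ) (fun p => ((hg p).hasFDerivAt.fun_sub
    (hL p)).differentiableAt) hz p 0
  simp at this
  linarith

/-- The height function of an isometry has gradient of length one. -/
lemma IsIsometry.sum_sq_frameDeriv {φ : Solv → Solv} (hφ : IsIsometry φ) (p : Solv) :
    ∑ i, frameDeriv i (fun q => φ q 2) p ^ 2 = 1 := by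
  let A : Matrix (Fin 3) (Fin 3) ℝ := Matrix.of fun k i =>
    (frameScale k (φ p))⁻¹ * fderiv ℝ φ p (frame p i) k
  have hmet : ∀ q u w : Solv, metric q u w =
      ∑ k, ((frameScale k q)⁻¹ * u k) * ((frameScale k q)⁻¹ * w k) := by
    intro q u w
    have h2 : Real.exp (2 * q 2) = Real.exp (q 2) * Real.exp (q 2) := by
      rw [← Real.exp_add]; ring_nf
    have h3 : Real.exp (-2 * q 2) = Real.exp (-(q 2)) * Real.exp (-(q 2)) := by
      rw [← Real.exp_add]; ring_nf
    simp [metric, Fin.sum_univ_three, frameScale, ← Real.exp_neg, h2, h3, -neg_mul]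
    ring
  have hA : A.transpose * A = 1 := by
    ext i j
    have h := hφ.2 p (frame p i) (frame p j)
    rw [hmet, hmet] at h
    rw [Matrix.mul_apply]
    simp only [A, Matrix.transpose_apply, Matrix.of_apply]
    rw [h]
    simp only [frame_eq, Pi.smul_apply, smul_eq_mul, Pi.single_apply]
    have hne := fun k => (frameScale_pos k p).ne'
    rw [Matrix.one_apply]
    fin_cases i <;> fin_cases j <;> simp [hne]
  have hA' := mul_eq_one_comm.1 hA
  have h22 := congrFun (congrFun hA' 2) 2
  rw [Matrix.mul_apply, Matrix.one_apply_eq] at h22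
  rw [← h22]
  refine Finset.sum_congr rfl fun i _ => ?_
  simp only [A, Matrix.transpose_apply, Matrix.of_apply, frameDeriv, fderiv_component hφ.1]
  simp [frameScale, pow_two]

/-- `γ` normalizes the group `Γ`. -/
structure Normalizes (γ : Equiv.Perm Solv) (Γ : Subgroup (Equiv.Perm Solv)) : Prop where
  conj_mem : ∀ δ ∈ Γ, γ * δ * γ⁻¹ ∈ Γ
  inv_conj_mem : ∀ δ ∈ Γ, γ⁻¹ * δ * γ ∈ Γ

lemma Normalizes.inv {γ : Equiv.Perm Solv} (h : Normalizes γ Γ) : Normalizes γ⁻¹ Γ :=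
  ⟨fun δ hδ => by simpa using h.inv_conj_mem δ hδ, fun δ hδ => by simpa using h.conj_mem δ hδ⟩

lemma IsSolvLattice.height_mul (hΓ : IsSolvLattice Γ) {a b : Equiv.Perm Solv} (ha : a ∈ Γ) :
    (a * b) 0 2 = a 0 2 + b 0 2 := by
  rw [Equiv.Perm.mul_apply, (hΓ.left a ha).apply_two]

lemma IsSolvLattice.height_inv (hΓ : IsSolvLattice Γ) {a : Equiv.Perm Solv} (ha : a ∈ Γ) :
    (a⁻¹ : Equiv.Perm Solv) 0 2 = -(a 0 2) := by
  have := hΓ.height_mul (b := a⁻¹) ha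
  simp at this
  simp; linarith

/-- A horizontal translation commutes with all its conjugates, whereas a translation with vertical
part does not commute with its conjugates by horizontal translations. So every automorphism of the
lattice preserves its horizontal part. -/
lemma Normalizes.height_conj_eq_zero {γ : Equiv.Perm Solv} (h : Normalizes γ Γ)
    (hΓ : IsSolvLattice Γ) {δ : Equiv.Perm Solv} (hδ : δ ∈ Γ) (h0 : δ 0 2 = 0) :
    (γ * δ * γ⁻¹) 0 2 = 0 := by
  obtain ⟨u, hu, hune⟩ := hΓ.exists_horizontal
  have hu0 := (hΓ.horizontal_ne_zero hu hune).1
  set n := γ * δ * γ⁻¹ with hn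
  have hnΓ : n ∈ Γ := h.conj_mem δ hδ
  set b : Equiv.Perm Solv := Equiv.addRight u with hb
  have hcomm : n * (b * n * b⁻¹) = b * n * b⁻¹ * n := by
    set a := γ⁻¹ * b * γ with ha
    have haΓ : a ∈ Γ := h.inv_conj_mem b hu.2
    have hx : a * δ * a⁻¹ ∈ Γ := Γ.mul_mem (Γ.mul_mem haΓ hδ) (Γ.inv_mem haΓ)
    have hx0 : (a * δ * a⁻¹) 0 2 = 0 := by
      rw [hΓ.height_mul (Γ.mul_mem haΓ hδ), hΓ.height_mul haΓ, hΓ.height_inv haΓ, h0]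
      ring
    have h1 : δ * (a * δ * a⁻¹) = a * δ * a⁻¹ * δ := by
      ext1 p
      rw [Equiv.Perm.mul_apply δ, Equiv.Perm.mul_apply _ δ, hΓ.eq_add hδ h0 ((a * δ * a⁻¹) p),
        hΓ.eq_add hδ h0 p, hΓ.eq_add hx hx0 p, hΓ.eq_add hx hx0 (p + δ 0), add_right_comm]
    have h2 : b * n * b⁻¹ = γ * (a * δ * a⁻¹) * γ⁻¹ := by rw [ha, hn]; group
    have h3 : n * (b * n * b⁻¹) = γ * (δ * (a * δ * a⁻¹)) * γ⁻¹ := by rw [h2, hn]; group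
    rw [h3, h1, h2, hn]; group
  have hl := hΓ.left n hnΓ
  have hb1 : ∀ p : Solv, b p = p + u := fun p => rfl
  have hb2 : ∀ p : Solv, (b⁻¹ : Equiv.Perm Solv) p = p - u := fun p => by
    rw [hb]; simp [sub_eq_add_neg]
  -- In the `x`-coordinate, a left translation commutes with its conjugate by a horizontal
  -- translation only if its linear part is trivial.
  have h4 := congrArg (fun e : Equiv.Perm Solv => e 0 0) hcomm
  simp only [Equiv.Perm.mul_apply, hb1, hb2] at h4
  rw [hl.apply_zero (n (0 - u) + u), Pi.add_apply, Pi.add_apply, hl.apply_zero (0 - u),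
    hl.apply_zero (n 0 - u)] at h4
  simp only [Pi.sub_apply, Pi.zero_apply] at h4
  have h5 : (Real.exp (-(n 0 2)) - 1) ^ 2 * u 0 = 0 := by linear_combination -h4
  have h6 : Real.exp (-(n 0 2)) = 1 := by
    rcases mul_eq_zero.1 h5 with h | h
    · linarith [pow_eq_zero_iff (two_ne_zero) |>.1 h]
    · exact absurd h hu0
  have := (Real.exp_eq_one_iff _).1 h6
  linarith

/-- The height function of an element normalizing `Γ` is equivariant. -/
lemma Normalizes.height_apply {γ : Equiv.Perm Solv} (h : Normalizes γ Γ) (hΓ : IsSolvLattice Γ)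
    {δ : Equiv.Perm Solv} (hδ : δ ∈ Γ) (p : Solv) :
    γ (δ p) 2 = (γ * δ * γ⁻¹) 0 2 + γ p 2 := by
  have := (hΓ.left _ (h.conj_mem δ hδ)).apply_two (γ p)
  rw [← this]
  simp

lemma Normalizes.height_periodic {γ : Equiv.Perm Solv} (h : Normalizes γ Γ)
    (hΓ : IsSolvLattice Γ) {u : Solv} (hu : u ∈ horizontalPart Γ) (p : Solv) :
    γ (p + u) 2 = γ p 2 := by
  have h1 := h.height_apply hΓ hu.2 p
  rw [h.height_conj_eq_zero hΓ hu.2 (by simp [hu.1]), zero_add] at h1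
  exact h1

/-- The fiberwise mean of the height function of `γ` is equivariant under the translation of the
line induced by an element of `Γ`. -/
lemma Normalizes.avg_height_add {γ : Equiv.Perm Solv} (h : Normalizes γ Γ) (hΓ : IsSolvLattice Γ)
    (hγ : Continuous γ) (hv : v ∈ horizontalPart Γ) (hw : w ∈ horizontalPart Γ)
    (hb : IsFiberBasis v w) {t : Equiv.Perm Solv} (ht : t ∈ Γ) (z : ℝ) :
    avg v w (fun p => γ p 2) (Pi.single 2 (z + t 0 2)) =
      avg v w (fun p => γ p 2) (Pi.single 2 z) + (γ * t * γ⁻¹) 0 2 := by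
  have hl := hΓ.left t ht
  have hf : Continuous fun p => γ p 2 := by fun_prop
  have hper : IsCellPeriodic v w fun p => γ p 2 :=
    ⟨h.height_periodic hΓ hv, h.height_periodic hΓ hw⟩
  have hper' : IsCellPeriodic (conjHorizontal (t 0 2) v) (conjHorizontal (t 0 2) w)
      fun p => γ p 2 :=
    ⟨h.height_periodic hΓ (hΓ.conjHorizontal_mem ht hv),
      h.height_periodic hΓ (hΓ.conjHorizontal_mem ht hw)⟩
  have h1 : avg v w (fun p => γ p 2) (t (Pi.single 2 z)) =
      avg v w (fun p => γ p 2) (Pi.single 2 (z + t 0 2)) := by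
    have := avg_shift hb hf hper (Pi.single 2 (z + t 0 2))
      (h := t (Pi.single 2 z) - Pi.single 2 (z + t 0 2))
      (by simp [hl.apply_two (Pi.single 2 z), add_comm])
    rwa [add_sub_cancel] at this
  have h2 : ∀ u, t (Pi.single 2 z + cellPoint v w u) =
      t (Pi.single 2 z) + cellPoint (conjHorizontal (t 0 2) v) (conjHorizontal (t 0 2) w) u := by
    intro u
    ext i
    fin_cases i
    · simp [hl.apply_zero (Pi.single 2 z + _), hl.apply_zero (Pi.single 2 z), cellPoint,
        conjHorizontal]
      ring
    · simp [hl.apply_one (Pi.single 2 z + _), hl.apply_one (Pi.single 2 z), cellPoint,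
        conjHorizontal]
      ring
    · simp [hl.apply_two (Pi.single 2 z + _), hl.apply_two (Pi.single 2 z), cellPoint,
        conjHorizontal, hb.left, hb.right]
  rw [← h1, avg_eq_avg hb (isFiberBasis_conj_conj hb (t 0 2)) hf hper hper']
  have h3 : avg (conjHorizontal (t 0 2) v) (conjHorizontal (t 0 2) w) (fun p => γ p 2)
      (t (Pi.single 2 z)) =
      avg v w (fun p => γ p 2 + (γ * t * γ⁻¹) 0 2) (Pi.single 2 z) := by
    unfold avg
    simp only [← h2, h.height_apply hΓ ht, add_comm]
  rw [h3, avg_add hf continuous_const, avg_const]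

lemma IsIsometry.abs_frameDeriv_le {φ : Solv → Solv} (hφ : IsIsometry φ) (p : Solv) :
    |frameDeriv 2 (fun q => φ q 2) p| ≤ 1 := by
  have := hφ.sum_sq_frameDeriv p
  rw [Fin.sum_univ_three] at this
  rw [← sq_le_one_iff_abs_le_one]
  linarith [sq_nonneg (frameDeriv 0 (fun q => φ q 2) p),
    sq_nonneg (frameDeriv 1 (fun q => φ q 2) p)]

/-- As the fiberwise mean of the height function of `γ` is `1`-Lipschitz, conjugation by `γ` does
not increase the heights of elements of `Γ`. -/
lemma Normalizes.abs_height_le {γ : Equiv.Perm Solv} (h : Normalizes γ Γ) (hΓ : IsSolvLattice Γ)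
    (hγ : IsIsometry γ) {t : Equiv.Perm Solv} (ht : t ∈ Γ) :
    |(γ * t * γ⁻¹) 0 2| ≤ |t 0 2| := by
  obtain ⟨v, hv, w, hw, hb⟩ := hΓ.exists_basis
  have hf : ContDiff ℝ ∞ fun p => γ p 2 := (contDiff_apply ℝ ℝ 2).comp hγ.1
  have hd := (contDiff_frameDeriv hf 2).continuous
  have h1 := h.avg_height_add hΓ hγ.1.continuous hv hw hb ht 0
  have h2 : ∀ z : ℝ, ‖avg v w (frameDeriv 2 fun p => γ p 2) (Pi.single 2 z)‖ ≤ 1 := by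
    intro z
    rw [Real.norm_eq_abs, abs_le]
    constructor
    · rw [← avg_const (v := v) (w := w) (-1) (Pi.single 2 z)]
      exact avg_mono hb continuous_const hd fun q _ => (abs_le.1 (hγ.abs_frameDeriv_le q)).1
    · rw [← avg_const (v := v) (w := w) 1 (Pi.single 2 z)]
      exact avg_mono hb hd continuous_const fun q _ => (abs_le.1 (hγ.abs_frameDeriv_le q)).2
  have h3 := convex_univ.norm_image_sub_le_of_norm_hasDerivWithin_le
    (fun z _ => (hasDerivAt_avg hb hf z).hasDerivWithinAt) (fun z _ => h2 z)
    (mem_univ 0) (mem_univ (t 0 2))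
  rw [zero_add] at h1
  rw [h1] at h3
  simpa using h3

lemma const_of_antitone_of_periodic {u : ℝ → ℝ} (hu : Antitone u) {T : ℝ} (hT : T ≠ 0)
    (hp : Function.Periodic u T) (x y : ℝ) : u x = u y := by
  wlog hpos : 0 < T generalizing T
  · exact this (neg_ne_zero.2 hT) hp.neg (by
      rcases lt_or_gt_of_ne hT with h | h
      · linarith
      · exact absurd h hpos)
  have key : ∀ x y, x ≤ y → u x = u y := by
    intro x y hxy
    obtain ⟨n, hn⟩ := exists_nat_gt ((y - x) / T)
    rw [div_lt_iff₀ hpos] at hn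
    refine le_antisymm ?_ (hu hxy)
    have := hu (show y ≤ x + n * T by linarith)
    rwa [hp.nat_mul n x] at this
  rcases le_total x y with h | h
  · exact key x y h
  · exact (key y x h).symm

/-- An isometry normalizing a lattice maps fibers to fibers. Indeed, the fiberwise mean `F` of its
height function satisfies `|F'| ≤ 1`, and `κF - z` is periodic for a sign `κ`. So `F' = κ`, and then
the height function, whose gradient has length one, has vertical derivative `κ` everywhere. -/
lemma Normalizes.exists_height_eq {γ : Equiv.Perm Solv} (h : Normalizes γ Γ)
    (hΓ : IsSolvLattice Γ) (hγ : IsIsometry γ) (hγ' : IsIsometry (γ⁻¹ : Equiv.Perm Solv)) :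
    ∃ κ c : ℝ, (κ = 1 ∨ κ = -1) ∧ ∀ p, γ p 2 = κ * p 2 + c := by
  obtain ⟨v, hv, w, hw, hb⟩ := hΓ.exists_basis
  obtain ⟨t, ht, htne⟩ := hΓ.exists_vertical
  have hf : ContDiff ℝ ∞ fun p => γ p 2 := (contDiff_apply ℝ ℝ 2).comp hγ.1
  have hd := (contDiff_frameDeriv hf 2).continuous
  have hper : IsCellPeriodic v w fun p => γ p 2 :=
    ⟨h.height_periodic hΓ hv, h.height_periodic hΓ hw⟩
  set χ := (γ * t * γ⁻¹) 0 2 with hχ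
  have habs : |χ| = |t 0 2| := by
    refine le_antisymm (h.abs_height_le hΓ hγ ht) ?_
    have := h.inv.abs_height_le hΓ hγ' (h.conj_mem t ht)
    have e : γ⁻¹ * (γ * t * γ⁻¹) * γ⁻¹⁻¹ = t := by group
    rwa [e] at this
  obtain ⟨κ, hκ, hκχ⟩ : ∃ κ : ℝ, (κ = 1 ∨ κ = -1) ∧ κ * χ = t 0 2 := by
    rcases abs_eq_abs.1 habs with e | e
    · exact ⟨1, Or.inl rfl, by rw [e, one_mul]⟩
    · exact ⟨-1, Or.inr rfl, by rw [e]; ring⟩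
  have hκ2 : κ * κ = 1 := by rcases hκ with rfl | rfl <;> norm_num
  set F : ℝ → ℝ := fun z => avg v w (fun p => γ p 2) (Pi.single 2 z) with hF
  set F' : ℝ → ℝ := fun z => avg v w (frameDeriv 2 fun p => γ p 2) (Pi.single 2 z) with hF'
  have hder : ∀ z, HasDerivAt (fun z => κ * F z - z) (κ * F' z - 1) z := fun z =>
    ((hasDerivAt_avg hb hf z).const_mul κ).sub (hasDerivAt_id z)
  have hnonpos : ∀ z, κ * F' z - 1 ≤ 0 := by
    intro z
    have : avg v w (fun q => κ * frameDeriv 2 (fun p => γ p 2) q) (Pi.single 2 z) ≤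
        avg v w (fun _ => 1) (Pi.single 2 z) :=
      avg_mono hb (hd.const_mul κ) continuous_const fun q _ => by
        have h1 := abs_le.1 (hγ.abs_frameDeriv_le q)
        rcases hκ with rfl | rfl <;> linarith [h1.1, h1.2]
    rw [avg_const_mul, avg_const] at this
    linarith
  have hanti : Antitone fun z => κ * F z - z :=
    antitone_of_hasDerivAt_nonpos hder hnonpos
  have hperiodic : Function.Periodic (fun z => κ * F z - z) (t 0 2) := by
    intro z
    have : F (z + t 0 2) = F z + χ := h.avg_height_add hΓ hγ.1.continuous hv hw hb ht z
    simp only [this]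
    linear_combination hκχ
  have hFκ : ∀ z, F' z = κ := by
    intro z
    have e : (fun z => κ * F z - z) = fun _ => κ * F 0 - 0 := funext fun x =>
      const_of_antitone_of_periodic hanti htne hperiodic x 0
    have h1 := hder z
    rw [e] at h1
    have h2 := h1.unique (hasDerivAt_const z _)
    linear_combination κ * h2 - F' z * hκ2
  have hvert : ∀ p, frameDeriv 2 (fun p => γ p 2) p = κ := by
    intro p
    have hper2 := hper.frameDeriv hb 2
    have hz := eq_zero_of_avg_sq hb (f := fun q => frameDeriv 2 (fun p => γ p 2) q - κ)
      (by fun_prop) ⟨fun q => by simp only [hper2.1], fun q => by simp only [hper2.2]⟩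
      (p := Pi.single 2 (p 2)) (q := p) ?_ (by simp)
    · linarith
    refine le_antisymm ?_ (avg_nonneg (fun q => sq_nonneg _) _)
    have h1 : avg v w (fun q => (frameDeriv 2 (fun p => γ p 2) q - κ) ^ 2) (Pi.single 2 (p 2)) ≤
        avg v w (fun q => 2 - 2 * κ * frameDeriv 2 (fun p => γ p 2) q) (Pi.single 2 (p 2)) :=
      avg_mono hb (by fun_prop) (by fun_prop) fun q _ => by
        have := (sq_le_one_iff_abs_le_one _).2 (hγ.abs_frameDeriv_le q)
        nlinarith
    rw [avg_sub continuous_const (by fun_prop), avg_const_mul, avg_const] at h1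
    have h2 := hFκ (p 2)
    simp only [hF'] at h2
    rw [h2] at h1
    linarith
  have hhor : ∀ p, frameDeriv 0 (fun p => γ p 2) p = 0 ∧ frameDeriv 1 (fun p => γ p 2) p = 0 := by
    intro p
    have h1 := hγ.sum_sq_frameDeriv p
    rw [Fin.sum_univ_three, hvert p] at h1
    constructor <;> nlinarith [sq_nonneg (frameDeriv 0 (fun p => γ p 2) p),
      sq_nonneg (frameDeriv 1 (fun p => γ p 2) p)]
  have haff := eq_affine_of_fderiv (hf.differentiable (by simp)) (L := ![0, 0, κ]) fun p i => by
    have hcomp : ∀ i, fderiv ℝ (fun q => γ q 2) p (Pi.single i 1) =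
        (frameScale i p)⁻¹ * frameDeriv i (fun q => γ q 2) p := fun i => by
      rw [frameDeriv_eq, inv_mul_cancel_left₀ (frameScale_pos i p).ne']
    rw [hcomp]
    fin_cases i <;> simp [hhor p, hvert p, frameScale]
  refine ⟨κ, γ 0 2, hκ, fun p => ?_⟩
  rw [haff p, Fin.sum_univ_three]
  simp [add_comm]

/-! ### The group of a rational homology sphere -/

/-- `φ` is the composition of the map `(x, y, z) ↦ (ηy, ηx, -z)` with a left translation. It is an
orientation-preserving isometry if `η = ±1`. -/
def IsFlip (η : ℝ) (φ : Solv → Solv) : Prop :=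
  ∃ q : Solv, ∀ p, φ p = mul q ![η * p 1, η * p 0, -(p 2)]

lemma hasFDerivAt_mul (q p : Solv) : HasFDerivAt (mul q) (ContinuousLinearMap.pi
    fun i => (![Real.exp (-(q 2)), Real.exp (q 2), 1] : Fin 3 → ℝ) i •
      ContinuousLinearMap.proj (R := ℝ) (φ := fun _ : Fin 3 => ℝ) i) p := by
  refine hasFDerivAt_pi.2 fun i => ?_
  have h : ∀ i, HasFDerivAt (fun p : Solv => p i)
    (ContinuousLinearMap.proj (R := ℝ) (φ := fun _ : Fin 3 => ℝ) i) p := fun i =>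
    hasFDerivAt_apply i p
  fin_cases i
  · exact ((h 0).const_mul _).const_add _
  · exact ((h 1).const_mul _).const_add _
  · simpa [mul] using (h 2).const_add (q 2)

lemma contDiff_mul (q : Solv) : ContDiff ℝ ∞ (mul q) := by
  have h : ∀ i, ContDiff ℝ ∞ fun p : Solv => p i := fun i => contDiff_apply ℝ ℝ i
  refine contDiff_pi.2 fun i => ?_
  fin_cases i
  · exact contDiff_const.add (contDiff_const.mul (h 0))
  · exact contDiff_const.add (contDiff_const.mul (h 1))
  · exact contDiff_const.add (h 2)

/-- The linear map `(x, y, z) ↦ (ηy, ηx, -z)`. -/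
def flipMap (η : ℝ) : Solv →L[ℝ] Solv := ContinuousLinearMap.pi
  ![η • ContinuousLinearMap.proj 1, η • ContinuousLinearMap.proj 0, -ContinuousLinearMap.proj 2]

lemma flipMap_apply (η : ℝ) (p : Solv) : flipMap η p = ![η * p 1, η * p 0, -(p 2)] := by
  ext i; fin_cases i <;> simp [flipMap]

lemma IsLeftTranslation.contDiff {φ : Solv → Solv} (h : IsLeftTranslation φ) :
    ContDiff ℝ ∞ φ := by
  obtain ⟨q, hq⟩ := h
  rw [show φ = mul q from funext hq]
  exact contDiff_mul q

lemma IsFlip.contDiff {η : ℝ} {φ : Solv → Solv} (h : IsFlip η φ) : ContDiff ℝ ∞ φ := by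
  obtain ⟨q, hq⟩ := h
  rw [show φ = mul q ∘ flipMap η from funext fun p => by
    rw [hq, Function.comp_apply, flipMap_apply]]
  exact (contDiff_mul q).comp (flipMap η).contDiff

lemma IsLeftTranslation.fderiv_apply {φ : Solv → Solv} (h : IsLeftTranslation φ) (p u : Solv) :
    fderiv ℝ φ p u = ![Real.exp (-(φ 0 2)) * u 0, Real.exp (φ 0 2) * u 1, u 2] := by
  have e : φ = mul (φ 0) := funext h.eq_mul
  conv_lhs => rw [e]
  rw [(hasFDerivAt_mul _ p).fderiv]
  ext i; fin_cases i <;> simp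

lemma IsFlip.fderiv_apply {η : ℝ} {φ : Solv → Solv} (h : IsFlip η φ) (p u : Solv) :
    fderiv ℝ φ p u = ![Real.exp (-(φ 0 2)) * (η * u 1), Real.exp (φ 0 2) * (η * u 0), -(u 2)] := by
  obtain ⟨q, hq⟩ := h
  have e : φ = mul q ∘ flipMap η := funext fun p => by
    rw [hq, Function.comp_apply, flipMap_apply]
  have e2 : φ 0 2 = q 2 := by rw [hq]; simp [mul]
  rw [e2, e, ((hasFDerivAt_mul q _).comp p (flipMap η).hasFDerivAt).fderiv]
  ext i; fin_cases i <;> simp [flipMap_apply]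

lemma IsFlip.apply {η : ℝ} {φ : Solv → Solv} (h : IsFlip η φ) (p : Solv) :
    φ p = mul (φ 0) ![η * p 1, η * p 0, -(p 2)] := by
  obtain ⟨q, hq⟩ := h
  have e2 : φ 0 = q := by rw [hq]; ext i; fin_cases i <;> simp [mul]
  rw [e2, hq]

lemma IsFlip.apply_two {η : ℝ} {φ : Solv → Solv} (h : IsFlip η φ) (p : Solv) :
    φ p 2 = φ 0 2 - p 2 := by
  rw [h.apply p]; simp [mul, sub_eq_add_neg]

lemma IsLeftTranslation.fderiv_frame {φ : Solv → Solv} (h : IsLeftTranslation φ) (p : Solv)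
    (i : Fin 3) : fderiv ℝ φ p (frame p i) = frame (φ p) i := by
  rw [h.fderiv_apply]
  have h2 := h.apply_two p
  ext j
  fin_cases i <;> fin_cases j <;> simp [frame, h2, Real.exp_add]
  ring

lemma IsFlip.fderiv_frame {η : ℝ} {φ : Solv → Solv} (h : IsFlip η φ) (p : Solv) :
    fderiv ℝ φ p (frame p 0) = η • frame (φ p) 1 ∧
    fderiv ℝ φ p (frame p 1) = η • frame (φ p) 0 ∧
    fderiv ℝ φ p (frame p 2) = (-1 : ℝ) • frame (φ p) 2 := by
  have h2 := h.apply_two p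
  refine ⟨?_, ?_, ?_⟩ <;> rw [h.fderiv_apply] <;> ext j <;> fin_cases j <;>
    simp [frame, h2, sub_eq_add_neg, Real.exp_add] <;> ring

lemma det_eq_matrix_det (A : Solv →L[ℝ] Solv) :
    A.det = Matrix.det (Matrix.of fun i j => A (Pi.single j 1) i) := by
  rw [ContinuousLinearMap.det, ← LinearMap.det_toMatrix']
  congr 1

lemma IsLeftTranslation.isIsometry {φ : Solv → Solv} (h : IsLeftTranslation φ) :
    IsIsometry φ := by
  refine ⟨h.contDiff, fun p u v => ?_⟩
  have h2 := h.apply_two p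
  have hs : Real.exp (φ 0 2) * Real.exp (-(φ 0 2)) = 1 := by rw [← Real.exp_add]; simp
  have e1 : Real.exp (2 * (φ 0 2 + p 2)) = Real.exp (φ 0 2) * Real.exp (φ 0 2) *
      Real.exp (2 * p 2) := by rw [← Real.exp_add, ← Real.exp_add]; ring_nf
  have e2 : Real.exp (-2 * (φ 0 2 + p 2)) = Real.exp (-(φ 0 2)) * Real.exp (-(φ 0 2)) *
      Real.exp (-2 * p 2) := by rw [← Real.exp_add, ← Real.exp_add]; ring_nf
  rw [metric, metric, h.fderiv_apply, h.fderiv_apply, h2, e1, e2]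
  simp only [Matrix.cons_val_zero, Matrix.cons_val_one, Matrix.cons_val]
  linear_combination (Real.exp (2 * p 2) * u 0 * v 0 + Real.exp (-2 * p 2) * u 1 * v 1) *
    (Real.exp (φ 0 2) * Real.exp (-(φ 0 2)) + 1) * hs

lemma IsFlip.isIsometry {η : ℝ} (hη : η * η = 1) {φ : Solv → Solv} (h : IsFlip η φ) :
    IsIsometry φ := by
  refine ⟨h.contDiff, fun p u v => ?_⟩
  have h2 := h.apply_two p
  have hs : Real.exp (φ 0 2) * Real.exp (-(φ 0 2)) = 1 := by rw [← Real.exp_add]; simp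
  have e1 : Real.exp (2 * (φ 0 2 - p 2)) = Real.exp (φ 0 2) * Real.exp (φ 0 2) *
      Real.exp (-2 * p 2) := by rw [← Real.exp_add, ← Real.exp_add]; ring_nf
  have e2 : Real.exp (-2 * (φ 0 2 - p 2)) = Real.exp (-(φ 0 2)) * Real.exp (-(φ 0 2)) *
      Real.exp (2 * p 2) := by rw [← Real.exp_add, ← Real.exp_add]; ring_nf
  rw [metric, metric, h.fderiv_apply, h.fderiv_apply, h2, e1, e2]
  simp only [Matrix.cons_val_zero, Matrix.cons_val_one, Matrix.cons_val]
  linear_combination (Real.exp (2 * p 2) * u 0 * v 0 + Real.exp (-2 * p 2) * u 1 * v 1) *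
    ((Real.exp (φ 0 2) * Real.exp (-(φ 0 2)) + 1) * hs * (η * η) + hη)

lemma IsLeftTranslation.preservesOrientation {φ : Solv → Solv} (h : IsLeftTranslation φ) :
    PreservesOrientation φ := by
  intro p
  have hs : Real.exp (φ 0 2) * Real.exp (-(φ 0 2)) = 1 := by rw [← Real.exp_add]; simp
  rw [det_eq_matrix_det, Matrix.det_fin_three]
  simp only [Matrix.of_apply, h.fderiv_apply]
  simp
  positivity

lemma IsFlip.preservesOrientation {η : ℝ} (hη : η * η = 1) {φ : Solv → Solv} (h : IsFlip η φ) :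
    PreservesOrientation φ := by
  intro p
  rw [det_eq_matrix_det, Matrix.det_fin_three]
  simp only [Matrix.of_apply, h.fderiv_apply]
  simp
  have : 0 < Real.exp (-(φ 0 2)) * Real.exp (φ 0 2) * (η * η) := by rw [hη]; positivity
  linarith

/-- An isometry which reverses the height is a flip. Its derivative maps `∂z` to `-∂z`, so it is
determined by a map of the plane, which has to pull back the flat metric of every fiber to the one
of the corresponding fiber; this forces the plane map to interchange the directions of `x` and
`y`. -/
lemma IsIsometry.exists_isFlip {φ : Solv → Solv} (hφ : IsIsometry φ) (hor : PreservesOrientation φ)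
    {c : ℝ} (hc : ∀ p, φ p 2 = -(p 2) + c) : ∃ η : ℝ, η * η = 1 ∧ IsFlip η φ := by
  set J : Fin 3 → Fin 3 → Solv → ℝ := fun k i p => fderiv ℝ φ p (Pi.single i 1) k with hJ
  have hJk : ∀ k i p, fderiv ℝ (fun q => φ q k) p (Pi.single i 1) = J k i p := fun k i p =>
    fderiv_component hφ.1 k p _
  have hsm : ∀ k, ContDiff ℝ ∞ fun q => φ q k := fun k => (contDiff_apply ℝ ℝ k).comp hφ.1
  have hJ2 : ∀ i p, J 2 i p = -(Pi.single i 1 : Solv) 2 := by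
    intro i p
    have hdz : HasFDerivAt (fun q : Solv => q 2)
      (ContinuousLinearMap.proj (R := ℝ) (φ := fun _ : Fin 3 => ℝ) 2) p := hasFDerivAt_apply 2 p
    rw [← hJk, funext hc, (hdz.fun_neg.add_const c).fderiv]
    rfl
  have hmet : ∀ i p, Real.exp (2 * (c - p 2)) * J 0 i p ^ 2 +
      Real.exp (-2 * (c - p 2)) * J 1 i p ^ 2 + J 2 i p ^ 2 =
      metric p (Pi.single i 1) (Pi.single i 1) := by
    intro i p
    rw [← hφ.2 p, metric, hc p, show -(p 2) + c = c - p 2 by ring]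
    simp only [hJ]
    ring
  have hvert : ∀ p, J 0 2 p = 0 ∧ J 1 2 p = 0 := by
    intro p
    have h := hmet 2 p
    rw [hJ2] at h
    simp [metric] at h
    have h1 := mul_nonneg (Real.exp_pos (2 * (c - p 2))).le (sq_nonneg (J 0 2 p))
    have h2 := mul_nonneg (Real.exp_pos (-(2 * (c - p 2)))).le (sq_nonneg (J 1 2 p))
    have h3 : Real.exp (2 * (c - p 2)) * J 0 2 p ^ 2 = 0 := by linarith
    have h4 : Real.exp (-(2 * (c - p 2))) * J 1 2 p ^ 2 = 0 := by linarith
    simpa [(Real.exp_pos _).ne'] using And.intro h3 h4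
  have hinv : ∀ k, k ≠ 2 → ∀ i p, J k i (p + Pi.single 2 1) = J k i p := by
    intro k hk i p
    have hz : ∀ q, φ (q + Pi.single 2 1) k = φ q k := by
      intro q
      have hd : ∀ t : ℝ, HasDerivAt (fun t : ℝ => φ (q + t • Pi.single 2 1) k) 0 t := by
        intro t
        have h3 : HasDerivAt (fun t : ℝ => q + t • (Pi.single 2 1 : Solv)) (Pi.single 2 1) t := by
          simpa using ((hasDerivAt_id t).smul_const (Pi.single 2 1 : Solv)).const_add q
        have h4 := (((hsm k).differentiable (by simp) _).hasFDerivAt).comp_hasDerivAt t h3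
        rw [hJk] at h4
        have : J k 2 (q + t • Pi.single 2 1) = 0 := by
          fin_cases k
          · exact (hvert _).1
          · exact (hvert _).2
          · exact absurd rfl hk
        rwa [this] at h4
      have := is_const_of_deriv_eq_zero (fun t => (hd t).differentiableAt)
        (fun t => (hd t).deriv) 1 0
      simpa using this
    rw [← hJk, ← hJk, ← fderiv_comp_add_right, funext hz]
  -- The derivative is the same at `p` and at `p + ∂z`, but the metric coefficients differ.
  -- Comparing the isometry condition at these points eliminates the diagonal entries.
  have hshift : ∀ i p, Real.exp (-2) * (Real.exp (2 * (c - p 2)) * J 0 i p ^ 2) +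
      Real.exp 2 * (Real.exp (-2 * (c - p 2)) * J 1 i p ^ 2) + J 2 i p ^ 2 =
      metric (p + Pi.single 2 1) (Pi.single i 1) (Pi.single i 1) := by
    intro i p
    rw [← hmet, hinv 0 (by decide), hinv 1 (by decide), hJ2, hJ2, ← mul_assoc, ← mul_assoc,
      ← Real.exp_add, ← Real.exp_add]
    simp only [Pi.add_apply, Pi.single_eq_same]
    ring_nf
  have hlt : Real.exp (-2) < Real.exp 2 := Real.exp_lt_exp.2 (by norm_num)
  have hx : ∀ p, J 0 0 p = 0 ∧ J 1 0 p ^ 2 = Real.exp (2 * c) := by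
    intro p
    have h1 := hmet 0 p
    have h2 := hshift 0 p
    have e : Real.exp (2 * (p 2 + 1)) = Real.exp 2 * Real.exp (2 * p 2) := by
      rw [← Real.exp_add]; ring_nf
    simp [hJ2, metric, e] at h1 h2
    have h3 : (Real.exp 2 - Real.exp (-2)) * (Real.exp (2 * (c - p 2)) * J 0 0 p ^ 2) = 0 := by
      linear_combination Real.exp 2 * h1 - h2
    have h4 : J 0 0 p = 0 := by
      simpa [(Real.exp_pos _).ne', (sub_pos.2 hlt).ne'] using h3
    refine ⟨h4, ?_⟩
    rw [h4] at h1
    have e2 : Real.exp (2 * c) = Real.exp (2 * (c - p 2)) * Real.exp (2 * p 2) := by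
      rw [← Real.exp_add]; ring_nf
    have e3 : Real.exp (2 * (c - p 2)) * Real.exp (-(2 * (c - p 2))) = 1 := by
      rw [← Real.exp_add]; simp
    rw [e2]
    linear_combination Real.exp (2 * (c - p 2)) * h1 - J 1 0 p ^ 2 * e3
  have hy : ∀ p, J 1 1 p = 0 ∧ J 0 1 p ^ 2 = Real.exp (-(2 * c)) := by
    intro p
    have h1 := hmet 1 p
    have h2 := hshift 1 p
    have e : Real.exp (-(2 * (p 2 + 1))) = Real.exp (-2) * Real.exp (-(2 * p 2)) := by
      rw [← Real.exp_add]; ring_nf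
    simp [hJ2, metric, e] at h1 h2
    have h3 : (Real.exp 2 - Real.exp (-2)) * (Real.exp (-(2 * (c - p 2))) * J 1 1 p ^ 2) = 0 := by
      linear_combination h2 - Real.exp (-2) * h1
    have h4 : J 1 1 p = 0 := by
      simpa [(Real.exp_pos _).ne', (sub_pos.2 hlt).ne'] using h3
    refine ⟨h4, ?_⟩
    rw [h4] at h1
    have e2 : Real.exp (-(2 * c)) = Real.exp (-(2 * (c - p 2))) * Real.exp (-(2 * p 2)) := by
      rw [← Real.exp_add]; ring_nf
    have e3 : Real.exp (2 * (c - p 2)) * Real.exp (-(2 * (c - p 2))) = 1 := by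
      rw [← Real.exp_add]; simp
    rw [e2]
    linear_combination Real.exp (-(2 * (c - p 2))) * h1 - J 0 1 p ^ 2 * e3
  have hcc : Real.exp c * Real.exp (-c) = 1 := by rw [← Real.exp_add]; simp
  have hpos : ∀ p, 0 < J 0 1 p * J 1 0 p := by
    intro p
    have h := hor p
    rw [det_eq_matrix_det, Matrix.det_fin_three] at h
    simp only [Matrix.of_apply] at h
    change 0 < J 0 0 p * J 1 1 p * J 2 2 p - J 0 0 p * J 1 2 p * J 2 1 p -
      J 0 1 p * J 1 0 p * J 2 2 p + J 0 1 p * J 1 2 p * J 2 0 p + J 0 2 p * J 1 0 p * J 2 1 p -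
      J 0 2 p * J 1 1 p * J 2 0 p at h
    simp [hJ2, (hx p).1, (hvert p).1, (hvert p).2] at h
    exact h
  obtain ⟨η, hη, hηJ⟩ : ∃ η : ℝ, (η = 1 ∨ η = -1) ∧ ∀ p, Real.exp c * J 0 1 p = η := by
    have hcont : Continuous fun p => Real.exp c * J 0 1 p := by
      have : Continuous (fderiv ℝ φ) := hφ.1.continuous_fderiv (by simp)
      simp only [hJ]
      fun_prop
    have hsq : ∀ p, (Real.exp c * J 0 1 p) ^ 2 = 1 := by
      intro p
      rw [mul_pow, (hy p).2, ← Real.exp_nat_mul, ← Real.exp_add]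
      simp
    rcases isPreconnected_univ.eq_one_or_eq_neg_one_of_sq_eq (f := fun p => Real.exp c * J 0 1 p)
      hcont.continuousOn (fun p _ => hsq p) with h | h
    · exact ⟨1, Or.inl rfl, fun p => h (mem_univ p)⟩
    · exact ⟨-1, Or.inr rfl, fun p => h (mem_univ p)⟩
  have hη2 : η * η = 1 := by rcases hη with rfl | rfl <;> norm_num
  have h01 : ∀ p, J 0 1 p = Real.exp (-c) * η := by
    intro p
    rw [← hηJ p]
    linear_combination -J 0 1 p * hcc
  have h10 : ∀ p, J 1 0 p = Real.exp c * η := by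
    intro p
    have h1 : (J 1 0 p - Real.exp c * η) * (J 1 0 p + Real.exp c * η) = 0 := by
      have : Real.exp (2 * c) = Real.exp c * Real.exp c := by rw [← Real.exp_add]; ring_nf
      linear_combination (hx p).2 + this - Real.exp c * Real.exp c * hη2
    rcases mul_eq_zero.1 h1 with h | h
    · linarith
    · exfalso
      have h2 := hpos p
      rw [h01, eq_neg_of_add_eq_zero_left h] at h2
      have : Real.exp (-c) * η * -(Real.exp c * η) = -1 := by
        linear_combination -(η * η) * hcc - hη2
      linarith
  have ha := eq_affine_of_fderiv ((hsm 0).differentiable (by simp))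
    (L := ![0, Real.exp (-c) * η, 0]) fun p i => by
      rw [hJk]
      fin_cases i <;> simp [(hx p).1, h01 p, (hvert p).1]
  have hb := eq_affine_of_fderiv ((hsm 1).differentiable (by simp))
    (L := ![Real.exp c * η, 0, 0]) fun p i => by
      rw [hJk]
      fin_cases i <;> simp [(hy p).1, h10 p, (hvert p).2]
  have hc0 : φ 0 2 = c := by simpa using hc 0
  refine ⟨η, hη2, φ 0, fun p => ?_⟩
  ext i
  fin_cases i
  · simp [mul, ha p, Fin.sum_univ_three, hc0, mul_assoc]
  · simp [mul, hb p, Fin.sum_univ_three, hc0, mul_assoc]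
  · simp [mul, hc p, hc0]; ring

/-- The group `π` consists of the elements of the lattice `Γ` of left translations and of flips of
one sign `η`, and contains a flip. -/
structure IsFlipExtension (η : ℝ) (Γ π : Subgroup (Equiv.Perm Solv)) : Prop where
  lattice : IsSolvLattice Γ
  le : Γ ≤ π
  sq : η * η = 1
  flip : ∀ γ ∈ π, γ ∈ Γ ∨ IsFlip η γ
  exists_flip : ∃ a ∈ π, IsFlip η a

variable {π : Subgroup (Equiv.Perm Solv)}

lemma IsSolvManifold.isSolvLattice (hπ : IsSolvManifold π) (hle : Γ ≤ π)
    (hΓ : ∀ γ ∈ Γ, IsLeftTranslation γ) {a : Equiv.Perm Solv} (ha : a ∈ π)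
    (h : ∀ b ∈ π, a * b ∈ Γ ∨ b ∈ Γ) : IsSolvLattice Γ := by
  refine ⟨hΓ, fun K hK => (hπ.properlyDiscontinuous K hK).subset fun γ h => ⟨hle h.1, h.2⟩, ?_⟩
  obtain ⟨K, hK, hcov⟩ := hπ.cocompact
  refine ⟨K ∪ a '' K, hK.union (hK.image (hπ.isometry a ha).1.continuous), fun p => ?_⟩
  obtain ⟨γ, hγ, hp⟩ := hcov p
  rcases h γ hγ with h | h
  · exact ⟨a * γ, h, Or.inr ⟨γ p, hp, rfl⟩⟩
  · exact ⟨γ, h, Or.inl hp⟩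

lemma normalizes_of_relIndex (hle : Γ ≤ π) (h : Γ.relIndex π = 2) {γ : Equiv.Perm Solv}
    (hγ : γ ∈ π) : Normalizes γ Γ := by
  have hn : (Γ.subgroupOf π).Normal := Subgroup.normal_of_index_eq_two h
  have key : ∀ γ ∈ π, ∀ δ ∈ Γ, γ * δ * γ⁻¹ ∈ Γ := fun γ hγ δ hδ =>
    hn.conj_mem ⟨δ, hle hδ⟩ hδ ⟨γ, hγ⟩
  refine ⟨key γ hγ, fun δ hδ => ?_⟩
  simpa using key γ⁻¹ (π.inv_mem hγ) δ hδ

/-- If all elements of `π` act on the heights by translations then `dz` is a form on the quotient.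
It is not exact there, as `z` is unbounded. -/
lemma IsSolvManifold.not_firstBettiZero (hπ : IsSolvManifold π)
    (h : ∀ γ ∈ π, ∃ c, ∀ p, γ p 2 = p 2 + c) : ¬ FirstBettiZero π := by
  intro hb
  have hdz : ∀ p, HasFDerivAt (fun q : Solv => q 2)
    (ContinuousLinearMap.proj (R := ℝ) (φ := fun _ : Fin 3 => ℝ) 2) p := fun p =>
    hasFDerivAt_apply 2 p
  have hα : IsFormOnQuotient π (fun _ => ContinuousAlternatingMap.ofSubsingleton ℝ Solv ℝ
      (0 : Fin 1) (ContinuousLinearMap.proj (R := ℝ) (φ := fun _ : Fin 3 => ℝ) 2)) := by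
    refine ⟨contDiff_const, fun γ hγ p => ?_⟩
    obtain ⟨c, hc⟩ := h γ hγ
    ext u
    have h1 := fderiv_component (hπ.isometry γ hγ).1 2 p (u 0)
    rw [funext hc, ((hdz p).add_const c).fderiv] at h1
    simpa using h1.symm
  obtain ⟨f, ⟨hf, hinv⟩, hd⟩ := hb _ hα (extDeriv_const _)
  have hg : ContDiff ℝ ∞ fun p => f p ![] := contDiff_apply_const hf _
  have haff := eq_affine_of_fderiv (hg.differentiable (by simp)) (L := ![0, 0, 1])
    fun p i => by
      have h1 := congrArg (fun α => α ![Pi.single i 1]) (congrFun hd p)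
      simp only [extDeriv_apply (hf.differentiable (by simp) p)] at h1
      have e : (0 : Fin 1).removeNth ![(Pi.single i 1 : Solv)] = ![] := Subsingleton.elim _ _
      simp [e] at h1
      rw [h1]
      fin_cases i <;> simp
  obtain ⟨B, hB⟩ := exists_bound_of_invariant hπ.cocompact hg.continuous fun γ hγ p => by
    have h1 := congrArg (fun α => α ![]) (hinv γ hγ p)
    simp only [ContinuousAlternatingMap.compContinuousLinearMap_apply] at h1
    rw [← h1]
    congr 1
    exact Subsingleton.elim _ _
  have h0 := abs_le.1 (hB 0)
  have h1 := hB (Pi.single 2 (2 * B + 1))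
  rw [haff] at h1
  simp [Fin.sum_univ_three] at h1
  have := (abs_le.1 h1).2
  linarith [h0.1]

/-- The group of a rational homology sphere consists of left translations and flips: its elements
map fibers to fibers, those outside of the lattice reverse the heights as the first Betti number
vanishes, and the composition of two flips is a left translation only if their signs agree. -/
lemma IsSolvRationalHomologySphere.exists_isFlipExtension (hπ : IsSolvRationalHomologySphere π) :
    ∃ (η : ℝ) (Γ : Subgroup (Equiv.Perm Solv)), IsFlipExtension η Γ π := by
  obtain ⟨Γ, hle, hidx, hleft⟩ := hπ.doubleCover
  obtain ⟨a₀, ha₀, ha₀Γ, hcos⟩ := Subgroup.relIndex_eq_two_iff_exists_notMem_and'.1 hidx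
  have hΓ := hπ.toIsSolvManifold.isSolvLattice hle hleft ha₀ hcos
  have hheight : ∀ γ ∈ π, ∃ κ c : ℝ, (κ = 1 ∨ κ = -1) ∧ ∀ p, γ p 2 = κ * p 2 + c := fun γ hγ =>
    (normalizes_of_relIndex hle hidx hγ).exists_height_eq hΓ (hπ.isometry γ hγ)
      (hπ.isometry γ⁻¹ (π.inv_mem hγ))
  have hflip : ∀ γ ∈ π, ∀ c : ℝ, (∀ p, γ p 2 = -1 * p 2 + c) →
      ∃ η : ℝ, η * η = 1 ∧ IsFlip η γ := fun γ hγ c hc =>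
    (hπ.isometry γ hγ).exists_isFlip (hπ.orientable γ hγ) fun p => by rw [hc, neg_one_mul]
  obtain ⟨a, ha, c, hc⟩ : ∃ a ∈ π, ∃ c : ℝ, ∀ p, a p 2 = -1 * p 2 + c := by
    by_contra! hcon
    refine hπ.toIsSolvManifold.not_firstBettiZero (fun γ hγ => ?_) hπ.firstBetti
    obtain ⟨κ, c, rfl | rfl, hc⟩ := hheight γ hγ
    · exact ⟨c, fun p => by rw [hc, one_mul]⟩
    · obtain ⟨p, hp⟩ := hcon γ hγ c
      exact absurd (hc p) hp
  obtain ⟨η, hη, haη⟩ := hflip a ha c hc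
  have haΓ : a ∉ Γ := by
    intro h
    have h1 := (hΓ.left a h).apply_two (Pi.single 2 1)
    rw [hc, hc] at h1
    simp at h1
    linarith
  have hmul : ∀ b ∈ π, b ∉ Γ → b * a ∈ Γ := by
    intro b hb hbΓ
    have h1 : a₀ * a ∈ Γ := (hcos a ha).resolve_right haΓ
    have h2 : a₀ * b⁻¹ ∈ Γ := (hcos b⁻¹ (π.inv_mem hb)).resolve_right fun h =>
      hbΓ (by simpa using Γ.inv_mem h)
    have h3 := Γ.mul_mem (Γ.inv_mem h2) h1
    rwa [show (a₀ * b⁻¹)⁻¹ * (a₀ * a) = b * a by group] at h3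
  refine ⟨η, Γ, hΓ, hle, hη, fun b hb => or_iff_not_imp_left.2 fun hbΓ => ?_, a, ha, haη⟩
  have hl := hΓ.left _ (hmul b hb hbΓ)
  obtain ⟨κ, c', rfl | rfl, hc'⟩ := hheight b hb
  · have h1 := hl.apply_two (Pi.single 2 1)
    simp [hc, hc'] at h1
    linarith
  · obtain ⟨η', hη', hbη'⟩ := hflip b hb c' hc'
    -- the composition multiplies the `x`-coordinate by a positive multiple of `η' * η`
    have h1 := hl.apply_zero (Pi.single 0 1)
    have hb1 := hbη'.apply (a (Pi.single 0 1))
    have hb2 := hbη'.apply (a 0)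
    have ha1 := haη.apply (Pi.single 0 1)
    simp only [Equiv.Perm.mul_apply] at h1
    rw [hb1, hb2, ha1] at h1
    simp [mul] at h1
    have h2 : Real.exp (-(b 0 2)) * Real.exp (a 0 2) ≠ 0 := by positivity
    have h3 : η' * η = 1 := mul_left_cancel₀ h2 (by
      rw [Real.exp_add] at h1
      linear_combination h1)
    have h4 : η' = η := by linear_combination η * h3 - η' * hη
    rwa [← h4]

/-! ### The coexact eigenspaces -/

/-- The pullback of the differential form `α` by the map `φ`. -/
def pullback {k : ℕ} (φ : Solv → Solv) (α : Form k) : Form k := fun p =>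
  (α (φ p)).compContinuousLinearMap (fderiv ℝ φ p)

lemma comp_pullback (φ : Solv → Solv) (ξ : Form 1) (i : Fin 3) (p : Solv) :
    comp (pullback φ ξ) i p = ξ (φ p) ![fderiv ℝ φ p (frame p i)] := by
  simp only [comp, pullback, ContinuousAlternatingMap.compContinuousLinearMap_apply]
  congr 1
  ext j; simp

lemma IsLeftTranslation.comp_pullback {φ : Solv → Solv} (h : IsLeftTranslation φ) (ξ : Form 1)
    (i : Fin 3) (p : Solv) : comp (pullback φ ξ) i p = comp ξ i (φ p) := by
  rw [SolvGeometry.comp_pullback, h.fderiv_frame, comp]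

lemma IsFlip.comp_pullback {η : ℝ} {φ : Solv → Solv} (h : IsFlip η φ) (ξ : Form 1) (p : Solv) :
    comp (pullback φ ξ) 0 p = η * comp ξ 1 (φ p) ∧
    comp (pullback φ ξ) 1 p = η * comp ξ 0 (φ p) ∧
    comp (pullback φ ξ) 2 p = -comp ξ 2 (φ p) := by
  obtain ⟨h0, h1, h2⟩ := h.fderiv_frame p
  rw [SolvGeometry.comp_pullback, SolvGeometry.comp_pullback, SolvGeometry.comp_pullback, h0, h1,
    h2, apply_smul_vec, apply_smul_vec, apply_smul_vec, neg_one_mul]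
  exact ⟨rfl, rfl, rfl⟩

lemma extDeriv_pullback_eq {k : ℕ} {φ : Solv → Solv} (hφ : ContDiff ℝ ∞ φ) {α : Form k}
    (hα : ContDiff ℝ ∞ α) : extDeriv (pullback φ α) = pullback φ (extDeriv α) :=
  funext fun p => extDeriv_pullback (hα.differentiable (by simp) _) hφ.contDiffAt
    (by simpa using ENat.LEInfty.out)

lemma IsFormOnQuotient.pullback_eq {k : ℕ} {α : Form k} (hα : IsFormOnQuotient π α)
    {γ : Equiv.Perm Solv} (hγ : γ ∈ π) : pullback γ α = α := funext (hα.2 γ hγ)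

lemma IsFormOnQuotient.extDeriv {k : ℕ} {α : Form k} (hα : IsFormOnQuotient π α)
    (hπ : ∀ γ ∈ π, ContDiff ℝ ∞ γ) : IsFormOnQuotient π (extDeriv α) := by
  refine ⟨contDiff_extDeriv hα.1, fun γ hγ p => ?_⟩
  have h := extDeriv_pullback_eq (hπ γ hγ) hα.1
  rw [hα.pullback_eq hγ] at h
  exact congrFun h.symm p

lemma IsFormOnQuotient.const_smul {k : ℕ} {α : Form k} (hα : IsFormOnQuotient π α) (c : ℝ) :
    IsFormOnQuotient π (c • α) :=
  ⟨hα.1.const_smul c, fun γ hγ p => congrArg (c • ·) (hα.2 γ hγ p)⟩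

lemma curl_const (c : Fin 3 → ℝ) : star₂ (extDeriv (ofComp fun i _ => c i)) =
    ofComp fun i _ => (![c 1, c 0, 0] : Fin 3 → ℝ) i := by
  have hs : ContDiff ℝ ∞ (ofComp fun i _ => c i) := contDiff_ofComp fun i => contDiff_const
  have hd : ∀ (i : Fin 3) (a : ℝ) (p : Solv), frameDeriv i (fun _ => a) p = 0 := by
    intro i a p; simp [frameDeriv]
  refine form_one_ext fun i => funext fun p => ?_
  obtain ⟨h0, h1, h2⟩ := comp_curl hs p
  simp only [comp_ofComp, hd] at h0 h1 h2
  rw [comp_ofComp]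
  fin_cases i
  · simpa using h0
  · simpa using h1
  · simpa using h2

/-- The left-invariant `1`-form `η e^z dx + e^{-z} dy`. -/
def invariantForm (η : ℝ) : Form 1 := ofComp fun i _ => (![η, 1, 0] : Fin 3 → ℝ) i

lemma invariantForm_ne_zero (η : ℝ) : invariantForm η ≠ 0 := by
  intro h
  have h1 : comp (invariantForm η) 1 0 = 1 := by rw [invariantForm, comp_ofComp]; simp
  rw [h] at h1
  simp [comp] at h1

lemma codiff₂_extDeriv_invariantForm (η c : ℝ) :
    codiff₂ (extDeriv (c • invariantForm η)) = c • invariantForm η := by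
  have e : c • invariantForm η = ofComp fun i _ => (![c * η, c, 0] : Fin 3 → ℝ) i :=
    form_one_ext fun i => funext fun p => by
      have hs : comp (c • invariantForm η) i p = c * comp (invariantForm η) i p := rfl
      rw [hs, invariantForm, comp_ofComp, comp_ofComp]
      fin_cases i <;> simp
  rw [e, codiff₂, curl_const, curl_const]
  congr

lemma IsFlipExtension.contDiff {η : ℝ} (h : IsFlipExtension η Γ π) {γ : Equiv.Perm Solv}
    (hγ : γ ∈ π) : ContDiff ℝ ∞ γ := by
  rcases h.flip γ hγ with h1 | h1
  · exact (h.lattice.left γ h1).contDiff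
  · exact h1.contDiff

lemma IsFlipExtension.isFormOnQuotient {η : ℝ} (h : IsFlipExtension η Γ π) :
    IsFormOnQuotient π (invariantForm η) := by
  refine ⟨contDiff_ofComp fun i => contDiff_const, fun γ hγ p => ?_⟩
  refine form_one_ext_at (ξ := pullback γ (invariantForm η)) fun i => ?_
  have hc : ∀ i p, comp (invariantForm η) i p = (![η, 1, 0] : Fin 3 → ℝ) i := fun i p => by
    rw [invariantForm, comp_ofComp]
  rcases h.flip γ hγ with h1 | h1
  · rw [(h.lattice.left γ h1).comp_pullback, hc, hc]
  · obtain ⟨e0, e1, e2⟩ := h1.comp_pullback (invariantForm η) p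
    simp only [hc] at e0 e1 e2
    rw [hc]
    fin_cases i
    · simpa using e0
    · simpa [h.sq] using e1
    · simpa using e2

lemma IsFlipExtension.smul_invariantForm_mem {η : ℝ} (h : IsFlipExtension η Γ π) (c : ℝ) :
    c • invariantForm η ∈ coexactEigenspace π 1 := by
  have hc := h.isFormOnQuotient.const_smul c
  have hβ := hc.extDeriv fun γ hγ => h.contDiff hγ
  refine ⟨hc, ⟨_, hβ, (codiff₂_extDeriv_invariantForm η c).symm⟩, ?_⟩
  have h0 : extDeriv (0 : Form 0) = 0 := extDeriv_const 0
  have h1 : codiff₁ (c • invariantForm η) = 0 := by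
    rw [← codiff₂_extDeriv_invariantForm η c]
    exact codiff₁_codiff₂ hβ.1
  rw [hodgeLaplacian, h1, h0, codiff₂_extDeriv_invariantForm, zero_add, one_smul]

/-- On a quotient with small fibers, a coexact eigenform of eigenvalue at most `1` has constant
components. The flip leaves a single candidate. -/
lemma IsFlipExtension.eq_smul_invariantForm {η l : ℝ} (h : IsFlipExtension η Γ π) (hl : l ≤ 1)
    (hnet : Dense {z | IsFiberNet (horizontalPart Γ) (1 / 5) z}) {ξ : Form 1}
    (hξ : ξ ∈ coexactEigenspace π l) :
    ∃ c : ℝ, ξ = c • invariantForm η ∧ (l < 1 → c = 0) := by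
  have hsys := isEigenSystem_of_mem hξ
  have hinv : ∀ i, ∀ γ ∈ Γ, ∀ p, comp ξ i (γ p) = comp ξ i p := by
    intro i γ hγ p
    rw [← (h.lattice.left γ hγ).comp_pullback ξ i p, hξ.1.pullback_eq (h.le hγ)]
  have hbd : ∀ i, ∃ B, ∀ p, |comp ξ i p| ≤ B := fun i =>
    exists_bound_of_invariant h.lattice.cocompact (hsys.smooth i).continuous (hinv i)
  choose B hB using hbd
  have hB' : ∀ i p, |comp ξ i p| ≤ ∑ j, |B j| := fun i p =>
    (hB i p).trans ((le_abs_self _).trans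
      (Finset.single_le_sum (f := fun j => |B j|) (fun j _ => abs_nonneg _) (Finset.mem_univ i)))
  obtain ⟨v, hv, w, hw, hb⟩ := h.lattice.exists_basis
  have hhor : ∀ i p, ∀ u : Solv, u 2 = 0 → comp ξ i (p + u) = comp ξ i p := fun i p u hu =>
    hsys.horizontal_const hb hl hB' hv hw (fun u hu => hu.1)
      (fun i u hu q => hinv i _ hu.2 q) hnet hu i p
  obtain ⟨hconst, hlt, -⟩ := hsys.eq_const hl hB' hhor
  obtain ⟨a, ha, hflip⟩ := h.exists_flip
  obtain ⟨-, e1, e2⟩ := hflip.comp_pullback ξ 0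
  rw [hξ.1.pullback_eq ha, hconst _ (a 0)] at e1 e2
  refine ⟨comp ξ 1 0, form_one_ext fun i => funext fun p => ?_, fun h1 => (hlt h1).2⟩
  have hs : comp (comp ξ 1 0 • invariantForm η) i p =
      comp ξ 1 0 * comp (invariantForm η) i p := rfl
  rw [hs, hconst, invariantForm, comp_ofComp]
  fin_cases i
  · simp
    linear_combination -comp ξ 0 0 * h.sq - η * e1
  · simp
  · simp
    linarith

lemma IsSolvManifold.countable (hπ : IsSolvManifold π) : {γ | γ ∈ π}.Countable := by
  refine (countable_iUnion fun n : ℕ => (hπ.properlyDiscontinuous (Metric.closedBall 0 n)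
    (isCompact_closedBall 0 _)).countable).mono fun γ hγ => mem_iUnion.2 ?_
  obtain ⟨n, hn⟩ := exists_nat_ge ‖γ 0‖
  exact ⟨n, hγ, γ 0, ⟨0, by simp, rfl⟩, by simpa using hn⟩

/-- Away from the heights fixed by a flip, the fiber is the quotient of the plane by the horizontal
translations in the lattice. -/
lemma IsFlipExtension.isFiberNet {η ε z : ℝ} (h : IsFlipExtension η Γ π)
    (hf : FibersSmallerThan π ε) (hz : ∀ γ ∈ π, γ 0 2 ≠ 2 * z) :
    IsFiberNet (horizontalPart Γ) ε z := by
  intro u hu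
  obtain ⟨γ, hγ, h2, hd⟩ := hf (Pi.single 2 z + u) (Pi.single 2 z) (by simp [hu])
  simp only [Pi.add_apply, Pi.single_eq_same, hu, add_zero] at h2
  rcases h.flip γ hγ with h1 | h1
  · have h0 : γ 0 2 = 0 := by
      have := (h.lattice.left γ h1).apply_two (Pi.single 2 z)
      simp only [Pi.single_eq_same] at this
      linarith
    refine ⟨γ 0, by simpa using h.lattice.sub_mem h1 (Γ.one_mem) (by simpa using h0), ?_⟩
    rw [planeDist, h.lattice.eq_add h1 h0] at hd
    simp only [Pi.add_apply, Pi.single_eq_same, hu, add_zero, ne_eq, Fin.reduceEq,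
      not_false_eq_true, Pi.single_eq_of_ne, zero_add] at hd
    simp only [fiberNormSq, Pi.sub_apply]
    exact (Real.sqrt_le_left ((Real.sqrt_nonneg _).trans hd.le)).1 hd.le
  · have := h1.apply_two (Pi.single 2 z)
    simp only [Pi.single_eq_same] at this
    exact absurd (by linarith) (hz γ hγ)

/-- The heights fixed by flips are countable in number, so the fibers at the other heights, which
are tori, form a dense set. -/
theorem IsSolvRationalHomologySphere.firstCoexactEigenvalueIsSimpleOne
    (hπ : IsSolvRationalHomologySphere π) (hf : FibersSmallerThan π (1 / 5)) :
    FirstCoexactEigenvalueIsSimpleOne π := by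
  obtain ⟨η, Γ, h⟩ := hπ.exists_isFlipExtension
  have hnet : Dense {z | IsFiberNet (horizontalPart Γ) (1 / 5) z} := by
    have hc := (hπ.toIsSolvManifold.countable.image fun γ => γ 0 2 / 2).dense_compl ℝ
    refine hc.mono fun z hz => h.isFiberNet hf fun γ hγ hγz => ?_
    exact hz ⟨γ, hγ, by simp only [hγz]; ring⟩
  have hne := invariantForm_ne_zero η
  refine ⟨⟨⟨_, by simpa using h.smul_invariantForm_mem 1, hne⟩, ?_⟩, invariantForm η, hne,
    Set.ext fun ξ => ?_⟩
  · rintro l ⟨ξ, hξ, hne⟩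
    by_contra! hl
    obtain ⟨c, rfl, hc⟩ := h.eq_smul_invariantForm hl.le hnet hξ
    exact hne (by rw [hc hl, zero_smul])
  · rw [SetLike.mem_coe, Submodule.mem_span_singleton]
    constructor
    · intro hξ
      obtain ⟨c, rfl, -⟩ := h.eq_smul_invariantForm le_rfl hnet hξ
      exact ⟨c, rfl⟩
    · rintro ⟨c, rfl⟩
      exact h.smul_invariantForm_mem c

/-! ### Fibers have bounded diameter -/

lemma zsmul_add_zsmul_mem_horizontalPart (hv : v ∈ horizontalPart Γ) (hw : w ∈ horizontalPart Γ)
    (n m : ℤ) : n • v + m • w ∈ horizontalPart Γ := by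
  let A : AddSubgroup Solv :=
    { carrier := horizontalPart Γ
      zero_mem' := ⟨rfl, by
        convert Γ.one_mem
        ext1 p
        simp⟩
      add_mem' := fun {a b} ha hb => ⟨by simp [ha.1, hb.1], by
        convert Γ.mul_mem hb.2 ha.2
        ext1 p
        simp [add_assoc]⟩
      neg_mem' := fun {a} ha => ⟨by simp [ha.1], by
        convert Γ.inv_mem ha.2
        ext1 p
        simp⟩ }
  exact A.add_mem (A.zsmul_mem hv n) (A.zsmul_mem hw m)

/-- The lattice brings every fiber to bounded height, where a fixed basis of horizontal translations
is available; its conjugate is of bounded size in the metric of the original fiber. -/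
lemma IsSolvLattice.exists_fibersSmallerThan (hΓ : IsSolvLattice Γ) :
    ∃ D : ℝ, 0 < D ∧ FibersSmallerThan Γ D := by
  obtain ⟨v, hv, w, hw, hb⟩ := hΓ.exists_basis
  obtain ⟨K, hK, hcov⟩ := hΓ.cocompact
  obtain ⟨B, hB⟩ := hK.exists_bound_of_continuousOn (f := fun p : Solv => p 2) (by fun_prop)
  set M := Real.exp B * (|v 0| + |w 0| + |v 1| + |w 1|) with hM
  have hM0 : 0 ≤ M := by positivity
  refine ⟨M + 1, by positivity, fun p q hpq => ?_⟩
  obtain ⟨t, ht, htp⟩ := hcov p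
  have hbd := abs_le.1 (hB _ htp)
  rw [(hΓ.left t ht).apply_two] at hbd
  set τ := (t⁻¹ : Equiv.Perm Solv) 0 2 with hτ
  have hτt : τ = -(t 0 2) := hΓ.height_inv ht
  have ht' := Γ.inv_mem ht
  obtain ⟨⟨a, b⟩, hab⟩ := (isFiberBasis_conj_conj hb τ).exists_eq (h := p - q) (by simp [hpq])
  have h0 := congrFun hab 0
  have h1 := congrFun hab 1
  set u := ⌊a⌋ • conjHorizontal τ v + ⌊b⌋ • conjHorizontal τ w with hu
  have huΓ : u ∈ horizontalPart Γ := zsmul_add_zsmul_mem_horizontalPart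
    (hΓ.conjHorizontal_mem ht' hv) (hΓ.conjHorizontal_mem ht' hw) _ _
  refine ⟨Equiv.addRight u, huΓ.2, by simp [huΓ.1, hpq], ?_⟩
  have hx : p 0 - (q + u) 0 = Int.fract a * (Real.exp (-τ) * v 0) +
      Int.fract b * (Real.exp (-τ) * w 0) := by
    simp only [hu, cellPoint, Pi.add_apply, Pi.smul_apply, Pi.sub_apply, smul_eq_mul] at h0 ⊢
    simp only [conjHorizontal, zsmul_eq_mul, Matrix.cons_val_zero, Int.fract] at h0 ⊢
    linear_combination h0
  have hy : p 1 - (q + u) 1 = Int.fract a * (Real.exp τ * v 1) +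
      Int.fract b * (Real.exp τ * w 1) := by
    simp only [hu, cellPoint, Pi.add_apply, Pi.smul_apply, Pi.sub_apply, smul_eq_mul] at h1 ⊢
    simp only [conjHorizontal, zsmul_eq_mul, Matrix.cons_val_zero, Matrix.cons_val_one,
      Int.fract] at h1 ⊢
    linear_combination h1
  have hfr : ∀ a b x y : ℝ, |Int.fract a * x + Int.fract b * y| ≤ |x| + |y| := by
    intro a b x y
    refine (abs_add_le _ _).trans (add_le_add ?_ ?_) <;> rw [abs_mul, Int.abs_fract] <;>
      exact mul_le_of_le_one_left (abs_nonneg _) (Int.fract_lt_one _).le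
  have key : ∀ σ a b x y : ℝ, σ ≤ B →
      |Real.exp σ * (Int.fract a * x + Int.fract b * y)| ≤ Real.exp B * (|x| + |y|) := by
    intro σ a b x y hσ
    rw [abs_mul, Real.abs_exp]
    exact mul_le_mul (Real.exp_le_exp.2 hσ) (hfr a b x y) (abs_nonneg _) (Real.exp_pos _).le
  have kx := key (p 2 - τ) a b (v 0) (w 0) (by linarith [hbd.2])
  have ky := key (τ - p 2) a b (v 1) (w 1) (by linarith [hbd.1])
  rw [planeDist, Real.sqrt_lt' (by positivity), Equiv.coe_addRight, hx, hy]
  set X := Real.exp (p 2 - τ) * (Int.fract a * v 0 + Int.fract b * w 0) with hX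
  set Y := Real.exp (τ - p 2) * (Int.fract a * v 1 + Int.fract b * w 1) with hY
  have e1 : Real.exp (2 * p 2) * (Int.fract a * (Real.exp (-τ) * v 0) +
      Int.fract b * (Real.exp (-τ) * w 0)) ^ 2 = |X| ^ 2 := by
    rw [sq_abs, hX, show Real.exp (2 * p 2) = Real.exp (p 2) * Real.exp (p 2) by
      rw [← Real.exp_add]; ring_nf, sub_eq_add_neg, Real.exp_add]
    ring
  have e2 : Real.exp (-2 * p 2) * (Int.fract a * (Real.exp τ * v 1) +
      Int.fract b * (Real.exp τ * w 1)) ^ 2 = |Y| ^ 2 := by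
    rw [sq_abs, hY, show Real.exp (-2 * p 2) = Real.exp (-(p 2)) * Real.exp (-(p 2)) by
      rw [← Real.exp_add]; ring_nf, sub_eq_add_neg, Real.exp_add]
    ring
  rw [e1, e2]
  have hXY : |X| + |Y| ≤ M := by rw [hM]; linarith
  nlinarith [abs_nonneg X, abs_nonneg Y]

/-! ### Rescaling the fibers -/

/-- The dilation by `s` along the fibers as a linear map. -/
def fiberDilationCLM (s : ℝ) : Solv →L[ℝ] Solv := ContinuousLinearMap.pi
  ![s • ContinuousLinearMap.proj 0, s • ContinuousLinearMap.proj 1, ContinuousLinearMap.proj 2]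

lemma fiberDilationCLM_apply (s : ℝ) (p : Solv) :
    fiberDilationCLM s p = ![s * p 0, s * p 1, p 2] := by
  ext i; fin_cases i <;> simp [fiberDilationCLM]

variable {s : ℝ} {hs : s ≠ 0}

lemma coe_fiberDilation : ⇑(fiberDilation s hs) = fiberDilationCLM s :=
  funext fun p => (fiberDilationCLM_apply s p).symm

lemma coe_fiberDilation_inv : ⇑(fiberDilation s hs)⁻¹ = fiberDilationCLM s⁻¹ :=
  funext fun p => (fiberDilationCLM_apply s⁻¹ p).symm

lemma mem_rescaleFibers {γ : Equiv.Perm Solv} : γ ∈ rescaleFibers s hs π ↔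
    ∃ δ ∈ π, fiberDilation s hs * δ * (fiberDilation s hs)⁻¹ = γ := by
  simp [rescaleFibers, Subgroup.mem_map]

lemma IsLeftTranslation.conj_fiberDilation {δ : Equiv.Perm Solv} (h : IsLeftTranslation δ) :
    IsLeftTranslation ⇑(fiberDilation s hs * δ * (fiberDilation s hs)⁻¹) := by
  obtain ⟨q, hq⟩ := h
  refine ⟨fiberDilationCLM s q, fun p => ?_⟩
  rw [Equiv.Perm.mul_apply, Equiv.Perm.mul_apply, coe_fiberDilation, coe_fiberDilation_inv, hq]
  simp only [fiberDilationCLM_apply]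
  ext i
  fin_cases i <;> simp [mul] <;> field_simp

lemma IsFlip.conj_fiberDilation {η : ℝ} {δ : Equiv.Perm Solv} (h : IsFlip η δ) :
    IsFlip η ⇑(fiberDilation s hs * δ * (fiberDilation s hs)⁻¹) := by
  obtain ⟨q, hq⟩ := h
  refine ⟨fiberDilationCLM s q, fun p => ?_⟩
  rw [Equiv.Perm.mul_apply, Equiv.Perm.mul_apply, coe_fiberDilation, coe_fiberDilation_inv, hq]
  simp only [fiberDilationCLM_apply]
  ext i
  fin_cases i <;> simp [mul] <;> field_simp

lemma pullback_comp {k : ℕ} {φ ψ : Solv → Solv} (hφ : ContDiff ℝ ∞ φ) (hψ : ContDiff ℝ ∞ ψ)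
    (α : Form k) : pullback (φ ∘ ψ) α = pullback ψ (pullback φ α) := by
  funext p
  ext u
  simp only [pullback, ContinuousAlternatingMap.compContinuousLinearMap_apply]
  rw [fderiv_comp p (hφ.differentiable (by simp) _) (hψ.differentiable (by simp) _)]
  rfl

/-- The pullback of a form by a linear map intertwining two groups. -/
lemma IsFormOnQuotient.pullback_clm {k : ℕ} {P Q : Subgroup (Equiv.Perm Solv)} {α : Form k}
    (hα : IsFormOnQuotient P α) (hP : ∀ γ ∈ P, ContDiff ℝ ∞ γ) (hQ : ∀ γ ∈ Q, ContDiff ℝ ∞ γ)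
    (L : Solv →L[ℝ] Solv) (h : ∀ γ ∈ Q, ∃ δ ∈ P, L ∘ γ = δ ∘ L) :
    IsFormOnQuotient Q (pullback L α) := by
  refine ⟨?_, fun γ hγ p => ?_⟩
  · have e : pullback L α = fun p =>
        ContinuousAlternatingMap.compContinuousLinearMapCLM L (α (L p)) := by
      funext p
      rw [pullback, L.fderiv]
      rfl
    rw [e]
    exact (ContinuousLinearMap.contDiff _).comp (hα.1.comp L.contDiff)
  · obtain ⟨δ, hδ, e⟩ := h γ hγ
    refine congrFun (f := pullback γ (pullback L α)) ?_ p
    rw [← pullback_comp L.contDiff (hQ γ hγ), e, pullback_comp (hP δ hδ) L.contDiff,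
      hα.pullback_eq hδ]

lemma FirstBettiZero.rescaleFibers (hb : FirstBettiZero π) (hπ : ∀ γ ∈ π, ContDiff ℝ ∞ γ)
    (hπ' : ∀ γ ∈ rescaleFibers s hs π, ContDiff ℝ ∞ γ) :
    FirstBettiZero (rescaleFibers s hs π) := by
  intro α hα hd
  have hL : ∀ γ ∈ π, ∃ δ ∈ SolvGeometry.rescaleFibers s hs π,
      fiberDilationCLM s ∘ γ = δ ∘ fiberDilationCLM s := fun γ hγ => by
    refine ⟨_, mem_rescaleFibers.2 ⟨γ, hγ, rfl⟩, ?_⟩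
    rw [← coe_fiberDilation (hs := hs)]
    funext p
    simp
  have hL' : ∀ γ ∈ SolvGeometry.rescaleFibers s hs π, ∃ δ ∈ π,
      fiberDilationCLM s⁻¹ ∘ γ = δ ∘ fiberDilationCLM s⁻¹ := fun γ hγ => by
    obtain ⟨δ, hδ, rfl⟩ := mem_rescaleFibers.1 hγ
    refine ⟨δ, hδ, ?_⟩
    rw [← coe_fiberDilation_inv (hs := hs)]
    funext p
    simp
  obtain ⟨f, hf, hfd⟩ := hb _ (hα.pullback_clm hπ' hπ _ hL) (by
    rw [extDeriv_pullback_eq (fiberDilationCLM s).contDiff hα.1, hd]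
    funext p
    ext u
    simp [pullback])
  refine ⟨_, hf.pullback_clm hπ hπ' _ hL', ?_⟩
  rw [extDeriv_pullback_eq (fiberDilationCLM s⁻¹).contDiff hf.1, hfd,
    ← pullback_comp (fiberDilationCLM s).contDiff (fiberDilationCLM s⁻¹).contDiff]
  have e : fiberDilationCLM s ∘ fiberDilationCLM s⁻¹ = id := by
    rw [← coe_fiberDilation (hs := hs), ← coe_fiberDilation_inv (hs := hs)]
    funext p
    simp
  rw [e]
  funext p
  ext u
  simp only [pullback, fderiv_id, ContinuousAlternatingMap.compContinuousLinearMap_apply]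
  rfl

/-- Rescaling the fibers gives another rational homology sphere. -/
lemma IsSolvRationalHomologySphere.rescaleFibers (hπ : IsSolvRationalHomologySphere π) :
    IsSolvRationalHomologySphere (rescaleFibers s hs π) := by
  obtain ⟨η, Γ, h⟩ := hπ.exists_isFlipExtension
  set δ := fiberDilation s hs with hδ
  have hcont : Continuous δ := by rw [hδ, coe_fiberDilation]; exact (fiberDilationCLM s).continuous
  have hcont' : Continuous (δ⁻¹ : Equiv.Perm Solv) := by
    rw [hδ, coe_fiberDilation_inv]; exact (fiberDilationCLM s⁻¹).continuous
  have hel : ∀ γ ∈ SolvGeometry.rescaleFibers s hs π, IsIsometry γ ∧ PreservesOrientation γ := by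
    intro γ hγ
    obtain ⟨γ, hγ', rfl⟩ := mem_rescaleFibers.1 hγ
    rcases h.flip γ hγ' with h1 | h1
    · have := (h.lattice.left γ h1).conj_fiberDilation (hs := hs)
      exact ⟨this.isIsometry, this.preservesOrientation⟩
    · have := h1.conj_fiberDilation (hs := hs)
      exact ⟨this.isIsometry h.sq, this.preservesOrientation h.sq⟩
  refine ⟨⟨fun γ hγ => (hel γ hγ).1, ?_, fun K hK => ?_, ?_⟩, fun γ hγ => (hel γ hγ).2,
    hπ.firstBetti.rescaleFibers (fun γ hγ => h.contDiff hγ) fun γ hγ => (hel γ hγ).1.1, ?_⟩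
  · intro γ hγ p hp
    obtain ⟨γ, hγ', rfl⟩ := mem_rescaleFibers.1 hγ
    have := hπ.free γ hγ' ((δ⁻¹ : Equiv.Perm Solv) p) (δ.injective (by simpa using hp))
    simp [this]
  · refine ((hπ.properlyDiscontinuous _ (hK.image hcont')).image
      fun γ => δ * γ * δ⁻¹).subset ?_
    rintro _ ⟨hγ, _, ⟨p, hp, rfl⟩, hpK⟩
    obtain ⟨γ, hγ', rfl⟩ := mem_rescaleFibers.1 hγ
    exact ⟨γ, ⟨hγ', γ ((δ⁻¹ : Equiv.Perm Solv) p), ⟨_, ⟨p, hp, rfl⟩, rfl⟩, _, hpK, by simp [hδ]⟩,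
      rfl⟩
  · obtain ⟨K, hK, hcov⟩ := hπ.cocompact
    refine ⟨δ '' K, hK.image hcont, fun p => ?_⟩
    obtain ⟨γ, hγ, hp⟩ := hcov ((δ⁻¹ : Equiv.Perm Solv) p)
    exact ⟨_, mem_rescaleFibers.2 ⟨γ, hγ, rfl⟩, _, hp, rfl⟩
  · obtain ⟨Γ, hle, hidx, hleft⟩ := hπ.doubleCover
    refine ⟨SolvGeometry.rescaleFibers s hs Γ, Subgroup.map_mono hle, ?_, fun γ hγ => ?_⟩
    · rw [SolvGeometry.rescaleFibers, SolvGeometry.rescaleFibers,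
        Subgroup.relIndex_map_map_of_injective _ _ (MulAut.conj _).injective, hidx]
    · obtain ⟨γ, hγ', rfl⟩ := mem_rescaleFibers.1 hγ
      exact (hleft γ hγ').conj_fiberDilation

lemma planeDist_fiberDilationCLM (hs : 0 < s) (p q : Solv) :
    planeDist (fiberDilationCLM s p) (fiberDilationCLM s q) = s * planeDist p q := by
  simp only [planeDist, fiberDilationCLM_apply]
  rw [← Real.sqrt_sq hs.le, ← Real.sqrt_mul (sq_nonneg s), Real.sqrt_sq hs.le]
  congr 1
  simp
  ring

lemma FibersSmallerThan.rescaleFibers {D : ℝ} (h : FibersSmallerThan π D) (hs : 0 < s) :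
    FibersSmallerThan (rescaleFibers s hs.ne' π) (s * D) := by
  intro p q hpq
  set δ := fiberDilation s hs.ne' with hδ
  have hz : ∀ p : Solv, fiberDilationCLM s⁻¹ p 2 = p 2 := fun p => by
    simp [fiberDilationCLM_apply]
  have hz' : ∀ p : Solv, fiberDilationCLM s p 2 = p 2 := fun p => by
    simp [fiberDilationCLM_apply]
  obtain ⟨γ, hγ, h2, hd⟩ := h (fiberDilationCLM s⁻¹ p) (fiberDilationCLM s⁻¹ q)
    (by rw [hz, hz, hpq])
  refine ⟨_, mem_rescaleFibers.2 ⟨γ, hγ, rfl⟩, ?_, ?_⟩ <;>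
    rw [Equiv.Perm.mul_apply, Equiv.Perm.mul_apply, coe_fiberDilation, coe_fiberDilation_inv]
  · rw [hz', h2, hz]
  · have hp : p = fiberDilationCLM s (fiberDilationCLM s⁻¹ p) := by
      rw [← coe_fiberDilation (hs := hs.ne'), ← coe_fiberDilation_inv (hs := hs.ne')]
      simp
    conv_lhs => rw [hp]
    rw [planeDist_fiberDilationCLM hs]
    exact mul_lt_mul_of_pos_left hd hs

lemma FibersSmallerThan.mono {ε ε' : ℝ} (h : FibersSmallerThan π ε) (hε : ε ≤ ε') :
    FibersSmallerThan π ε' := fun p q hpq => by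
  obtain ⟨γ, hγ, h2, hd⟩ := h p q hpq
  exact ⟨γ, hγ, h2, hd.trans_le hε⟩

end SolvGeometry

end

theorem mainTheorem3 :
    (∃ ε : ℝ, 0 < ε ∧ ∀ π : Subgroup (Equiv.Perm SolvGeometry.Solv),
      SolvGeometry.IsSolvRationalHomologySphere π → SolvGeometry.FibersSmallerThan π ε →
        SolvGeometry.FirstCoexactEigenvalueIsSimpleOne π) ∧
    (∀ π : Subgroup (Equiv.Perm SolvGeometry.Solv),
      SolvGeometry.IsSolvRationalHomologySphere π →
        ∃ s₀ : ℝ, 0 < s₀ ∧ ∀ (s : ℝ) (hs : 0 < s), s < s₀ →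
          SolvGeometry.IsSolvRationalHomologySphere
              (SolvGeometry.rescaleFibers s hs.ne' π) ∧
            SolvGeometry.FirstCoexactEigenvalueIsSimpleOne
              (SolvGeometry.rescaleFibers s hs.ne' π)) := by
  refine ⟨⟨1 / 5, by norm_num, fun π hπ hf => hπ.firstCoexactEigenvalueIsSimpleOne hf⟩,
    fun π hπ => ?_⟩
  obtain ⟨η, Γ, h⟩ := hπ.exists_isFlipExtension
  obtain ⟨D, hD, hsmall⟩ := h.lattice.exists_fibersSmallerThan
  refine ⟨1 / 5 / D, by positivity, fun s hs hlt => ?_⟩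
  have hπs : SolvGeometry.IsSolvRationalHomologySphere
    (SolvGeometry.rescaleFibers s hs.ne' π) := hπ.rescaleFibers
  refine ⟨hπs, hπs.firstCoexactEigenvalueIsSimpleOne ?_⟩
  have hπD : SolvGeometry.FibersSmallerThan π D := fun p q hpq => by
    obtain ⟨γ, hγ, hd⟩ := hsmall p q hpq
    exact ⟨γ, h.le hγ, hd⟩
  exact (hπD.rescaleFibers hs).mono ((lt_div_iff₀ hD).1 hlt).le
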